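/- **Setting and definitions.** Let $V$ be a real vector space of finite dimension at least $2$. An open set $\Omega\subset\mathrm P(V)$ is *properly convex* if it is contained, convex and bounded in some affine chart. Its *dual* $\Omega^*\subset\mathrm P(V^*)$ is the set of projective hyperplanes of $\mathrm P(V)$ that do not meet $\overline\Omega$. $\mathrm{Aut}(\Omega)$ is the group of $g\in\mathrm{PGL}(V)$ with $g\Omega=\Omega$; the group $\mathrm{PGL}(V)$ also acts on $\mathrm P(V^*)$ by $H\mapsto gH$, which identifies it with $\mathrm{PGL}(V^*)$. For a discrete subgroup $\Gamma\subset\mathrm{Aut}(\Omega)$, the *full orbital limit set* $\Lambda^{\mathrm{orb}}_\Omega(\Gamma)$ is the union over $x\in\Omega$ of the sets of accumulation points of the orbits $\Gamma x$. The action of $\Gamma$ on $\Omega$ is *convex cocompact* if the convex hull of $\Lambda^{\mathrm{orb}}_\Omega(\Gamma)$ in $\Omega$ is non-empty and has compact quotient by $\Gamma$. An element $g\in\mathrm{PGL}(V)$ is *proximal* if a lift of $g$ to $\mathrm{GL}(V)$ has exactly one complex eigenvalue of maximal modulus and this eigenvalue has multiplicity one; its eigenline $x_g^+\in\mathrm P(V)$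 is the attracting fixed point of $g$. It is *biproximal* if $g$ and $g^{-1}$ are proximal; its *axis* is then the projective line through $x_g^+$ and $x_g^-:=x_{g^{-1}}^+$, and its *dual axis* is the axis of $g$ acting on $\mathrm P(V^*)$. The *proximal limit set* $\Lambda^{\mathrm{prox}}$ of $\Gamma$ in $\mathrm P(V)$ is the closure of the set of attracting fixed points of proximal elements of $\Gamma$; the proximal limit set of $\Gamma$ in $\mathrm P(V^*)$ is defined in the same way from the action on $\mathrm P(V^*)$. The *straight geodesic* spanned by a unit tangent vector $v\in T^1\Omega$ is the intersection with $\Omega$ of the projective line tangent to $v$; its two endpoints are the intersection points of this line with $\partial\Omega$. $T^1(\Omega/\Gamma)_{\mathrm{bip}}\subset T^1\Omega/\Gamma$ is the set of vectors such that both endpoints of the straight geodesic spanned by any lift to $T^1\Omega$ lie in the proximal limit set of $\Gamma$ in $\mathrm P(V)$; $T^1(\Omega^*/\Gamma)_{\mathrm{bip}}$ is defined in the same way for the action of $\Gamma$ on $\Omega^*\subset\mathrm P(V^*)$. A point of $\partial\Omega$ is *smooth* if it lies on exactly one projective hyperplane disjoint from $\Omega$, and *strongly extremal* if it lies in no non-trivial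 segment contained in $\partial\Omega$. An infinite-order element of $\mathrm{Aut}(\Omega)$ is *rank-one* if it preserves a straight geodesic of $\Omega$ both of whose endpoints are smooth and strongly extremal. The quotient $\Omega/\Gamma$ is *rank-one* if $\Gamma$ contains a rank-one element. **Statement.** Let $\Omega\subset\mathrm P(V)$ be a properly convex open set and let $\Gamma\subset\mathrm{Aut}(\Omega)$ be a discrete subgroup that acts convex cocompactly on $\Omega$. 1. Any biproximal element of $\Gamma$ whose dual axis in $\mathrm P(V^*)$ intersects $\Omega^*$ is rank-one (as an automorphism of $\Omega$). Moreover, if $T^1(\Omega^*/\Gamma)_{\mathrm{bip}}\neq\emptyset$, then $\Omega/\Gamma$ is rank-one. 2. Suppose that $\Gamma$ also acts convex cocompactly on $\Omega^*$. Then any biproximal element of $\Gamma$ whose axis intersects $\Omega$ is rank-one. Moreover, if $T^1(\Omega/\Gamma)_{\mathrm{bip}}\neq\emptyset$, then $\Omega/\Gamma$ is rank-one. -/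

import Mathlib

open scoped LinearAlgebra.Projectivization Pointwise Topology

namespace ConvProj

section Basic

variable (V : Type*) [NormedAddCommGroup V] [NormedSpace ℝ V]

/-- The projective space `P(V)` carries the quotient topology of `V \ {0}`. -/
instance instTopologicalSpaceProj : TopologicalSpace (ℙ ℝ V) :=
  inferInstanceAs (TopologicalSpace (Quotient (projectivizationSetoid ℝ V)))

/-- `GL(V)`, with its topology coming from the operator norm (for finite-dimensional `V` every
linear map is continuous). -/
abbrev GLin : Type _ := (V →L[ℝ] V)ˣ

/-- The subgroup `ℝ^* · id` of homotheties in `GL(V)`. -/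
def scalars : Subgroup (GLin V) :=
  (Units.map (algebraMap ℝ (V →L[ℝ] V)).toMonoidHom).range

variable {V} in
theorem mem_scalars {u : GLin V} :
    u ∈ scalars V ↔ ∃ c : ℝˣ, ∀ v : V, (u : V →L[ℝ] V) v = (c : ℝ) • v := by
  constructor
  · rintro ⟨c, rfl⟩
    exact ⟨c, fun v => by simp [Algebra.algebraMap_eq_smul_one]⟩
  · rintro ⟨c, hc⟩
    refine ⟨c, ?_⟩
    ext v
    simp [Algebra.algebraMap_eq_smul_one, hc]

instance : (scalars V).Normal where
  conj_mem := by
    rintro n hn g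
    obtain ⟨c, hc⟩ := mem_scalars.1 hn
    refine mem_scalars.2 ⟨c, fun v => ?_⟩
    have h : (g : V →L[ℝ] V) (((g⁻¹ : GLin V) : V →L[ℝ] V) v) = v := by
      rw [← mul_apply_eq_comp, ← Units.val_mul, mul_inv_cancel]; rfl
    simp only [Units.val_mul, mul_apply_eq_comp, hc, map_smul, h]

/-- `PGL(V) = GL(V) / ℝ^*`, with its quotient group structure and quotient topology. -/
abbrev PGL : Type _ := GLin V ⧸ scalars V

/-- `PGL(V)` acts on `P(V)` by `[u] • [v] = [u v]`. -/
noncomputable instance instMulActionPGL : MulAction (PGL V) (ℙ ℝ V) :=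
  MulAction.compHom (ℙ ℝ V)
    (QuotientGroup.lift (scalars V) (MulAction.toPermHom (GLin V) (ℙ ℝ V)) (by
      intro u hu
      obtain ⟨c, hc⟩ := mem_scalars.1 hu
      ext x
      induction x using Projectivization.ind with
      | h v hv =>
        rw [MulAction.toPermHom_apply, MulAction.toPerm_apply, Equiv.Perm.one_apply,
          Projectivization.smul_mk, Projectivization.mk_eq_mk_iff]
        exact ⟨c, (hc v).symm⟩))

variable {V} in
theorem mk_smul_mk (u : GLin V) (v : V) (hv : v ≠ 0) (huv : (u : V →L[ℝ] V) v ≠ 0) :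
    (u : PGL V) • Projectivization.mk ℝ v hv =
      Projectivization.mk ℝ ((u : V →L[ℝ] V) v) huv := rfl

/-- The contragredient map `GL(V) → GL(V^*)`, `u ↦ (f ↦ f ∘ u⁻¹)`. -/
noncomputable def contragredientGL : GLin V →* GLin (StrongDual ℝ V) where
  toFun u :=
    { val := (ContinuousLinearMap.compL ℝ V V ℝ).flip ((u⁻¹ : GLin V) : V →L[ℝ] V)
      inv := (ContinuousLinearMap.compL ℝ V V ℝ).flip (u : V →L[ℝ] V)
      val_inv := by
        ext f v
        simp [← mul_apply_eq_comp]
      inv_val := by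
        ext f v
        simp [← mul_apply_eq_comp] }
  map_one' := by ext f v; simp
  map_mul' u w := by ext f v; simp

theorem contragredientGL_apply (u : GLin V) (f : StrongDual ℝ V) (v : V) :
    (contragredientGL V u : StrongDual ℝ V →L[ℝ] StrongDual ℝ V) f v =
      f (((u⁻¹ : GLin V) : V →L[ℝ] V) v) := rfl

/-- The natural map `PGL(V) → PGL(V^*)`, through which `PGL(V)` acts on `P(V^*)`; in terms of
hyperplanes, `g` sends the hyperplane `H` to `g H`. -/
noncomputable def contragredient : PGL V →* PGL (StrongDual ℝ V) :=
  QuotientGroup.map (scalars V) (scalars (StrongDual ℝ V)) (contragredientGL V) (by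
    intro u hu
    obtain ⟨c, hc⟩ := mem_scalars.1 ((scalars V).inv_mem hu)
    refine mem_scalars.2 ⟨c, fun f => ?_⟩
    ext v
    rw [contragredientGL_apply, hc]
    simp)

end Basic

section ConvexSets

variable {V : Type*} [NormedAddCommGroup V] [NormedSpace ℝ V]

/-- The set of nonzero vectors of `V` whose class lies in `S ⊆ P(V)`. -/
def cone (S : Set (ℙ ℝ V)) : Set V :=
  {v | ∃ hv : v ≠ 0, Projectivization.mk ℝ v hv ∈ S}

/-- A linear form whose kernel, a projective hyperplane, does not meet `S`: then `S` lies in the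
affine chart `{φ ≠ 0} ≅ {v | φ v = 1}`. -/
def Avoids (φ : StrongDual ℝ V) (S : Set (ℙ ℝ V)) : Prop := ∀ v ∈ cone S, φ v ≠ 0

/-- The trace of `S ⊆ P(V)` in the affine chart `{v | φ v = 1}` of `P(V)`. -/
def chart (φ : StrongDual ℝ V) (S : Set (ℙ ℝ V)) : Set V := {v | φ v = 1 ∧ v ∈ cone S}

/-- `Ω` is properly convex: it is convex and bounded in some affine chart that contains it. -/
def IsProperlyConvex (Ω : Set (ℙ ℝ V)) : Prop :=
  ∃ φ : StrongDual ℝ V, Avoids φ Ω ∧ Convex ℝ (chart φ Ω) ∧ Bornology.IsBounded (chart φ Ω)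

/-- The convex hull in `Ω` of a subset `S` of the closure of `Ω`, computed in an affine chart that
contains the closure of `Ω`. -/
def hullIn (Ω S : Set (ℙ ℝ V)) : Set (ℙ ℝ V) :=
  {x | x ∈ Ω ∧ ∃ φ : StrongDual ℝ V, Avoids φ (closure Ω) ∧
    ∃ v ∈ convexHull ℝ (chart φ S), ∃ hv : v ≠ 0, x = Projectivization.mk ℝ v hv}

/-- `x` lies on the projective hyperplane `[f]`, a point of `P(V^*)`. -/
def OnHyperplane (x : ℙ ℝ V) (f : ℙ ℝ (StrongDual ℝ V)) : Prop := f.rep x.rep = 0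

/-- The dual `Ω^* ⊆ P(V^*)`: the hyperplanes that do not meet the closure of `Ω`. -/
def dual (Ω : Set (ℙ ℝ V)) : Set (ℙ ℝ (StrongDual ℝ V)) :=
  {f | ∀ x ∈ closure Ω, ¬ OnHyperplane x f}

/-- A boundary point is smooth if it has exactly one supporting hyperplane, i.e. exactly one
hyperplane through it does not meet the (convex open) set `Ω`. -/
def IsSmoothPoint (Ω : Set (ℙ ℝ V)) (ξ : ℙ ℝ V) : Prop :=
  ∃! f : ℙ ℝ (StrongDual ℝ V), OnHyperplane ξ f ∧ ∀ x ∈ Ω, ¬ OnHyperplane x f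

/-- The projective segment consisting of the `[s u + t w]`, where `s, t ≥ 0` are not both `0`. It is
a segment that is not reduced to a point if `u` and `w` are linearly independent. -/
def segmentOf (u w : V) : Set (ℙ ℝ V) :=
  {x | ∃ s t : ℝ, 0 ≤ s ∧ 0 ≤ t ∧ ∃ h : s • u + t • w ≠ 0,
    x = Projectivization.mk ℝ (s • u + t • w) h}

/-- A point is strongly extremal if it lies on no non-trivial segment contained in `∂Ω`. -/
def IsStronglyExtremal (Ω : Set (ℙ ℝ V)) (ξ : ℙ ℝ V) : Prop :=
  ¬ ∃ u w : V, LinearIndependent ℝ ![u, w] ∧ ξ ∈ segmentOf u w ∧ segmentOf u w ⊆ frontier Ω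

/-- The set `∂_sse Ω` of smooth strongly extremal boundary points. -/
def sseBoundary (Ω : Set (ℙ ℝ V)) : Set (ℙ ℝ V) :=
  {ξ | ξ ∈ frontier Ω ∧ IsSmoothPoint Ω ξ ∧ IsStronglyExtremal Ω ξ}

/-- The span of two points of `P(V)`: the projective line through them if they are distinct. -/
def projLine (x y : ℙ ℝ V) : Set (ℙ ℝ V) := {z | z.submodule ≤ x.submodule ⊔ y.submodule}

/-- The unit tangent bundle `T¹Ω` of a properly convex open set `Ω`: a unit tangent vector `v` is
determined by its footpoint `π v ∈ Ω` and by the point `φ_∞ v ∈ ∂Ω` at which it aims. -/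
structure UnitTangent (Ω : Set (ℙ ℝ V)) where
  /-- the footpoint `π v` -/
  foot : ℙ ℝ V
  /-- the forward endpoint `φ_∞ v` -/
  fwd : ℙ ℝ V
  foot_mem : foot ∈ Ω
  fwd_mem : fwd ∈ frontier Ω

/-- The straight geodesic of `Ω` spanned by `v`. -/
def UnitTangent.geodesic {Ω : Set (ℙ ℝ V)} (v : UnitTangent Ω) : Set (ℙ ℝ V) :=
  projLine v.foot v.fwd ∩ Ω

/-- The set `{φ_∞ v, φ_{-∞} v}` of the two endpoints of the straight geodesic spanned by `v`, i.e.
the intersection points with `∂Ω` of the projective line generated by `v`. -/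
def UnitTangent.ends {Ω : Set (ℙ ℝ V)} (v : UnitTangent Ω) : Set (ℙ ℝ V) :=
  projLine v.foot v.fwd ∩ frontier Ω

/-- The vector `v` is rank-one if both endpoints of its geodesic are in `∂_sse Ω`. -/
def UnitTangent.IsRankOne {Ω : Set (ℙ ℝ V)} (v : UnitTangent Ω) : Prop :=
  v.ends ⊆ sseBoundary Ω

end ConvexSets

section Groups

variable {V : Type*} [NormedAddCommGroup V] [NormedSpace ℝ V]

/-- The group of automorphisms of `Ω`. -/
noncomputable def Aut (Ω : Set (ℙ ℝ V)) : Subgroup (PGL V) := MulAction.stabilizer (PGL V) Ω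

/-- The full orbital limit set: the accumulation points of the orbits of the points of `Ω`. -/
def orbLimitSet (Γ : Subgroup (PGL V)) (Ω : Set (ℙ ℝ V)) : Set (ℙ ℝ V) :=
  {ξ | ∃ x ∈ Ω, AccPt ξ (Filter.principal {y | ∃ γ ∈ Γ, y = γ • x})}

/-- The convex hull in `Ω` of the full orbital limit set. -/
def core (Γ : Subgroup (PGL V)) (Ω : Set (ℙ ℝ V)) : Set (ℙ ℝ V) := hullIn Ω (orbLimitSet Γ Ω)

/-- The quotient of a `Γ`-invariant set `C ⊆ P(V)` by `Γ`, with the quotient topology. -/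
abbrev QuotientBy (Γ : Subgroup (PGL V)) (C : Set (ℙ ℝ V)) : Type _ :=
  Quot fun x y : C => ∃ γ ∈ Γ, γ • (x : ℙ ℝ V) = y

/-- Convex cocompactness of the action of a discrete group `Γ` of automorphisms of the properly
convex open set `Ω`. -/
def ActsConvexCocompactly (Γ : Subgroup (PGL V)) (Ω : Set (ℙ ℝ V)) : Prop :=
  (core Γ Ω).Nonempty ∧ CompactSpace (QuotientBy Γ (core Γ Ω))

/-- An infinite-order automorphism of `Ω` is rank-one if it preserves a rank-one geodesic. -/
def IsRankOne (Ω : Set (ℙ ℝ V)) (g : PGL V) : Prop :=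
  g ∈ Aut Ω ∧ ¬ IsOfFinOrder g ∧
    ∃ v : UnitTangent Ω, v.IsRankOne ∧ g • v.geodesic = v.geodesic

/-- The quotient `Ω/Γ` is rank-one if `Γ` contains a rank-one element. -/
def QuotientIsRankOne (Γ : Subgroup (PGL V)) (Ω : Set (ℙ ℝ V)) : Prop :=
  ∃ γ ∈ Γ, IsRankOne Ω γ

/-- `T¹(Ω/Γ) = T¹Ω / Γ`. -/
abbrev QuotientUnitTangent (Γ : Subgroup (PGL V)) (Ω : Set (ℙ ℝ V)) : Type _ :=
  Quot fun v w : UnitTangent Ω => ∃ γ ∈ Γ, γ • v.foot = w.foot ∧ γ • v.fwd = w.fwd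

variable [FiniteDimensional ℝ V]

/-- The complex number `z` is an eigenvalue of `T` of (algebraic) multiplicity one and all other
complex eigenvalues of `T` have smaller modulus. -/
def IsDominantEigenvalue (T : V →L[ℝ] V) (z : ℂ) : Prop :=
  ((T : V →ₗ[ℝ] V).charpoly.aroots ℂ).count z = 1 ∧
    ∀ w ∈ (T : V →ₗ[ℝ] V).charpoly.aroots ℂ, w ≠ z → ‖w‖ < ‖z‖

/-- `g ∈ PGL(V)` is proximal if its lifts to `GL(V)` have exactly one complex eigenvalue of maximal
modulus, of multiplicity one (this does not depend on the lift). -/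
def IsProximal (g : PGL V) : Prop :=
  ∃ u : GLin V, (u : PGL V) = g ∧ ∃ z : ℂ, IsDominantEigenvalue (u : V →L[ℝ] V) z

/-- `x` is the attracting fixed point of the proximal element `g`: the eigenline of the dominant
eigenvalue (which is real, as the other eigenvalues have smaller modulus). -/
def IsAttractingPoint (g : PGL V) (x : ℙ ℝ V) : Prop :=
  ∃ u : GLin V, (u : PGL V) = g ∧ ∃ r : ℝ, IsDominantEigenvalue (u : V →L[ℝ] V) (r : ℂ) ∧
    (u : V →L[ℝ] V) x.rep = r • x.rep

/-- `g` is biproximal if `g` and `g⁻¹` are proximal. -/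
def IsBiproximal (g : PGL V) : Prop := IsProximal g ∧ IsProximal g⁻¹

/-- The axis of a biproximal element: the line through its attracting fixed point and its repelling
fixed point (the attracting fixed point of `g⁻¹`). -/
def axis (g : PGL V) : Set (ℙ ℝ V) :=
  {z | ∃ x y : ℙ ℝ V, IsAttractingPoint g x ∧ IsAttractingPoint g⁻¹ y ∧ z ∈ projLine x y}

/-- The proximal limit set: the closure of the set of attracting fixed points of proximal
elements. -/
def proxLimitSet (Γ : Subgroup (PGL V)) : Set (ℙ ℝ V) :=
  closure {x | ∃ γ ∈ Γ, IsAttractingPoint γ x}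

/-- The biproximal unit tangent bundle: the `v ∈ T¹(Ω/Γ)` such that both endpoints of the geodesic
spanned by any lift of `v` to `T¹Ω` are in the proximal limit set. -/
def bipUnitTangent (Γ : Subgroup (PGL V)) (Ω : Set (ℙ ℝ V)) : Set (QuotientUnitTangent Γ Ω) :=
  {q | ∀ v : UnitTangent Ω, Quot.mk _ v = q → v.ends ⊆ proxLimitSet Γ}

end Groups

end ConvProj

/-! The problem becomes linear on one half `C` of the cone over Ω, acted on by the group `G` of
lifts of Γ preserving `C`. A proximal element, scaled to have dominant eigenvalue 1, has powers
converging to a projection `v ↦ f v • y`, with `y` in the closure of `C` and `f` nonnegative there.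
For a biproximal element with data `(x, f)` and `(x', f')`, the axis meets Ω exactly when `x + x' ∈
C`, and the dual axis meets Ω* exactly when `f + f'` is positive on the closure of `C` minus 0.

The core is `mem_of_bounded_of_posOn`. Let `w` be a sum of limit vectors that `S₁` and `S₂` move by
bounded factors for the order defined by the cone. Cocompactness brings the points `w + t c`, `t →
0`, back to a compact set by elements of `G`. These conjugate `S₁` and `S₂` into a bounded set, so
by discreteness the conjugates are eventually constant up to scalars, and quotients of the returning
elements commute with `S₁` and `S₂`. Such quotients multiply `f₁` and `f₂` by scalars; if both forms
are positive at `w` and `f₁ + f₂` is coercive, the quotients stay bounded, which forces `w ∈ C`.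
With `w = x + x'` this shows that the axis meets Ω as soon as the dual axis meets Ω*
(`IsBiprox.add_mem`).

When both axes meet their domains, north-south dynamics makes the attracting point strongly
extremal, and the same dynamics on the dual cone makes it smooth; hence the element is rank-one
(`IsConeOver.isRankOne`).

For the existence statements, density of attracting points gives two proximal elements with `f₁ +
f₂` positive. A product `S₂⁻ᵐ δ S₁ⁿ` and its inverse are then close, after scaling, to rank-one
operators of nonzero trace, so both are proximal with forms near `f₁` and `f₂`
(`IsPosProx.exists_isBiprox`). A suitable `δ` comes from the core lemma, except when an attracting
point is fixed by all of `G`; in that case the commuting elements already give the biproximal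
element. Part 2 applies all this to the dual action and returns through biduality. -/

namespace ConvProj

/-! ### Sharp cones, the order they define, and proximal operators -/

section Cone

open Filter Set

variable {E : Type*} [NormedAddCommGroup E] [NormedSpace ℝ E]

/-- A nonempty open convex cone whose closure contains no line. -/
structure IsSharpCone (C : Set E) : Prop where
  isOpen : IsOpen C
  add_mem : ∀ u ∈ C, ∀ v ∈ C, u + v ∈ C
  smul_mem : ∀ t : ℝ, 0 < t → ∀ v ∈ C, t • v ∈ C
  nonempty : C.Nonempty
  exists_coercive : ∃ φ : StrongDual ℝ E, ∃ ε > 0, ∀ v ∈ C, ε * ‖v‖ ≤ φ v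
  zero_notMem : (0 : E) ∉ C

/-- A linear form that is positive on the closure of `C` without the origin. -/
def PosOn (C : Set E) (f : StrongDual ℝ E) : Prop := ∀ v ∈ closure C, v ≠ 0 → 0 < f v

namespace IsSharpCone

variable {C : Set E} (hC : IsSharpCone C)
include hC

theorem add_mem_closure {u v : E} (hu : u ∈ closure C) (hv : v ∈ closure C) :
    u + v ∈ closure C :=
  map_mem_closure₂ continuous_add hu hv hC.add_mem

theorem zero_mem_closure : (0 : E) ∈ closure C := by
  obtain ⟨c, hc⟩ := hC.nonempty
  have h : Tendsto (fun n : ℕ => (1 / ((n : ℝ) + 1)) • c) atTop (𝓝 ((0 : ℝ) • c)) :=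
    tendsto_one_div_add_atTop_nhds_zero_nat.smul_const c
  rw [zero_smul] at h
  exact mem_closure_of_tendsto h (Eventually.of_forall fun n => hC.smul_mem _ (by positivity) _ hc)

theorem smul_mem_closure {t : ℝ} (ht : 0 ≤ t) {v : E} (hv : v ∈ closure C) :
    t • v ∈ closure C := by
  rcases ht.eq_or_lt with rfl | ht
  · simpa using hC.zero_mem_closure
  · exact map_mem_closure (continuous_const_smul t) hv (fun x hx => hC.smul_mem t ht x hx)

theorem add_closure_mem {c x : E} (hc : c ∈ C) (hx : x ∈ closure C) : c + x ∈ C := by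
  have h1 : IsOpen ((fun y => c + x - y) ⁻¹' C) :=
    hC.isOpen.preimage (by fun_prop)
  have h2 : x ∈ (fun y => c + x - y) ⁻¹' C := by simpa using hc
  obtain ⟨y, hy, hyC⟩ := mem_closure_iff.1 hx _ h1 h2
  have := hC.add_mem _ hy _ hyC
  simpa using this

theorem exists_coercive_closure : ∃ φ : StrongDual ℝ E, ∃ ε > 0, ∀ v ∈ closure C, ε * ‖v‖ ≤ φ v := by
  obtain ⟨φ, ε, hε, h⟩ := hC.exists_coercive
  refine ⟨φ, ε, hε, fun v hv => ?_⟩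
  have hcl : IsClosed {v : E | ε * ‖v‖ ≤ φ v} := isClosed_le (by fun_prop) (by fun_prop)
  exact closure_minimal h hcl hv

theorem eq_zero_of_neg_mem {v : E} (hv : v ∈ closure C) (hv' : -v ∈ closure C) : v = 0 := by
  obtain ⟨φ, ε, hε, h⟩ := hC.exists_coercive_closure
  have h1 := h v hv
  have h2 := h _ hv'
  rw [norm_neg, map_neg] at h2
  have : ‖v‖ ≤ 0 := by nlinarith
  exact norm_le_zero_iff.1 this

/-- The cone is normal: the coercive form is monotone for the order and controls norms. -/
theorem exists_norm_le : ∃ M > 0, ∀ u v : E, u ∈ closure C → v - u ∈ closure C →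
    ‖u‖ ≤ M * ‖v‖ := by
  obtain ⟨φ, ε, hε, h⟩ := hC.exists_coercive_closure
  refine ⟨(‖φ‖ + 1) / ε, by positivity, fun u v hu hvu => ?_⟩
  have h1 := h u hu
  have h2 := h _ hvu
  have h3 : φ v ≤ ‖φ‖ * ‖v‖ := (le_abs_self _).trans (φ.le_opNorm v)
  rw [map_sub] at h2
  have h4 : 0 ≤ ε * ‖v - u‖ := by positivity
  rw [div_mul_eq_mul_div, le_div_iff₀ hε]
  nlinarith [norm_nonneg v]

/-- A compact subset of the open cone has a uniform thickening inside it, so its points are order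
units with a common constant. -/
theorem exists_dominate_of_isCompact {K : Set E} (hK : IsCompact K) (hKC : K ⊆ C) :
    ∃ k > 0, ∀ q ∈ K, ∀ v : E, (k * ‖v‖) • q - v ∈ closure C := by
  obtain ⟨r, hr, hrC⟩ := hK.exists_thickening_subset_open hC.isOpen hKC
  refine ⟨2 / r, by positivity, fun q hq v => ?_⟩
  rcases eq_or_ne v 0 with rfl | hv
  · simpa using hC.zero_mem_closure
  have hv' : 0 < ‖v‖ := norm_pos_iff.2 hv
  have h1 : q - (r / (2 * ‖v‖)) • v ∈ C := by
    apply hrC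
    rw [Metric.mem_thickening_iff]
    refine ⟨q, hq, ?_⟩
    rw [dist_eq_norm, sub_sub_cancel_left, norm_neg, norm_smul, Real.norm_of_nonneg (by positivity)]
    field_simp
    linarith
  have h2 := hC.smul_mem (2 / r * ‖v‖) (by positivity) _ h1
  rw [smul_sub, smul_smul] at h2
  have h3 : 2 / r * ‖v‖ * (r / (2 * ‖v‖)) = 1 := by field_simp
  rw [h3, one_smul] at h2
  exact subset_closure h2

theorem exists_dominate {c : E} (hc : c ∈ C) :
    ∃ k > 0, ∀ v : E, (k * ‖v‖) • c - v ∈ closure C := by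
  obtain ⟨k, hk, h⟩ := hC.exists_dominate_of_isCompact (isCompact_singleton (x := c)) (by simpa using hc)
  exact ⟨k, hk, fun v => h c rfl v⟩

/-- A positive operator is controlled by its values on a compact subset of the cone. -/
theorem exists_opNorm_le_of_isCompact {K : Set E} (hK : IsCompact K) (hKC : K ⊆ C) :
    ∃ M > 0, ∀ q ∈ K, ∀ T : E →L[ℝ] E, MapsTo T (closure C) (closure C) → ‖T‖ ≤ M * ‖T q‖ := by
  obtain ⟨k, hk, h⟩ := hC.exists_dominate_of_isCompact hK hKC
  obtain ⟨M, hM, hn⟩ := hC.exists_norm_le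
  refine ⟨(2 * M + 1) * k, by positivity, fun q hq T hT => ?_⟩
  refine T.opNorm_le_bound (by positivity) fun v => ?_
  -- Positivity of `T` traps `T v` between `-(k‖v‖) • T q` and `(k‖v‖) • T q`; normality turns this
  -- order bound into a norm bound.
  have h1 := hT (h q hq v)
  have h2 := hT (h q hq (-v))
  rw [map_sub, map_smul] at h1 h2
  rw [norm_neg, map_neg, sub_neg_eq_add] at h2
  have h3 := hn ((k * ‖v‖) • T q + T v) ((2 * (k * ‖v‖)) • T q) h2 (by
    have : (2 * (k * ‖v‖)) • T q - ((k * ‖v‖) • T q + T v) = (k * ‖v‖) • T q - T v := by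
      rw [two_mul, add_smul]; abel
    rwa [this])
  have h4 : ‖T v‖ ≤ ‖(k * ‖v‖) • T q + T v‖ + ‖(k * ‖v‖) • T q‖ := by
    have := norm_sub_le ((k * ‖v‖) • T q + T v) ((k * ‖v‖) • T q)
    rwa [add_sub_cancel_left] at this
  rw [norm_smul, Real.norm_of_nonneg (by positivity)] at h3 h4
  calc ‖T v‖ ≤ _ := h4
    _ ≤ M * (2 * (k * ‖v‖) * ‖T q‖) + k * ‖v‖ * ‖T q‖ := by gcongr
    _ = _ := by ring

theorem exists_opNorm_le {c : E} (hc : c ∈ C) :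
    ∃ M > 0, ∀ T : E →L[ℝ] E, MapsTo T (closure C) (closure C) → ‖T‖ ≤ M * ‖T c‖ := by
  obtain ⟨k, hk, h⟩ := hC.exists_opNorm_le_of_isCompact (isCompact_singleton (x := c)) (by simpa using hc)
  exact ⟨k, hk, fun v => h c rfl v⟩

theorem pos_of_nonneg {f : StrongDual ℝ E} (hf : ∀ v ∈ closure C, 0 ≤ f v) (hf0 : f ≠ 0)
    {c : E} (hc : c ∈ C) : 0 < f c := by
  obtain ⟨v, hv⟩ : ∃ v, f v ≠ 0 := by
    by_contra! h
    exact hf0 (ContinuousLinearMap.ext h)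
  obtain ⟨k, hk, h⟩ := hC.exists_dominate hc
  have h1 := hf _ (h v)
  have h2 := hf _ (h (-v))
  simp only [map_sub, map_smul, map_neg, norm_neg, smul_eq_mul] at h1 h2
  have hkv : 0 ≤ k * ‖v‖ := by positivity
  have : 0 < |f v| := abs_pos.2 hv
  by_contra! hc0
  have h3 : k * ‖v‖ * f c ≤ 0 := mul_nonpos_of_nonneg_of_nonpos hkv hc0
  apply hv; linarith

/-- A nonzero positive operator does not vanish on the open cone. -/
theorem apply_ne_zero {T : E →L[ℝ] E} (hT : MapsTo T (closure C) (closure C)) (hT0 : T ≠ 0)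
    {c : E} (hc : c ∈ C) : T c ≠ 0 := by
  intro h
  obtain ⟨M, hM, hn⟩ := hC.exists_opNorm_le hc
  have := hn T hT
  rw [h, norm_zero, mul_zero] at this
  exact hT0 (norm_le_zero_iff.1 this)

theorem exists_lower_bound [FiniteDimensional ℝ E] {f : StrongDual ℝ E} (hf : PosOn C f) :
    ∃ ε > 0, ∀ v ∈ closure C, ε * ‖v‖ ≤ f v := by
  have : ProperSpace E := FiniteDimensional.proper_real E
  have hcpt : IsCompact (closure C ∩ Metric.sphere (0 : E) 1) :=
    (isCompact_sphere (0 : E) 1).inter_left isClosed_closure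
  rcases (closure C ∩ Metric.sphere (0 : E) 1).eq_empty_or_nonempty with he | hne
  · refine ⟨1, one_pos, fun v hv => ?_⟩
    have : v = 0 := by
      by_contra hv0
      have : ‖v‖⁻¹ • v ∈ closure C ∩ Metric.sphere (0 : E) 1 :=
        ⟨hC.smul_mem_closure (by positivity) hv, by simp [norm_smul, hv0]⟩
      rw [he] at this
      exact this
    simp [this]
  · obtain ⟨x, hx, hmin⟩ := hcpt.exists_isMinOn hne f.continuous.continuousOn
    have hx0 : x ≠ 0 := by
      rintro rfl
      simpa using hx.2
    refine ⟨f x, hf x hx.1 hx0, fun v hv => ?_⟩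
    rcases eq_or_ne v 0 with rfl | hv0
    · simp
    have h1 : f x ≤ f (‖v‖⁻¹ • v) :=
      hmin ⟨hC.smul_mem_closure (by positivity) hv, by simp [norm_smul, hv0]⟩
    have hv' : 0 < ‖v‖ := norm_pos_iff.2 hv0
    rw [map_smul, smul_eq_mul] at h1
    calc f x * ‖v‖ ≤ ‖v‖⁻¹ * f v * ‖v‖ := by gcongr
      _ = f v := by field_simp

end IsSharpCone

/-- The powers of `S` converge to the rank-one projection `v ↦ f v • y`. -/
def IsProx (S : E →L[ℝ] E) (y : E) (f : StrongDual ℝ E) : Prop :=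
  Tendsto (fun n : ℕ => S ^ n) atTop (𝓝 (f.smulRight y)) ∧ f y = 1

namespace IsProx

variable {S : E →L[ℝ] E} {y : E} {f : StrongDual ℝ E} (h : IsProx S y f)
include h

theorem ne_zero : y ≠ 0 := by
  rintro rfl
  simpa using h.2

theorem form_ne_zero : f ≠ 0 := by
  rintro rfl
  simpa using h.2

theorem apply_self : S y = y := by
  have h1 : Tendsto (fun n : ℕ => S ^ (n + 1)) atTop (𝓝 (S * f.smulRight y)) := by
    simp_rw [pow_succ']
    exact tendsto_const_nhds.mul h.1
  have h2 := tendsto_nhds_unique h1 ((tendsto_add_atTop_iff_nat 1).2 h.1)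
  have h3 := congrArg (fun T : E →L[ℝ] E => T y) h2
  simpa [h.2] using h3

theorem form_apply (v : E) : f (S v) = f v := by
  have h1 : Tendsto (fun n : ℕ => S ^ (n + 1)) atTop (𝓝 (f.smulRight y * S)) := by
    simp_rw [pow_succ]
    exact h.1.mul tendsto_const_nhds
  have h2 := tendsto_nhds_unique h1 ((tendsto_add_atTop_iff_nat 1).2 h.1)
  have h3 := congrArg (fun T : E →L[ℝ] E => f (T v)) h2
  simpa [h.2] using h3

theorem tendsto_apply (v : E) : Tendsto (fun n : ℕ => (S ^ n) v) atTop (𝓝 (f v • y)) := by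
  have := (ContinuousLinearMap.apply ℝ E v).continuous.continuousAt.tendsto.comp h.1
  simpa [Function.comp_def] using this

/-- An operator commuting with `S` commutes with the limit projection, so it preserves both the
image line and the kernel. -/
theorem of_commute {Z : E →L[ℝ] E} (hZ : Z * S = S * Z) (v : E) :
    f (Z v) = f (Z y) * f v ∧ Z y = f (Z y) • y := by
  have hc : ∀ n : ℕ, Z * S ^ n = S ^ n * Z := fun n => (Commute.pow_right hZ n)
  have h1 : Tendsto (fun n : ℕ => Z * S ^ n) atTop (𝓝 (Z * f.smulRight y)) :=
    tendsto_const_nhds.mul h.1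
  have h2 : Tendsto (fun n : ℕ => Z * S ^ n) atTop (𝓝 (f.smulRight y * Z)) := by
    simp_rw [hc]
    exact h.1.mul tendsto_const_nhds
  have h3 := tendsto_nhds_unique h1 h2
  have h4 : ∀ x, f x • Z y = f (Z x) • y := fun x => by
    have := congrArg (fun T : E →L[ℝ] E => T x) h3
    simpa using this
  constructor
  · have := congrArg f (h4 v)
    simp only [map_smul, smul_eq_mul, h.2, mul_one] at this
    rw [← this, mul_comm]
  · have := h4 y
    rwa [h.2, one_smul] at this

end IsProx

theorem IsProx.inv_apply_self {S : GLin E} {y : E} {f : StrongDual ℝ E} (h : IsProx S.1 y f) :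
    S⁻¹.1 y = y := by
  conv_lhs => rw [← h.apply_self]
  rw [← mul_apply_eq_comp, ← Units.val_mul, inv_mul_cancel]; rfl

theorem val_apply_inv_apply (S : GLin E) (v : E) : S.1 (S⁻¹.1 v) = v := by
  rw [← mul_apply_eq_comp, ← Units.val_mul, mul_inv_cancel]; rfl

theorem inv_apply_val_apply (S : GLin E) (v : E) : S⁻¹.1 (S.1 v) = v := by
  rw [← mul_apply_eq_comp, ← Units.val_mul, inv_mul_cancel]; rfl

theorem val_mul_apply (S T : GLin E) (v : E) : (S * T).1 v = S.1 (T.1 v) := rfl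

theorem IsProx.form_inv_apply {S : GLin E} {y : E} {f : StrongDual ℝ E} (h : IsProx S.1 y f)
    (v : E) : f (S⁻¹.1 v) = f v := by
  conv_rhs => rw [← val_apply_inv_apply S v, h.form_apply]

theorem IsProx.form_inv_pow_apply {S : GLin E} {y : E} {f : StrongDual ℝ E} (h : IsProx S.1 y f)
    (n : ℕ) (v : E) : f ((S⁻¹ ^ n).1 v) = f v := by
  induction n generalizing v with
  | zero => rfl
  | succ n ih => rw [pow_succ, val_mul_apply, ih, h.form_inv_apply]

/-- The fixed nonzero vector `z - f z • y` is the image of `S⁻ⁿ z` under `Sⁿ - f.smulRight y`, whose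
norm tends to 0, so `S⁻ⁿ z` must blow up. -/
theorem IsProx.tendsto_norm_inv_pow {S : GLin E} {y : E} {f : StrongDual ℝ E}
    (h : IsProx S.1 y f) {z : E} (hz : z ≠ f z • y) :
    Tendsto (fun n : ℕ => ‖(S⁻¹ ^ n).1 z‖) atTop atTop := by
  have hv : 0 < ‖z - f z • y‖ := norm_pos_iff.2 (sub_ne_zero.2 hz)
  have hle : ∀ n : ℕ, ‖z - f z • y‖ ≤ ‖S.1 ^ n - f.smulRight y‖ * ‖(S⁻¹ ^ n).1 z‖ := by
    intro n
    have h1 : z - f z • y = (S.1 ^ n - f.smulRight y) ((S⁻¹ ^ n).1 z) := by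
      have h2 : (S.1 ^ n) ((S⁻¹ ^ n).1 z) = z := by
        have := val_apply_inv_apply (S ^ n) z
        rwa [← inv_pow, Units.val_pow_eq_pow_val] at this
      rw [sub_apply, h2, ContinuousLinearMap.smulRight_apply,
        h.form_inv_pow_apply]
    rw [h1]
    exact ContinuousLinearMap.le_opNorm _ _
  have h0 : Tendsto (fun n : ℕ => ‖S.1 ^ n - f.smulRight y‖) atTop (𝓝 0) :=
    tendsto_iff_norm_sub_tendsto_zero.1 h.1
  refine tendsto_atTop.2 fun b => ?_
  have hb : 0 < |b| + 1 := by positivity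
  filter_upwards [h0.eventually_lt_const (div_pos hv hb)] with n hn
  by_contra! hlt
  have h3 := hle n
  have h4 : ‖(S⁻¹ ^ n).1 z‖ ≤ |b| + 1 := by linarith [le_abs_self b]
  have : ‖S.1 ^ n - f.smulRight y‖ * ‖(S⁻¹ ^ n).1 z‖ < ‖z - f z • y‖ := by
    calc _ ≤ ‖S.1 ^ n - f.smulRight y‖ * (|b| + 1) := by gcongr
      _ < ‖z - f z • y‖ / (|b| + 1) * (|b| + 1) := by gcongr
      _ = _ := by field_simp
  linarith

end Cone

/-! ### Cocompact actions on cones and almost centralising elements -/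

section Action

open Filter Set

variable {E : Type*} [NormedAddCommGroup E] [NormedSpace ℝ E]

/-- Nonzero limits, outside the open cone `C`, of sequences in the `G`-orbit of a point of `C`. -/
def IsLimitVector (C : Set E) (G : Subgroup (GLin E)) (y : E) : Prop :=
  y ≠ 0 ∧ y ∉ C ∧ ∃ x ∈ C, ∃ u : ℕ → GLin E, (∀ n, u n ∈ G) ∧
    Tendsto (fun n => (u n).1 x) atTop (𝓝 y)

/-- A discrete group, up to homotheties, of linear automorphisms of the sharp cone `C`, acting
cocompactly on a nonempty subset of `C` that is stable under adding limit vectors. -/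
structure IsCocompactAction (C : Set E) (G : Subgroup (GLin E)) : Prop where
  sharp : IsSharpCone C
  map_mem : ∀ g ∈ G, ∀ v ∈ C, g.1 v ∈ C
  scalar_mem : ∀ g : GLin E, ∀ t : ℝ, 0 < t → (∀ v, g.1 v = t • v) → g ∈ G
  discrete : ∀ u : ℕ → GLin E, (∀ n, u n ∈ G) → ∀ T T' : E →L[ℝ] E,
    Tendsto (fun n => (u n).1) atTop (𝓝 T) → Tendsto (fun n => (u n)⁻¹.1) atTop (𝓝 T') →
    ∀ᶠ n in atTop, ∃ κ : ℝ, (u (n + 1)).1 = κ • (u n).1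
  cocompact : ∃ D K : Set E, D ⊆ C ∧ D.Nonempty ∧ IsCompact K ∧ K ⊆ C ∧
    (∀ v ∈ D, ∃ g ∈ G, g.1 v ∈ K) ∧
    (∀ v ∈ D, ∀ s : ℝ, 0 < s → s • v ∈ D) ∧ ∀ v ∈ D, ∀ y, IsLimitVector C G y → y + v ∈ D

theorem tendsto_clm_apply {α : Type*} {l : Filter α} {F : Type*} [NormedAddCommGroup F]
    [NormedSpace ℝ F] {T : α → E →L[ℝ] F} {T0 : E →L[ℝ] F}
    {v : α → E} {v0 : E} (hT : Tendsto T l (𝓝 T0)) (hv : Tendsto v l (𝓝 v0)) :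
    Tendsto (fun a => T a (v a)) l (𝓝 (T0 v0)) :=
  (isBoundedBilinearMap_apply.continuous.tendsto (T0, v0)).comp (hT.prodMk_nhds hv)

/-- A scalar by which an element of a cone-preserving group can fail to commute with a proximal
one is trivial. -/
theorem IsProx.eq_one_of_conj {S z : GLin E} {y : E} {f : StrongDual ℝ E} (h : IsProx S.1 y f)
    {κ : ℝ} (hκ0 : 0 ≤ κ) (hκ : (z * S).1 = κ • (S * z).1) : κ = 1 := by
  -- The norms of `z Sⁿ` and `Sⁿ z` have positive limits, so `κ ^ n` has a positive limit, which is
  -- possible only for `κ = 1`.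
  have hpow : ∀ n : ℕ, z.1 * S.1 ^ n = κ ^ n • (S.1 ^ n * z.1) := by
    intro n
    induction n with
    | zero => simp
    | succ n ih =>
      have h1 : z.1 * S.1 = κ • (S.1 * z.1) := hκ
      rw [pow_succ, ← mul_assoc, ih, smul_mul_assoc, mul_assoc, h1, mul_smul_comm, smul_smul,
        ← mul_assoc, ← pow_succ]
  have h1 : Tendsto (fun n : ℕ => ‖z.1 * S.1 ^ n‖) atTop (𝓝 ‖z.1 * f.smulRight y‖) :=
    (tendsto_const_nhds.mul h.1).norm
  have h2 : Tendsto (fun n : ℕ => ‖S.1 ^ n * z.1‖) atTop (𝓝 ‖f.smulRight y * z.1‖) :=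
    (h.1.mul tendsto_const_nhds).norm
  have hy : z.1 y ≠ 0 := by
    intro h0
    apply h.ne_zero
    rw [← inv_apply_val_apply z y, h0, map_zero]
  have hz1 : 0 < ‖z.1 * f.smulRight y‖ := by
    rw [norm_pos_iff]
    intro h0
    have := congrArg (fun T : E →L[ℝ] E => T y) h0
    simp [h.2, hy] at this
  have hz2 : 0 < ‖f.smulRight y * z.1‖ := by
    rw [norm_pos_iff]
    intro h0
    have := congrArg (fun T : E →L[ℝ] E => T (z⁻¹.1 y)) h0
    simp only [mul_apply_eq_comp, val_apply_inv_apply] at this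
    simp [h.2, h.ne_zero] at this
  have h3 : Tendsto (fun n : ℕ => κ ^ n) atTop
      (𝓝 (‖z.1 * f.smulRight y‖ / ‖f.smulRight y * z.1‖)) := by
    refine (h1.div h2 hz2.ne').congr' ?_
    filter_upwards [h2.eventually_ne hz2.ne'] with n hn
    rw [Pi.div_apply, hpow, norm_smul, Real.norm_of_nonneg (by positivity)]
    field_simp
  set L := ‖z.1 * f.smulRight y‖ / ‖f.smulRight y * z.1‖
  have hL : 0 < L := by positivity
  have h4 := tendsto_nhds_unique ((tendsto_add_atTop_iff_nat 1).2 h3)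
    ((h3.const_mul κ).congr fun n => by rw [pow_succ'])
  have : (κ - 1) * L = 0 := by linarith
  rcases mul_eq_zero.1 this with h5 | h5
  · linarith
  · exact absurd h5 hL.ne'

namespace IsCocompactAction

variable {C : Set E} {G : Subgroup (GLin E)} (hG : IsCocompactAction C G)
include hG

theorem map_mem_closure {g : GLin E} (hg : g ∈ G) {v : E} (hv : v ∈ closure C) :
    g.1 v ∈ closure C :=
  _root_.map_mem_closure g.1.continuous hv (hG.map_mem g hg)

theorem mapsTo {g : GLin E} (hg : g ∈ G) : MapsTo g.1 (closure C) (closure C) :=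
  fun _ hv => hG.map_mem_closure hg hv

theorem mem_of_map_mem {g : GLin E} (hg : g ∈ G) {v : E} (hv : g.1 v ∈ C) : v ∈ C := by
  have := hG.map_mem _ (G.inv_mem hg) _ hv
  rwa [inv_apply_val_apply] at this

theorem exists_smul_mem {g : GLin E} (hg : g ∈ G) {t : ℝ} (ht : 0 < t) :
    ∃ g' ∈ G, g'.1 = t • g.1 ∧ g'⁻¹.1 = t⁻¹ • g⁻¹.1 := by
  let s : GLin E := Units.map (algebraMap ℝ (E →L[ℝ] E)).toMonoidHom (Units.mk0 t ht.ne')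
  have hs : s.1 = t • 1 := by simp [s, Algebra.algebraMap_eq_smul_one]
  have hs' : s⁻¹.1 = t⁻¹ • 1 := by
    simp only [s, ← map_inv]
    simp [Algebra.algebraMap_eq_smul_one]
  refine ⟨s * g, G.mul_mem (hG.scalar_mem s t ht fun v => by simp [hs]) hg, ?_, ?_⟩
  · rw [Units.val_mul, hs, smul_mul_assoc, one_mul]
  · rw [mul_inv_rev, Units.val_mul, hs', mul_smul_comm, mul_one]

theorem isLimitVector_map {g : GLin E} (hg : g ∈ G) {y : E} (hy : IsLimitVector C G y) :
    IsLimitVector C G (g.1 y) := by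
  obtain ⟨h0, hC, x, hx, u, hu, hlim⟩ := hy
  refine ⟨fun h => h0 ?_, fun h => hC (hG.mem_of_map_mem hg h), x, hx, fun n => g * u n,
    fun n => G.mul_mem hg (hu n), (g.1.continuous.tendsto y).comp hlim⟩
  rw [← inv_apply_val_apply g y, h, map_zero]

theorem mem_closure_of_isLimitVector {y : E} (hy : IsLimitVector C G y) : y ∈ closure C := by
  obtain ⟨h0, hC, x, hx, u, hu, hlim⟩ := hy
  exact mem_closure_of_tendsto hlim (Eventually.of_forall fun n => hG.map_mem _ (hu n) _ hx)

theorem mem_closure_of_mem {w : E} (hw : w ∈ AddSubmonoid.closure {y | IsLimitVector C G y}) :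
    w ∈ closure C := by
  induction hw using AddSubmonoid.closure_induction with
  | mem x hx => exact hG.mem_closure_of_isLimitVector hx
  | zero => exact hG.sharp.zero_mem_closure
  | add x y _ _ hx hy => exact hG.sharp.add_mem_closure hx hy

/-- Uniform bound for the conjugates of elements that move a point of the cone a bounded amount. -/
theorem exists_conj_bound {K : Set E} (hK : IsCompact K) (hKC : K ⊆ C) (k : ℝ) :
    ∃ B, ∀ u ∈ G, ∀ g ∈ G, ∀ c, u.1 c ∈ K → k • c - g.1 c ∈ closure C →
      ‖(u * g * u⁻¹).1‖ ≤ B := by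
  obtain ⟨M, hM, hn⟩ := hG.sharp.exists_opNorm_le_of_isCompact hK hKC
  obtain ⟨M', hM', hn'⟩ := hG.sharp.exists_norm_le
  obtain ⟨R, hR⟩ := hK.isBounded.exists_norm_le
  refine ⟨M * (M' * (|k| * R)), fun u hu g hg c hc hk => ?_⟩
  -- The conjugate is a positive operator, hence controlled by its value at `u c ∈ K`, and this
  -- value `u (g c)` is dominated by `k • u c`.
  have h1 := hn _ hc (u * g * u⁻¹).1 (hG.mapsTo (G.mul_mem (G.mul_mem hu hg) (G.inv_mem hu)))
  have h2 : (u * g * u⁻¹).1 (u.1 c) = u.1 (g.1 c) := by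
    rw [val_mul_apply, inv_apply_val_apply, val_mul_apply]
  have hcC := subset_closure (hKC hc)
  have h3 : ‖u.1 (g.1 c)‖ ≤ M' * ‖k • u.1 c‖ := by
    apply hn'
    · rw [← h2]
      exact hG.mapsTo (G.mul_mem (G.mul_mem hu hg) (G.inv_mem hu)) hcC
    · rw [← map_smul, ← map_sub]
      exact hG.map_mem_closure hu hk
  rw [norm_smul, Real.norm_eq_abs] at h3
  rw [h2] at h1
  calc _ ≤ _ := h1
    _ ≤ M * (M' * (|k| * ‖u.1 c‖)) := by gcongr
    _ ≤ _ := by gcongr; exact hR _ hc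

/-- If `w` is a boundary vector of the hull of the limit set that is moved a bounded amount by
`g₁` and `g₂`, then elements that commute with `g₁` and `g₂` up to homotheties bring points
converging to `w` back to a compact set. -/
theorem exists_centralizing [FiniteDimensional ℝ E] {w : E}
    (hw : w ∈ AddSubmonoid.closure {y | IsLimitVector C G y})
    {g₁ g₂ : GLin E} (hg₁ : g₁ ∈ G) (hg₂ : g₂ ∈ G) {k : ℝ}
    (h₁ : k • w - g₁.1 w ∈ closure C) (h₁' : k • w - g₁⁻¹.1 w ∈ closure C)
    (h₂ : k • w - g₂.1 w ∈ closure C) (h₂' : k • w - g₂⁻¹.1 w ∈ closure C) :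
    ∃ c ∈ C, ∃ p ∈ C, ∃ t : ℕ → ℝ, ∃ z : ℕ → GLin E, (∀ n, 0 < t n) ∧ Tendsto t atTop (𝓝 0) ∧
      (∀ n, z n ∈ G) ∧ Tendsto (fun n => (z n).1 (w + t n • c)) atTop (𝓝 p) ∧
      ∀ n, (∃ κ : ℝ, (z n * g₁).1 = κ • (g₁ * z n).1) ∧
        ∃ κ : ℝ, (z n * g₂).1 = κ • (g₂ * z n).1 := by
  have : ProperSpace (E →L[ℝ] E) := FiniteDimensional.proper_real _
  obtain ⟨D, K, hDC, ⟨c, hcD⟩, hK, hKC, hDK, hDs, hD⟩ := hG.cocompact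
  have hcC := hDC hcD
  have hwC := hG.mem_closure_of_mem hw
  -- Thus every `w + t • c` with `t > 0` stays in `D`, where cocompactness applies, although `w`
  -- itself may be a boundary vector.
  have hadd : ∀ w ∈ AddSubmonoid.closure {y | IsLimitVector C G y}, ∀ v ∈ D, w + v ∈ D := by
    intro w hw
    induction hw using AddSubmonoid.closure_induction with
    | mem x hx => exact fun v hv => hD v hv x hx
    | zero => exact fun v hv => by rwa [zero_add]
    | add x y _ _ hx hy => exact fun v hv => by rw [add_assoc]; exact hx _ (hy v hv)
  let t : ℕ → ℝ := fun n => 1 / ((n : ℝ) + 1)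
  have ht : ∀ n, 0 < t n := fun n => by positivity
  have ht0 : Tendsto t atTop (𝓝 0) := tendsto_one_div_add_atTop_nhds_zero_nat
  have hq : ∀ n, ∃ u ∈ G, u.1 (w + t n • c) ∈ K := fun n => hDK _ (hadd w hw _ (hDs c hcD _ (ht n)))
  choose u huG huK using hq
  have hk1 : ∀ g ∈ G, ∃ k' : ℝ, 0 < k' ∧ k' • c - g.1 c ∈ closure C := by
    intro g hg
    obtain ⟨k', hk', h⟩ := hG.sharp.exists_dominate hcC
    have hgc : g.1 c ≠ 0 := fun h0 => hG.sharp.zero_notMem (h0 ▸ hG.map_mem g hg c hcC)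
    exact ⟨k' * ‖g.1 c‖, mul_pos hk' (norm_pos_iff.2 hgc), h (g.1 c)⟩
  have hbd : ∀ g ∈ G, k • w - g.1 w ∈ closure C → ∃ B, ∀ n, ‖(u n * g * (u n)⁻¹).1‖ ≤ B := by
    intro g hg hgw
    obtain ⟨k', hk', hgc⟩ := hk1 g hg
    obtain ⟨B, hB⟩ := hG.exists_conj_bound hK hKC (|k| + k')
    refine ⟨B, fun n => hB _ (huG n) g hg _ (huK n) ?_⟩
    -- The domination constant for `w + t n • c` is independent of `n`: `k` handles `w`, `k'`
    -- handles `c`, and the absolute value keeps all remaining coefficients nonnegative.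
    have e : (|k| + k') • (w + t n • c) - g.1 (w + t n • c) =
        ((k • w - g.1 w) + (|k| - k + k') • w) + t n • ((k' • c - g.1 c) + |k| • c) := by
      simp only [map_add, map_smul]
      module
    rw [e]
    have hkk : 0 ≤ |k| - k + k' := by linarith [le_abs_self k]
    exact hG.sharp.add_mem_closure (hG.sharp.add_mem_closure hgw (hG.sharp.smul_mem_closure hkk hwC))
      (hG.sharp.smul_mem_closure (ht n).le
        (hG.sharp.add_mem_closure hgc (hG.sharp.smul_mem_closure (abs_nonneg k) (subset_closure hcC))))
  obtain ⟨B₁, hB₁⟩ := hbd g₁ hg₁ h₁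
  obtain ⟨B₁', hB₁'⟩ := hbd g₁⁻¹ (G.inv_mem hg₁) h₁'
  obtain ⟨B₂, hB₂⟩ := hbd g₂ hg₂ h₂
  obtain ⟨B₂', hB₂'⟩ := hbd g₂⁻¹ (G.inv_mem hg₂) h₂'
  have hcpt : ∀ B : ℝ, IsCompact (Metric.closedBall (0 : E →L[ℝ] E) B) :=
    fun B => isCompact_closedBall _ _
  obtain ⟨a, ha, φ, hφ, hlim⟩ := (hK.prod ((hcpt B₁).prod ((hcpt B₁').prod
    ((hcpt B₂).prod (hcpt B₂'))))).tendsto_subseq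
    (x := fun n => ((u n).1 (w + t n • c), (u n * g₁ * (u n)⁻¹).1, (u n * g₁⁻¹ * (u n)⁻¹).1,
      (u n * g₂ * (u n)⁻¹).1, (u n * g₂⁻¹ * (u n)⁻¹).1))
    (fun n => ⟨huK n, by simpa using hB₁ n, by simpa using hB₁' n, by simpa using hB₂ n,
      by simpa using hB₂' n⟩)
  -- The conjugates and their inverses converge along the subsequence, so by discreteness
  -- consecutive ones eventually differ by scalars only.
  have hconj : ∀ g ∈ G, ∀ T T' : E →L[ℝ] E,
      Tendsto (fun n => (u (φ n) * g * (u (φ n))⁻¹).1) atTop (𝓝 T) →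
      Tendsto (fun n => (u (φ n) * g⁻¹ * (u (φ n))⁻¹).1) atTop (𝓝 T') →
      ∃ N, ∀ n ≥ N, ∃ κ : ℝ,
        (u (φ n) * g * (u (φ n))⁻¹).1 = κ • (u (φ N) * g * (u (φ N))⁻¹).1 := by
    intro g hg T T' hT hT'
    have := hG.discrete (fun n => u (φ n) * g * (u (φ n))⁻¹)
      (fun n => G.mul_mem (G.mul_mem (huG _) hg) (G.inv_mem (huG _))) T T' hT
      (by simpa only [mul_inv_rev, inv_inv, mul_assoc] using hT')
    obtain ⟨N, hN⟩ := eventually_atTop.1 this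
    refine ⟨N, fun n hn => ?_⟩
    induction n, hn using Nat.le_induction with
    | base => exact ⟨1, (one_smul _ _).symm⟩
    | succ n hn ih =>
      obtain ⟨κ, hκ⟩ := ih
      obtain ⟨κ', hκ'⟩ := hN n hn
      exact ⟨κ' * κ, by rw [hκ', hκ, smul_smul]⟩
  -- If `u (φ n)` and `u (φ N)` conjugate `g` to proportional operators, their quotient commutes
  -- with `g` up to a scalar.
  have hcomm : ∀ g : GLin E, ∀ N n : ℕ, (∃ κ : ℝ,
      (u (φ n) * g * (u (φ n))⁻¹).1 = κ • (u (φ N) * g * (u (φ N))⁻¹).1) →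
      ∃ κ : ℝ, ((u (φ N))⁻¹ * u (φ n) * g).1 = κ • (g * ((u (φ N))⁻¹ * u (φ n))).1 := by
    rintro g N n ⟨κ, hκ⟩
    refine ⟨κ, ?_⟩
    have e : (u (φ N))⁻¹ * u (φ n) * g =
        (u (φ N))⁻¹ * (u (φ n) * g * (u (φ n))⁻¹) * u (φ n) := by group
    have e' : g * ((u (φ N))⁻¹ * u (φ n)) =
        (u (φ N))⁻¹ * (u (φ N) * g * (u (φ N))⁻¹) * u (φ n) := by group
    rw [e, e']
    generalize u (φ n) * g * (u (φ n))⁻¹ = X at hκ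
    generalize u (φ N) * g * (u (φ N))⁻¹ = Y at hκ
    rw [Units.val_mul, Units.val_mul, hκ, Units.val_mul, Units.val_mul, mul_smul_comm,
      smul_mul_assoc]
  have l₁ : Tendsto (fun n => (u (φ n) * g₁ * (u (φ n))⁻¹).1) atTop (𝓝 a.2.1) :=
    (continuous_fst.comp continuous_snd).continuousAt.tendsto.comp hlim
  have l₁' : Tendsto (fun n => (u (φ n) * g₁⁻¹ * (u (φ n))⁻¹).1) atTop (𝓝 a.2.2.1) :=
    (continuous_fst.comp (continuous_snd.comp continuous_snd)).continuousAt.tendsto.comp hlim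
  have l₂ : Tendsto (fun n => (u (φ n) * g₂ * (u (φ n))⁻¹).1) atTop (𝓝 a.2.2.2.1) :=
    (continuous_fst.comp (continuous_snd.comp
      (continuous_snd.comp continuous_snd))).continuousAt.tendsto.comp hlim
  have l₂' : Tendsto (fun n => (u (φ n) * g₂⁻¹ * (u (φ n))⁻¹).1) atTop (𝓝 a.2.2.2.2) :=
    (continuous_snd.comp (continuous_snd.comp
      (continuous_snd.comp continuous_snd))).continuousAt.tendsto.comp hlim
  have l₀ : Tendsto (fun n => (u (φ n)).1 (w + t (φ n) • c)) atTop (𝓝 a.1) :=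
    continuous_fst.continuousAt.tendsto.comp hlim
  obtain ⟨N₁, hN₁⟩ := hconj g₁ hg₁ _ _ l₁ l₁'
  obtain ⟨N₂, hN₂⟩ := hconj g₂ hg₂ _ _ l₂ l₂'
  set N := max N₁ N₂ with hN
  -- The two elements stabilise from different ranks; both comparisons are rebased at the common
  -- index `N`, which requires dividing by a nonzero scalar.
  have hto : ∀ g : GLin E, ∀ M ≤ N, (∀ n ≥ M, ∃ κ : ℝ,
      (u (φ n) * g * (u (φ n))⁻¹).1 = κ • (u (φ M) * g * (u (φ M))⁻¹).1) →
      ∀ n ≥ N, ∃ κ : ℝ,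
      (u (φ n) * g * (u (φ n))⁻¹).1 = κ • (u (φ N) * g * (u (φ N))⁻¹).1 := by
    intro g M hM h n hn
    obtain ⟨κ, hκ⟩ := h n (hM.trans hn)
    obtain ⟨κ', hκ'⟩ := h N hM
    have hκ0 : κ' = 0 → κ = 0 := by
      rintro rfl
      have e0 : (u (φ N) * g * (u (φ N))⁻¹).1 = 0 := by rw [hκ', zero_smul]
      have h1 : (1 : E →L[ℝ] E) = 0 := by
        rw [← Units.val_one, ← mul_inv_cancel (u (φ N) * g * (u (φ N))⁻¹), Units.val_mul, e0,
          zero_mul]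
      exfalso
      apply hG.sharp.zero_notMem
      have : c = 0 := by
        have := congrArg (fun T : E →L[ℝ] E => T c) h1
        simpa using this
      exact this ▸ hcC
    rcases eq_or_ne κ' 0 with h0 | h0
    · exact ⟨0, by rw [hκ, hκ0 h0, zero_smul, zero_smul]⟩
    · exact ⟨κ / κ', by rw [hκ, hκ', smul_smul, div_mul_cancel₀ _ h0]⟩
  have hM₁ := hto g₁ N₁ (le_max_left _ _) hN₁
  have hM₂ := hto g₂ N₂ (le_max_right _ _) hN₂
  refine ⟨c, hcC, (u (φ N))⁻¹.1 a.1, hG.map_mem _ (G.inv_mem (huG _)) _ (hKC ha.1),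
    fun n => t (φ (n + N)), fun n => (u (φ N))⁻¹ * u (φ (n + N)), fun n => ht _, ?_,
    fun n => G.mul_mem (G.inv_mem (huG _)) (huG _), ?_, fun n => ⟨?_, ?_⟩⟩
  · exact ht0.comp (hφ.tendsto_atTop.comp (tendsto_add_atTop_nat N))
  · exact ((u (φ N))⁻¹.1.continuous.tendsto a.1).comp (l₀.comp (tendsto_add_atTop_nat N))
  · exact hcomm _ _ _ (hM₁ _ (by omega))
  · exact hcomm _ _ _ (hM₂ _ (by omega))

end IsCocompactAction

end Action

/-! ### Proximal elements of the group, and why the axis meets the cone -/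

section Positive

open Filter Set

variable {E : Type*} [NormedAddCommGroup E] [NormedSpace ℝ E]

theorem IsSharpCone.exists_apply_ne_zero {C : Set E} (hC : IsSharpCone C) {f : StrongDual ℝ E}
    (hf : f ≠ 0) : ∃ c ∈ C, f c ≠ 0 := by
  by_contra! h
  obtain ⟨c, hc⟩ := hC.nonempty
  apply hf
  ext v
  obtain ⟨k, hk, hd⟩ := hC.exists_dominate hc
  have h1 := h _ (hC.add_closure_mem hc (hd v))
  simpa [h c hc] using h1

namespace IsCocompactAction

variable {C : Set E} {G : Subgroup (GLin E)} (hG : IsCocompactAction C G)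
include hG

theorem pow_apply_mem {S : GLin E} (hS : S ∈ G) (n : ℕ) {c : E} (hc : c ∈ C) :
    (S.1 ^ n) c ∈ C := by
  rw [← Units.val_pow_eq_pow_val]
  exact hG.map_mem _ (G.pow_mem hS n) _ hc

/-- The pair `(y, f)` is determined only up to a common sign. For `x ∈ C` the limit `f x • y` lies
in the closure of `C`; as this contains no line, `f` cannot take both signs on `C`. -/
theorem exists_sign {S : GLin E} (hS : S ∈ G) {y : E} {f : StrongDual ℝ E} (h : IsProx S.1 y f) :
    ∃ σ : ℝ, (σ = 1 ∨ σ = -1) ∧ IsProx S.1 (σ • y) (σ • f) ∧ σ • y ∈ closure C ∧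
      ∀ v ∈ closure C, 0 ≤ (σ • f) v := by
  obtain ⟨c, hc, hfc⟩ := hG.sharp.exists_apply_ne_zero h.form_ne_zero
  have key : ∀ x ∈ C, f x • y ∈ closure C := fun x hx =>
    mem_closure_of_tendsto (h.tendsto_apply x)
      (Eventually.of_forall fun n => hG.pow_apply_mem hS n hx)
  have hpr : ∀ σ : ℝ, σ = 1 ∨ σ = -1 → IsProx S.1 (σ • y) (σ • f) := by
    rintro σ (rfl | rfl)
    · simpa using h
    · refine ⟨?_, by simp [h.2]⟩
      convert h.1 using 2
      ext v
      simp
  have hpos : ∀ σ : ℝ, σ • y ∈ closure C → (σ = 1 ∨ σ = -1) → ∀ v ∈ closure C, 0 ≤ (σ • f) v := by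
    intro σ hσ hσ1
    have hcl : IsClosed {v : E | 0 ≤ (σ • f) v} := isClosed_le (by fun_prop) (by fun_prop)
    refine closure_minimal (fun x hx => ?_) hcl
    change 0 ≤ (σ • f) x
    by_contra! hneg
    have h1 := key x hx
    have h2 : f x • y = ((σ • f) x) • (σ • y) := by
      rcases hσ1 with rfl | rfl <;> simp
    have h3 : -(σ • y) ∈ closure C := by
      have := hG.sharp.smul_mem_closure (t := (-(σ • f) x)⁻¹) (inv_nonneg.2 (by linarith)) h1
      rwa [h2, smul_smul, inv_neg, neg_mul, inv_mul_cancel₀ hneg.ne, neg_smul, one_smul] at this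
    exact (hpr σ hσ1).ne_zero (hG.sharp.eq_zero_of_neg_mem hσ h3)
  have hy : ∃ σ : ℝ, (σ = 1 ∨ σ = -1) ∧ σ • y ∈ closure C := by
    have h1 := hG.sharp.smul_mem_closure (t := |f c|⁻¹) (by positivity) (key c hc)
    rw [smul_smul] at h1
    rcases hfc.lt_or_gt with h2 | h2
    · refine ⟨-1, Or.inr rfl, ?_⟩
      rwa [abs_of_neg h2, inv_neg, neg_mul, inv_mul_cancel₀ h2.ne] at h1
    · refine ⟨1, Or.inl rfl, ?_⟩
      rwa [abs_of_pos h2, inv_mul_cancel₀ h2.ne'] at h1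
  obtain ⟨σ, hσ1, hσ⟩ := hy
  exact ⟨σ, hσ1, hpr σ hσ1, hσ, hpos σ hσ hσ1⟩

end IsCocompactAction

/-- A proximal element of `G` whose attracting vector and form are nonnegative on the cone. -/
structure IsPosProx (C : Set E) (G : Subgroup (GLin E)) (S : GLin E) (y : E)
    (f : StrongDual ℝ E) : Prop where
  mem : S ∈ G
  prox : IsProx S.1 y f
  vec_mem : y ∈ closure C
  nonneg : ∀ v ∈ closure C, 0 ≤ f v

namespace IsPosProx

variable {C : Set E} {G : Subgroup (GLin E)} (hG : IsCocompactAction C G)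
  {S : GLin E} {y : E} {f : StrongDual ℝ E} (h : IsPosProx C G S y f)

include hG h

theorem pos {c : E} (hc : c ∈ C) : 0 < f c :=
  hG.sharp.pos_of_nonneg h.nonneg h.prox.form_ne_zero hc

/-- If `y` were in the open cone, it would be an order unit fixed by every `S⁻ⁿ`, which would bound
all sequences `S⁻ⁿ v`. In dimension at least 2 the kernel of `f` contains a vector that escapes. -/
theorem vec_notMem [FiniteDimensional ℝ E] (hd : 2 ≤ Module.finrank ℝ E) : y ∉ C := by
  intro hy
  obtain ⟨v, hv, hv0⟩ : ∃ v : E, f v = 0 ∧ v ≠ 0 := by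
    have h1 := f.toLinearMap.finrank_range_add_finrank_ker
    have h2 : Module.finrank ℝ f.toLinearMap.range ≤ 1 := by
      simpa using Submodule.finrank_le f.toLinearMap.range
    have h3 : 0 < Module.finrank ℝ f.toLinearMap.ker := by omega
    have := Module.finrank_pos_iff.1 h3
    obtain ⟨x, hx⟩ := exists_ne (0 : f.toLinearMap.ker)
    exact ⟨x, x.2, by simpa using hx⟩
  have ht := h.prox.tendsto_norm_inv_pow (z := v) (by simpa [hv] using hv0)
  obtain ⟨k, hk, hd⟩ := hG.sharp.exists_dominate hy
  obtain ⟨M, hM, hn⟩ := hG.sharp.exists_norm_le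
  set a := k * ‖v‖
  have hyn : ∀ n : ℕ, (S⁻¹ ^ n).1 y = y := by
    intro n
    induction n with
    | zero => rfl
    | succ n ih => rw [pow_succ, val_mul_apply, h.prox.inv_apply_self, ih]
  have hb : ∀ n : ℕ, ‖(S⁻¹ ^ n).1 v‖ ≤ M * ‖(2 * a) • y‖ + ‖a • y‖ := by
    intro n
    have hSn : S⁻¹ ^ n ∈ G := G.pow_mem (G.inv_mem h.mem) n
    have h1 := hG.map_mem_closure hSn (hd v)
    have h2 := hG.map_mem_closure hSn (hd (-v))
    rw [map_sub, map_smul, hyn] at h1 h2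
    rw [norm_neg, map_neg, sub_neg_eq_add] at h2
    have h3 := hn _ ((2 * a) • y) h2 (by
      have e : (2 * a) • y - (a • y + (S⁻¹ ^ n).1 v) = a • y - (S⁻¹ ^ n).1 v := by module
      rwa [e])
    have h4 := norm_sub_le (a • y + (S⁻¹ ^ n).1 v) (a • y)
    rw [add_sub_cancel_left] at h4
    linarith
  obtain ⟨n, hn'⟩ := (ht.eventually_gt_atTop (M * ‖(2 * a) • y‖ + ‖a • y‖)).exists
  linarith [hb n]

theorem isLimitVector [FiniteDimensional ℝ E] (hd : 2 ≤ Module.finrank ℝ E) :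
    IsLimitVector C G y := by
  obtain ⟨c, hc⟩ := hG.sharp.nonempty
  have hfc := h.pos hG hc
  refine ⟨h.prox.ne_zero, h.vec_notMem hG hd, (f c)⁻¹ • c, hG.sharp.smul_mem _ (by positivity) _ hc,
    fun n => S ^ n, fun n => G.pow_mem h.mem n, ?_⟩
  have := h.prox.tendsto_apply ((f c)⁻¹ • c)
  rwa [map_smul, smul_eq_mul, inv_mul_cancel₀ hfc.ne', one_smul] at this

/-- Under the inverse of `S`, vectors of the cone other than the attracting one escape from the
kernel of the second form. -/
theorem eventually_le [FiniteDimensional ℝ E] {f' : StrongDual ℝ E} (hp : PosOn C (f + f')) {z : E}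
    (hz : z ∈ closure C) (hzy : z ≠ f z • y) :
    ∀ᶠ n : ℕ in atTop, 0 < f' ((S⁻¹ ^ n).1 z) := by
  obtain ⟨ε, hε, hle⟩ := hG.sharp.exists_lower_bound hp
  filter_upwards [(h.prox.tendsto_norm_inv_pow hzy).eventually_gt_atTop (f z / ε)] with n hn
  have h1 := hle _ (hG.map_mem_closure (G.pow_mem (G.inv_mem h.mem) n) hz)
  rw [add_apply, h.prox.form_inv_pow_apply] at h1
  rw [div_lt_iff₀ hε] at hn
  linarith

/-- Both products preserve `C`, so `κ ≥ 0`, and `IsProx.eq_one_of_conj` leaves only `κ = 1`. -/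
theorem commute_of_smul {z : GLin E} (hz : z ∈ G) {κ : ℝ} (hκ : (z * S).1 = κ • (S * z).1) :
    z.1 * S.1 = S.1 * z.1 := by
  obtain ⟨c, hc⟩ := hG.sharp.nonempty
  have h0 : 0 ≤ κ := by
    by_contra! hneg
    have h1 := hG.map_mem _ (G.mul_mem hz h.mem) c hc
    have h2 := hG.map_mem _ (G.mul_mem h.mem hz) c hc
    rw [hκ, smul_apply] at h1
    have h3 := hG.sharp.add_mem _ h1 _ (hG.sharp.smul_mem (-κ) (by linarith) _ h2)
    rw [neg_smul, add_neg_cancel] at h3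
    exact hG.sharp.zero_notMem h3
  have := h.prox.eq_one_of_conj h0 hκ
  rw [this, one_smul] at hκ
  exact hκ

end IsPosProx

variable {C : Set E} {G : Subgroup (GLin E)} (hG : IsCocompactAction C G)
  {S₁ S₂ : GLin E} {y₁ y₂ : E} {f₁ f₂ : StrongDual ℝ E}

include hG in
/-- A vector of the hull of the limit set that is moved a bounded amount by `S₁` and `S₂`, and on
which both attracting forms are positive, lies in the open cone. -/
theorem mem_of_bounded_of_posOn [FiniteDimensional ℝ E]
    (h₁ : IsPosProx C G S₁ y₁ f₁) (h₂ : IsPosProx C G S₂ y₂ f₂)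
    (hp : PosOn C (f₁ + f₂)) {w : E} (hw : w ∈ AddSubmonoid.closure {y | IsLimitVector C G y})
    {k : ℝ} (hk₁ : k • w - S₁.1 w ∈ closure C) (hk₁' : k • w - S₁⁻¹.1 w ∈ closure C)
    (hk₂ : k • w - S₂.1 w ∈ closure C) (hk₂' : k • w - S₂⁻¹.1 w ∈ closure C)
    (hw₁ : 0 < f₁ w) (hw₂ : 0 < f₂ w) : w ∈ C := by
  have : ProperSpace (E →L[ℝ] E) := FiniteDimensional.proper_real _
  obtain ⟨c, hc, p, hpC, t, z, ht, ht0, hz, hlim, hcomm⟩ :=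
    hG.exists_centralizing hw h₁.mem h₂.mem hk₁ hk₁' hk₂ hk₂'
  have hctend : Tendsto (fun n => w + t n • c) atTop (𝓝 w) := by
    simpa using (tendsto_const_nhds (x := w)).add (ht0.smul_const c)
  -- By commutation `z n` multiplies `f` by a scalar. Evaluating at `w + t n • c`, where `f` tends
  -- to `f w > 0`, shows that this scalar converges.
  have key : ∀ {S : GLin E} {y : E} {f : StrongDual ℝ E}, IsPosProx C G S y f → 0 < f w →
      (∀ n, ∃ κ : ℝ, (z n * S).1 = κ • (S * z n).1) →
      ∃ b : ℝ, ∀ᶠ n in atTop, ∀ v ∈ closure C, f ((z n).1 v) ≤ b * f v := by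
    intro S y f h hfw hκ
    have hα : ∀ n v, f ((z n).1 v) = f ((z n).1 y) * f v := fun n v => by
      obtain ⟨κ, hκ⟩ := hκ n
      exact (h.prox.of_commute (h.commute_of_smul hG (hz n) hκ) v).1
    have hlim1 : Tendsto (fun n => f ((z n).1 (w + t n • c))) atTop (𝓝 (f p)) :=
      (f.continuous.tendsto p).comp hlim
    have hlim2 : Tendsto (fun n => f (w + t n • c)) atTop (𝓝 (f w)) :=
      (f.continuous.tendsto w).comp hctend
    have hlim3 : Tendsto (fun n => f ((z n).1 y)) atTop (𝓝 (f p / f w)) := by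
      refine (hlim1.div hlim2 hfw.ne').congr' ?_
      filter_upwards [hlim2.eventually_ne hfw.ne'] with n hn
      rw [Pi.div_apply, hα, mul_div_cancel_right₀ _ hn]
    refine ⟨f p / f w + 1, ?_⟩
    filter_upwards [hlim3.eventually_lt_const (lt_add_one _)] with n hn v hv
    rw [hα]
    exact mul_le_mul_of_nonneg_right hn.le (h.nonneg v hv)
  obtain ⟨b₁, hb₁⟩ := key h₁ hw₁ fun n => (hcomm n).1
  obtain ⟨b₂, hb₂⟩ := key h₂ hw₂ fun n => (hcomm n).2
  obtain ⟨ε, hε, hle⟩ := hG.sharp.exists_lower_bound hp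
  obtain ⟨M, hM, hn⟩ := hG.sharp.exists_opNorm_le hc
  have hcC := subset_closure hc
  have hbd : ∀ᶠ n in atTop, ‖(z n).1‖ ≤ M * ((b₁ * f₁ c + b₂ * f₂ c) / ε) := by
    filter_upwards [hb₁, hb₂] with n h1 h2
    refine (hn _ (hG.mapsTo (hz n))).trans ?_
    gcongr
    rw [le_div_iff₀ hε, mul_comm]
    refine (hle _ (hG.map_mem_closure (hz n) hcC)).trans ?_
    rw [add_apply]
    exact add_le_add (h1 c hcC) (h2 c hcC)
  -- Boundedness allows dropping the perturbation `t n • c` in the limit: `z (φ n) w` itself tends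
  -- to `p`, hence enters the open cone.
  obtain ⟨Z, -, φ, hφ, hZ⟩ := tendsto_subseq_of_frequently_bounded (Metric.isBounded_closedBall
    (x := (0 : E →L[ℝ] E)) (r := M * ((b₁ * f₁ c + b₂ * f₂ c) / ε)))
    (hbd.mono fun n hn => by simpa using hn).frequently
  have hZw : Z w = p := tendsto_nhds_unique
    (tendsto_clm_apply hZ (hctend.comp hφ.tendsto_atTop)) (hlim.comp hφ.tendsto_atTop)
  have h3 : Tendsto (fun n => (z (φ n)).1 w) atTop (𝓝 p) := by
    rw [← hZw]
    exact tendsto_clm_apply hZ tendsto_const_nhds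
  obtain ⟨n, hn⟩ := (h3.eventually_mem (hG.sharp.isOpen.mem_nhds hpC)).exists
  exact hG.mem_of_map_mem (hz _) hn

/-- `S` and `S'` are inverse up to homotheties, and both are proximal. -/
structure IsBiprox (C : Set E) (G : Subgroup (GLin E)) (S S' : GLin E) (x x' : E)
    (f f' : StrongDual ℝ E) : Prop where
  fst : IsPosProx C G S x f
  snd : IsPosProx C G S' x' f'
  exists_smul : ∃ μ : ℝ, 0 < μ ∧ S'.1 = μ • S⁻¹.1

namespace IsBiprox

variable {S S' : GLin E} {x x' : E} {f f' : StrongDual ℝ E} (h : IsBiprox C G S S' x x' f f')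

include h

theorem symm : IsBiprox C G S' S x' x f' f := by
  obtain ⟨μ, hμ, e⟩ := h.exists_smul
  refine ⟨h.snd, h.fst, μ, hμ, ?_⟩
  have h1 : S'.1 * S.1 = μ • 1 := by rw [e, smul_mul_assoc, ← Units.val_mul, inv_mul_cancel]; rfl
  calc S.1 = S'⁻¹.1 * (S'.1 * S.1) := by
        rw [← mul_assoc, ← Units.val_mul, inv_mul_cancel]; simp
    _ = μ • S'⁻¹.1 := by rw [h1, mul_smul_comm, mul_one]

theorem apply_snd_vec {μ : ℝ} (e : S'.1 = μ • S⁻¹.1) : S.1 x' = μ • x' := by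
  have h1 := h.snd.prox.apply_self
  rw [e, smul_apply] at h1
  conv_lhs => rw [← h1]
  rw [map_smul, val_apply_inv_apply]

/-- For `μ = 1` the products `Sⁿ S'ⁿ` are the identity, yet they converge to an operator of rank at
most one. -/
theorem scalar_ne_one (hd : 2 ≤ Module.finrank ℝ E) {μ : ℝ} (e : S'.1 = μ • S⁻¹.1) : μ ≠ 1 := by
  rintro rfl
  rw [one_smul] at e
  have h1 : Tendsto (fun n : ℕ => S.1 ^ n * S'.1 ^ n) atTop
      (𝓝 (f.smulRight x * f'.smulRight x')) := h.fst.prox.1.mul h.snd.prox.1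
  have h2 : ∀ n : ℕ, S.1 ^ n * S'.1 ^ n = 1 := by
    intro n
    rw [e, ← Units.val_pow_eq_pow_val, ← Units.val_pow_eq_pow_val, ← Units.val_mul, inv_pow,
      mul_inv_cancel]
    rfl
  simp_rw [h2] at h1
  have h3 := tendsto_nhds_unique h1 tendsto_const_nhds
  have : Module.finrank ℝ E ≤ 1 := by
    refine finrank_le_one x fun v => ?_
    have := congrArg (fun T : E →L[ℝ] E => T v) h3
    simp only [mul_apply_eq_comp, ContinuousLinearMap.smulRight_apply, one_apply_eq_self] at this
    exact ⟨_, this⟩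
  omega

/-- The form `f` is `S`-invariant while `S x' = μ • x'` with `μ ≠ 1`. -/
theorem form_vec (hd : 2 ≤ Module.finrank ℝ E) : f x' = 0 := by
  obtain ⟨μ, hμ, e⟩ := h.exists_smul
  have h1 := h.fst.prox.form_apply x'
  rw [h.apply_snd_vec e, map_smul, smul_eq_mul] at h1
  have h2 := h.scalar_ne_one hd e
  have h3 : (μ - 1) * f x' = 0 := by linarith
  rcases mul_eq_zero.1 h3 with h4 | h4
  · exact absurd (by linarith) h2
  · exact h4

include hG in
/-- If the dual axis meets the dual cone, then the axis meets the cone. -/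
theorem add_mem [FiniteDimensional ℝ E] (hd : 2 ≤ Module.finrank ℝ E) (hp : PosOn C (f + f')) :
    x + x' ∈ C := by
  obtain ⟨μ, hμ, e⟩ := h.exists_smul
  have hx := h.fst.vec_mem
  have hx' := h.snd.vec_mem
  have a1 : S.1 (x + x') = x + μ • x' := by
    rw [map_add, h.fst.prox.apply_self, h.apply_snd_vec e]
  have a2 : S⁻¹.1 (x + x') = x + μ⁻¹ • x' := by
    have : S⁻¹.1 x' = μ⁻¹ • x' := by
      have := h.snd.prox.apply_self
      rw [e, smul_apply] at this
      rw [eq_inv_smul_iff₀ hμ.ne', this]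
    rw [map_add, h.fst.prox.inv_apply_self, this]
  have e' : S'⁻¹.1 = μ⁻¹ • S.1 := by
    obtain ⟨μ', hμ', e''⟩ := h.symm.exists_smul
    have : S'.1 * S'⁻¹.1 = 1 := by rw [← Units.val_mul, mul_inv_cancel]; rfl
    have h2 : S.1 * S'.1 = μ • 1 := by
      rw [e, mul_smul_comm, ← Units.val_mul, mul_inv_cancel]; rfl
    calc S'⁻¹.1 = μ⁻¹ • (μ • 1 * S'⁻¹.1) := by
          rw [smul_mul_assoc, one_mul, smul_smul, inv_mul_cancel₀ hμ.ne', one_smul]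
      _ = μ⁻¹ • S.1 := by rw [← h2, mul_assoc, this, mul_one]
  have a3 : S'.1 (x + x') = μ • x + x' := by
    rw [e, smul_apply, a2, smul_add, smul_smul, mul_inv_cancel₀ hμ.ne', one_smul]
  have a4 : S'⁻¹.1 (x + x') = μ⁻¹ • x + x' := by
    rw [e', smul_apply, a1, smul_add, smul_smul, inv_mul_cancel₀ hμ.ne', one_smul]
  have hcomb : ∀ a b : ℝ, 0 ≤ a → 0 ≤ b → a • x + b • x' ∈ closure C := fun a b ha hb =>
    hG.sharp.add_mem_closure (hG.sharp.smul_mem_closure ha hx) (hG.sharp.smul_mem_closure hb hx')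
  have hμ' : 0 < μ⁻¹ := inv_pos.2 hμ
  -- In the basis `x`, `x'` the operators `S`, `S'` and their inverses have eigenvalues among `1`,
  -- `μ`, `μ⁻¹`, so this one constant serves all four domination hypotheses.
  have hk : ∀ a b : ℝ, a ≤ 1 + μ + μ⁻¹ → b ≤ 1 + μ + μ⁻¹ →
      (1 + μ + μ⁻¹) • (x + x') - (a • x + b • x') ∈ closure C := by
    intro a b ha hb
    have : (1 + μ + μ⁻¹) • (x + x') - (a • x + b • x') =
        (1 + μ + μ⁻¹ - a) • x + (1 + μ + μ⁻¹ - b) • x' := by module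
    rw [this]
    exact hcomb _ _ (by linarith) (by linarith)
  refine mem_of_bounded_of_posOn hG h.fst h.snd hp (k := 1 + μ + μ⁻¹) ?_ ?_ ?_ ?_ ?_ ?_ ?_
  · exact AddSubmonoid.add_mem _ (AddSubmonoid.subset_closure (h.fst.isLimitVector hG hd))
      (AddSubmonoid.subset_closure (h.snd.isLimitVector hG hd))
  · rw [a1]
    simpa using hk 1 μ (by linarith) (by linarith)
  · rw [a2]
    simpa using hk 1 μ⁻¹ (by linarith) (by linarith)
  · rw [a3]
    simpa using hk μ 1 (by linarith) (by linarith)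
  · rw [a4]
    simpa using hk μ⁻¹ 1 (by linarith) (by linarith)
  · rw [map_add, h.fst.prox.2, h.form_vec hd]; norm_num
  · rw [map_add, h.snd.prox.2, h.symm.form_vec hd]; norm_num

end IsBiprox

end Positive

/-! ### Perturbing rank-one operators into proximal ones -/

section Perturbation

open Filter Set

variable {E : Type*} [NormedAddCommGroup E] [NormedSpace ℝ E]

/-- With `P` the projection and `R = U - P`, invariance of `y` and `f` gives `P R = R P = 0`, so
positive powers split as `P + Rᵏ`. -/
theorem isProx_of_tendsto_sub_pow {U : E →L[ℝ] E} {y : E} {f : StrongDual ℝ E} (hfy : f y = 1)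
    (hy : U y = y) (hf : ∀ v, f (U v) = f v)
    (hR : Tendsto (fun k : ℕ => (U - f.smulRight y) ^ k) atTop (𝓝 0)) : IsProx U y f := by
  refine ⟨?_, hfy⟩
  set P := f.smulRight y with hP
  set R := U - P with hRdef
  have hPR : P * R = 0 := by
    ext v
    simp [hRdef, hP, hf, hfy]
  have hRP : R * P = 0 := by
    ext v
    simp [hRdef, hP, hy, hfy]
  have hPP : P * P = P := by
    ext v
    simp [hP, hfy]
  have hpow : ∀ k : ℕ, U ^ (k + 1) = P + R ^ (k + 1) := by
    intro k
    induction k with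
    | zero => simp [hRdef]
    | succ k ih =>
      have hU : U = P + R := by simp [hRdef]
      have hRk : R ^ (k + 1) * P = 0 := by rw [pow_succ, mul_assoc, hRP, mul_zero]
      rw [pow_succ, ih, hU, add_mul, mul_add, mul_add, hPP, hPR, hRk, add_zero, zero_add,
        ← pow_succ]
  rw [← tendsto_add_atTop_iff_nat 1]
  simp_rw [hpow]
  have h0 : Tendsto (fun k : ℕ => R ^ (k + 1)) atTop (𝓝 0) :=
    (tendsto_add_atTop_iff_nat 1).2 hR
  simpa using tendsto_const_nhds.add h0

variable [FiniteDimensional ℝ E]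

/-- Used for `f y = 1`: the determinant is then negative at `l = 1/2` and positive at `l = 2`, a
sign change that survives small perturbations. -/
theorem det_smul_one_sub_smulRight (f : StrongDual ℝ E) (y : E) {l : ℝ} (hl : l ≠ 0) :
    (l • (1 : E →L[ℝ] E) - f.smulRight y).det = l ^ Module.finrank ℝ E * (1 - l⁻¹ * f y) := by
  have h1 : ((l • (1 : E →L[ℝ] E) - f.smulRight y : E →L[ℝ] E) : E →ₗ[ℝ] E) =
      l • LinearMap.transvection (f : E →ₗ[ℝ] ℝ) (-(l⁻¹ • y)) := by
    ext v
    simp only [ContinuousLinearMap.coe_coe, sub_apply, smul_apply, one_apply_eq_self,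
      ContinuousLinearMap.smulRight_apply, LinearMap.smul_apply, LinearMap.transvection.apply]
    rw [smul_add, smul_neg, smul_neg, smul_comm (f v) l⁻¹, smul_smul, mul_inv_cancel₀ hl, one_smul,
      sub_eq_add_neg]
  rw [ContinuousLinearMap.det, h1, LinearMap.det_smul, LinearMap.transvection.det]
  simp [sub_eq_add_neg]

theorem exists_eigen_of_det_eq_zero {U : E →L[ℝ] E} {l : ℝ}
    (h : (l • (1 : E →L[ℝ] E) - U).det = 0) :
    (∃ v : E, ‖v‖ = 1 ∧ U v = l • v) ∧
      ∃ g : StrongDual ℝ E, ‖g‖ = 1 ∧ ∀ v, g (U v) = l * g v := by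
  constructor
  · obtain ⟨v, hv, hv0⟩ := (Submodule.ne_bot_iff _).1
      (bot_lt_iff_ne_bot.1 (LinearMap.bot_lt_ker_of_det_eq_zero h))
    have h1 : l • v - U v = 0 := by simpa using hv
    refine ⟨‖v‖⁻¹ • v, by simp [norm_smul, hv0], ?_⟩
    rw [map_smul, ← sub_eq_zero.1 h1, smul_comm]
  · obtain ⟨g, hg0, hg⟩ := Submodule.exists_le_ker_of_lt_top _
      (LinearMap.range_lt_top_of_det_eq_zero h)
    let g' : StrongDual ℝ E := LinearMap.toContinuousLinearMap g
    have hg' : ∀ v, g' (U v) = l * g' v := by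
      intro v
      have h1 : g ((l • (1 : E →L[ℝ] E) - U : E →L[ℝ] E) v) = 0 := hg ⟨v, rfl⟩
      have h2 : g (l • v - U v) = 0 := by simpa using h1
      rw [map_sub, map_smul, smul_eq_mul, sub_eq_zero] at h2
      exact h2.symm
    have hne : g' ≠ 0 := by
      intro h0
      apply hg0
      ext v
      exact congrArg (fun T : StrongDual ℝ E => T v) h0
    refine ⟨‖g'‖⁻¹ • g', by simp [norm_smul, hne], fun v => ?_⟩
    simp only [smul_apply, hg', smul_eq_mul]
    ring

set_option maxHeartbeats 800000 in
-- The intermediate value theorem yields eigenvalues of `U n` in `[1/2, 2]` with unit eigenvectors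
-- and eigenforms. By compactness these subconverge, necessarily to `1` and multiples of `y` and
-- `f`. What remains after subtracting the rank-one part then has norm below 1.
theorem exists_isProx_of_tendsto_aux {U : ℕ → E →L[ℝ] E} {y : E} {f : StrongDual ℝ E}
    (hU : Tendsto U atTop (𝓝 (f.smulRight y))) (hfy : f y = 1) {ε : ℝ} (hε : 0 < ε) :
    ∃ n, ∃ l : ℝ, 0 < l ∧ ∃ y' f', IsProx (l⁻¹ • U n) y' f' ∧ ‖f' - f‖ < ε := by
  have : ProperSpace E := FiniteDimensional.proper_real _
  have : ProperSpace (StrongDual ℝ E) := FiniteDimensional.proper_real _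
  have hcont : ∀ l : ℝ, Tendsto (fun n => (l • (1 : E →L[ℝ] E) - U n).det) atTop
      (𝓝 (l • (1 : E →L[ℝ] E) - f.smulRight y).det) := fun l =>
    (ContinuousLinearMap.continuous_det.tendsto _).comp (tendsto_const_nhds.sub hU)
  have h2 : ∀ᶠ n in atTop, 0 < ((2 : ℝ) • (1 : E →L[ℝ] E) - U n).det := by
    refine (hcont 2).eventually_const_lt ?_
    rw [det_smul_one_sub_smulRight _ _ two_ne_zero, hfy]
    exact mul_pos (by positivity) (by norm_num)
  have h3 : ∀ᶠ n in atTop, ((1 / 2 : ℝ) • (1 : E →L[ℝ] E) - U n).det < 0 := by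
    refine (hcont (1 / 2)).eventually_lt_const ?_
    rw [det_smul_one_sub_smulRight _ _ (by norm_num), hfy]
    exact mul_neg_of_pos_of_neg (by positivity) (by norm_num)
  obtain ⟨N, hN⟩ := eventually_atTop.1 (h2.and h3)
  have hex : ∀ n, ∃ l ∈ Icc (1 / 2 : ℝ) 2, (∃ v : E, ‖v‖ = 1 ∧ U (n + N) v = l • v) ∧
      ∃ g : StrongDual ℝ E, ‖g‖ = 1 ∧ ∀ v, g (U (n + N) v) = l * g v := by
    intro n
    have hc : ContinuousOn (fun l : ℝ => (l • (1 : E →L[ℝ] E) - U (n + N)).det) (Icc (1 / 2) 2) :=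
      (ContinuousLinearMap.continuous_det.comp (by fun_prop)).continuousOn
    have hn := hN (n + N) (by omega)
    obtain ⟨l, hl, hl0⟩ := intermediate_value_Icc (by norm_num) hc ⟨hn.2.le, hn.1.le⟩
    exact ⟨l, hl, exists_eigen_of_det_eq_zero hl0⟩
  choose l hl v g using hex
  choose v hv using v
  choose g hg using g
  obtain ⟨a, ha, φ, hφ, hlim⟩ := ((isCompact_Icc (a := (1 / 2 : ℝ)) (b := 2)).prod
    ((isCompact_sphere (0 : E) 1).prod (isCompact_sphere (0 : StrongDual ℝ E) 1))).tendsto_subseq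
    (x := fun n => (l n, v n, g n)) (fun n => ⟨hl n, by simpa using (hv n).1, by simpa using (hg n).1⟩)
  obtain ⟨l₀, v₀, g₀⟩ := a
  have tl : Tendsto (fun n => l (φ n)) atTop (𝓝 l₀) :=
    continuous_fst.continuousAt.tendsto.comp hlim
  have tv : Tendsto (fun n => v (φ n)) atTop (𝓝 v₀) :=
    (continuous_fst.comp continuous_snd).continuousAt.tendsto.comp hlim
  have tg : Tendsto (fun n => g (φ n)) atTop (𝓝 g₀) :=
    (continuous_snd.comp continuous_snd).continuousAt.tendsto.comp hlim
  have tU : Tendsto (fun n => U (φ n + N)) atTop (𝓝 (f.smulRight y)) :=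
    hU.comp (tendsto_atTop_mono (fun n => Nat.le_add_right _ _) hφ.tendsto_atTop)
  have hl0 : 1 / 2 ≤ l₀ := ha.1.1
  have hl0' : l₀ ≠ 0 := by linarith
  have hv0 : v₀ ≠ 0 := by
    have : ‖v₀‖ = 1 := by simpa using ha.2.1
    rintro rfl
    simp at this
  have hg0 : g₀ ≠ 0 := by
    have : ‖g₀‖ = 1 := by simpa using ha.2.2
    rintro rfl
    simp at this
  -- This limiting equation makes `v₀` a multiple of `y`, and applying `f` to it gives `l₀ = 1`.
  have ev : f v₀ • y = l₀ • v₀ := by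
    have h1 := tendsto_clm_apply tU tv
    have h2 : Tendsto (fun n => U (φ n + N) (v (φ n))) atTop (𝓝 (l₀ • v₀)) :=
      (tl.smul tv).congr fun n => ((hv (φ n)).2).symm
    exact tendsto_nhds_unique h1 h2
  have hfv : f v₀ ≠ 0 := by
    intro h0
    rw [h0, zero_smul] at ev
    exact hv0 ((smul_eq_zero.1 ev.symm).resolve_left hl0')
  have hl1 : l₀ = 1 := by
    have := congrArg f ev
    simp only [map_smul, smul_eq_mul, hfy, mul_one] at this
    have : (l₀ - 1) * f v₀ = 0 := by linarith
    rcases mul_eq_zero.1 this with h | h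
    · linarith
    · exact absurd h hfv
  subst hl1
  rw [one_smul] at ev
  have eg : ∀ x, g₀ x = g₀ y * f x := by
    intro x
    have h1 : Tendsto (fun n => g (φ n) (U (φ n + N) x)) atTop (𝓝 (g₀ (f x • y))) :=
      tendsto_clm_apply tg (tendsto_clm_apply tU tendsto_const_nhds)
    have h2 : Tendsto (fun n => g (φ n) (U (φ n + N) x)) atTop (𝓝 (1 * g₀ x)) :=
      (tl.mul (tendsto_clm_apply tg tendsto_const_nhds)).congr fun n => ((hg (φ n)).2 x).symm
    have := tendsto_nhds_unique h2 h1
    rw [one_mul, map_smul, smul_eq_mul] at this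
    rw [this, mul_comm]
  have hgy : g₀ y ≠ 0 := by
    intro h0
    apply hg0
    ext x
    rw [eg, h0, zero_mul]
    rfl
  have hgv : g₀ v₀ ≠ 0 := by
    rw [eg]
    exact mul_ne_zero hgy hfv
  have tgv : Tendsto (fun n => g (φ n) (v (φ n))) atTop (𝓝 (g₀ v₀)) := tendsto_clm_apply tg tv
  have tfv : Tendsto (fun n => f (v (φ n))) atTop (𝓝 (f v₀)) := (f.continuous.tendsto _).comp tv
  -- The eigenvectors and eigenforms are rescaled so that `f' n (y' n) = 1` and so that the limits
  -- are exactly `y` and `f`.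
  let y' : ℕ → E := fun n => (f (v (φ n)))⁻¹ • v (φ n)
  let f' : ℕ → StrongDual ℝ E := fun n => (f (v (φ n)) / g (φ n) (v (φ n))) • g (φ n)
  have ty' : Tendsto y' atTop (𝓝 y) := by
    have h1 : Tendsto y' atTop (𝓝 ((f v₀)⁻¹ • v₀)) := (tfv.inv₀ hfv).smul tv
    rwa [← ev, smul_smul, map_smul, smul_eq_mul, hfy, mul_one, inv_mul_cancel₀ hfv, one_smul] at h1
  have tf' : Tendsto f' atTop (𝓝 f) := by
    have h1 : Tendsto f' atTop (𝓝 ((f v₀ / g₀ v₀) • g₀)) := (tfv.div tgv hgv).smul tg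
    have h2 : (f v₀ / g₀ v₀) • g₀ = f := by
      ext x
      rw [smul_apply, eg v₀, eg x, smul_eq_mul]
      field_simp
    rwa [h2] at h1
  have tP : Tendsto (fun n => (f' n).smulRight (y' n)) atTop (𝓝 (f.smulRight y)) :=
    ((ContinuousLinearMap.smulRightL ℝ E E).isBoundedBilinearMap.continuous.tendsto (f, y)).comp
      (tf'.prodMk_nhds ty')
  have tR : Tendsto (fun n => ‖(l (φ n))⁻¹ • U (φ n + N) - (f' n).smulRight (y' n)‖) atTop
      (𝓝 0) := by
    have := (((tl.inv₀ one_ne_zero).smul tU).sub tP).norm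
    simpa using this
  have tf'' : Tendsto (fun n => ‖f' n - f‖) atTop (𝓝 0) :=
    tendsto_iff_norm_sub_tendsto_zero.1 tf'
  obtain ⟨n, ⟨⟨hn1, hn2⟩, hn3⟩, hn4⟩ := ((((tR.eventually_lt_const one_pos).and
    (tf''.eventually_lt_const hε)).and (tgv.eventually_ne hgv)).and (tfv.eventually_ne hfv)).exists
  have hlpos : 0 < l (φ n) := by linarith [(hl (φ n)).1]
  refine ⟨φ n + N, l (φ n), hlpos, y' n, f' n, isProx_of_tendsto_sub_pow ?_ ?_ ?_
    (tendsto_pow_atTop_nhds_zero_of_norm_lt_one hn1), hn2⟩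
  · simp only [f', y', smul_apply, map_smul, smul_eq_mul]
    field_simp
  · simp only [y', smul_apply, map_smul, (hv (φ n)).2]
    rw [smul_smul, smul_smul]
    congr 1
    field_simp
  · intro x
    simp only [f', smul_apply, map_smul, smul_eq_mul, (hg (φ n)).2]
    field_simp

/-- Operators close to a rank-one operator with nonzero trace are proximal up to scaling. -/
theorem eventually_exists_isProx {U : ℕ → E →L[ℝ] E} {y : E} {f : StrongDual ℝ E}
    (hU : Tendsto U atTop (𝓝 (f.smulRight y))) (hfy : f y = 1) {ε : ℝ} (hε : 0 < ε) :
    ∀ᶠ n in atTop, ∃ l : ℝ, 0 < l ∧ ∃ y' f', IsProx (l⁻¹ • U n) y' f' ∧ ‖f' - f‖ < ε := by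
  by_contra hcon
  obtain ⟨φ, hφ, h⟩ := extraction_of_frequently_atTop (not_eventually.1 hcon)
  obtain ⟨n, hn⟩ := exists_isProx_of_tendsto_aux (hU.comp hφ.tendsto_atTop) hfy hε
  exact h n hn

variable {C : Set E} {G : Subgroup (GLin E)} (hG : IsCocompactAction C G)

include hG in
theorem eventually_exists_isPosProx {U : ℕ → GLin E} (hUG : ∀ n, U n ∈ G) {r : ℕ → ℝ}
    (hr : ∀ n, 0 < r n) {a : E} {f : StrongDual ℝ E}
    (hU : Tendsto (fun n => r n • (U n).1) atTop (𝓝 (f.smulRight a))) (hfa : 0 < f a)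
    (hf : ∀ v ∈ closure C, 0 ≤ f v) {ε : ℝ} (hε : 0 < ε) :
    ∀ᶠ n in atTop, ∃ t : ℝ, 0 < t ∧ ∃ S : GLin E, S.1 = t • (U n).1 ∧ S⁻¹.1 = t⁻¹ • (U n)⁻¹.1 ∧
      ∃ y' f', IsPosProx C G S y' f' ∧ ‖f' - f‖ < ε := by
  obtain ⟨c, hc⟩ := hG.sharp.nonempty
  have hfc : 0 < f c := by
    refine hG.sharp.pos_of_nonneg hf ?_ hc
    rintro rfl
    simp at hfa
  have hc0 : 0 < ‖c‖ := norm_pos_iff.2 fun h => hG.sharp.zero_notMem (h ▸ hc)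
  have hU' : Tendsto (fun n => ((f a)⁻¹ * r n) • (U n).1) atTop
      (𝓝 (f.smulRight ((f a)⁻¹ • a))) := by
    have := hU.const_smul (f a)⁻¹
    simp_rw [smul_smul] at this
    convert this using 2
    ext v
    simp only [ContinuousLinearMap.smulRight_apply, smul_apply]
    rw [smul_comm]
  filter_upwards [eventually_exists_isProx hU' (by simp [hfa.ne'])
    (lt_min hε (div_pos hfc hc0))] with n hn
  obtain ⟨l, hl, y', f', hpr, hlt⟩ := hn
  have ht : 0 < l⁻¹ * ((f a)⁻¹ * r n) := by have := hr n; positivity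
  obtain ⟨S, hS, e, e'⟩ := hG.exists_smul_mem (hUG n) ht
  rw [smul_smul, ← e] at hpr
  obtain ⟨σ, hσ, h1, h2, h3⟩ := hG.exists_sign hS hpr
  -- The perturbed form is within `f c / ‖c‖` of `f`, hence positive at `c ∈ C`; the opposite sign
  -- normalisation is impossible.
  have hσ1 : σ = 1 := by
    rcases hσ with h | rfl
    · exact h
    exfalso
    have h4 := h3 c (subset_closure hc)
    simp only [smul_apply, smul_eq_mul] at h4
    have h5 : ‖(f' - f) c‖ < f c := by
      calc ‖(f' - f) c‖ ≤ ‖f' - f‖ * ‖c‖ := ContinuousLinearMap.le_opNorm _ _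
        _ < f c / ‖c‖ * ‖c‖ := by gcongr; exact hlt.trans_le (min_le_right _ _)
        _ = f c := by field_simp
    rw [Real.norm_eq_abs, sub_apply] at h5
    have := (abs_lt.1 h5).1
    linarith
  subst hσ1
  rw [one_smul] at h1 h2 h3
  rw [one_smul] at h1
  exact ⟨_, ht, S, e, e', y', f', ⟨hS, h1, h2, h3⟩, hlt.trans_le (min_le_left _ _)⟩

include hG in
-- A single large index makes `U n` and its inverse proximal at once. Coercivity of `f₁ + f₂` with
-- constant `ε` survives an error below `ε / 2` in each form.
theorem exists_isBiprox_of_tendsto {U : ℕ → GLin E} (hUG : ∀ n, U n ∈ G) {r s : ℕ → ℝ}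
    (hr : ∀ n, 0 < r n) (hs : ∀ n, 0 < s n) {a b : E} {f₁ f₂ : StrongDual ℝ E}
    (hU : Tendsto (fun n => r n • (U n).1) atTop (𝓝 (f₁.smulRight a)))
    (hU' : Tendsto (fun n => s n • (U n)⁻¹.1) atTop (𝓝 (f₂.smulRight b)))
    (ha : 0 < f₁ a) (hb : 0 < f₂ b) (hf₁ : ∀ v ∈ closure C, 0 ≤ f₁ v)
    (hf₂ : ∀ v ∈ closure C, 0 ≤ f₂ v) (hp : PosOn C (f₁ + f₂)) :
    ∃ S S' x x' f f', IsBiprox C G S S' x x' f f' ∧ PosOn C (f + f') := by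
  obtain ⟨ε, hε, hle⟩ := hG.sharp.exists_lower_bound hp
  obtain ⟨n, h1, h2⟩ := ((eventually_exists_isPosProx hG hUG hr hU ha hf₁ (half_pos hε)).and
    (eventually_exists_isPosProx hG (fun n => G.inv_mem (hUG n)) hs hU' hb hf₂ (half_pos hε))).exists
  obtain ⟨t, ht, S, e, e', x, f, hS, hf⟩ := h1
  obtain ⟨t', ht', S', e1, e1', x', f', hS', hf'⟩ := h2
  refine ⟨S, S', x, x', f, f', ⟨hS, hS', t' * t, by positivity, ?_⟩, fun v hv hv0 => ?_⟩
  · rw [e1, e', smul_smul, mul_assoc, mul_inv_cancel₀ ht.ne', mul_one]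
  · have h1 := hle v hv
    have hv' : 0 < ‖v‖ := norm_pos_iff.2 hv0
    have h2 : |(f - f₁) v| ≤ ‖f - f₁‖ * ‖v‖ := ContinuousLinearMap.le_opNorm (f - f₁) v
    have h3 : |(f' - f₂) v| ≤ ‖f' - f₂‖ * ‖v‖ := ContinuousLinearMap.le_opNorm (f' - f₂) v
    have h4 : ‖f - f₁‖ * ‖v‖ < ε / 2 * ‖v‖ := by gcongr
    have h5 : ‖f' - f₂‖ * ‖v‖ < ε / 2 * ‖v‖ := by gcongr
    have h6 := neg_le_of_abs_le h2
    have h7 := neg_le_of_abs_le h3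
    simp only [sub_apply, add_apply] at *
    linarith

end Perturbation

/-! ### From two proximal elements to a biproximal one -/

section Existence

open Filter Set

variable {E : Type*} [NormedAddCommGroup E] [NormedSpace ℝ E] [FiniteDimensional ℝ E]
  {C : Set E} {G : Subgroup (GLin E)} (hG : IsCocompactAction C G)

include hG

namespace IsPosProx

/-- Limits of the normalised powers of the inverse of a proximal element. -/
theorem exists_limit_inv (hd : 2 ≤ Module.finrank ℝ E) {S : GLin E} {y : E} {f : StrongDual ℝ E}
    (h : IsPosProx C G S y f) :
    ∃ (A : E →L[ℝ] E) (φ : ℕ → ℕ), StrictMono φ ∧ (∀ n, 0 < ‖(S⁻¹ ^ n).1‖) ∧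
      Tendsto (fun n => ‖(S⁻¹ ^ φ n).1‖⁻¹ • (S⁻¹ ^ φ n).1) atTop (𝓝 A) ∧
      MapsTo A (closure C) (closure C) ∧ A ≠ 0 ∧ (∀ v, f (A v) = 0) ∧ A y = 0 := by
  have : ProperSpace (E →L[ℝ] E) := FiniteDimensional.proper_real _
  obtain ⟨c, hc⟩ := hG.sharp.nonempty
  have hc0 : 0 < ‖c‖ := norm_pos_iff.2 fun h => hG.sharp.zero_notMem (h ▸ hc)
  have hne : c ≠ f c • y := by
    intro e
    apply h.vec_notMem hG hd
    have hfc := h.pos hG hc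
    have := hG.sharp.smul_mem (f c)⁻¹ (inv_pos.2 hfc) c hc
    rw [e, map_smul, smul_eq_mul, h.prox.2, mul_one, smul_smul, inv_mul_cancel₀ hfc.ne',
      one_smul] at this
    exact this
  have hpos : ∀ n, 0 < ‖(S⁻¹ ^ n).1‖ := by
    intro n
    rw [norm_pos_iff]
    intro h0
    have := val_apply_inv_apply (S⁻¹ ^ n)⁻¹ c
    rw [inv_inv, h0, zero_apply, map_zero] at this
    exact hc0.ne' (by rw [← this, norm_zero])
  -- Since the norms blow up while `f` and `y` are invariant under `S⁻¹`, the normalised limit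
  -- satisfies `f ∘ A = 0` and `A y = 0`.
  have hinf : Tendsto (fun n : ℕ => ‖(S⁻¹ ^ n).1‖) atTop atTop := by
    refine tendsto_atTop_mono (f := fun n => ‖(S⁻¹ ^ n).1 c‖ / ‖c‖) (fun n => ?_)
      ((h.prox.tendsto_norm_inv_pow hne).atTop_div_const hc0)
    rw [div_le_iff₀ hc0]
    exact ContinuousLinearMap.le_opNorm _ _
  obtain ⟨A, hA, φ, hφ, hlim⟩ := (isCompact_sphere (0 : E →L[ℝ] E) 1).tendsto_subseq
    (x := fun n => ‖(S⁻¹ ^ n).1‖⁻¹ • (S⁻¹ ^ n).1) (fun n => by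
      rw [mem_sphere_zero_iff_norm, norm_smul, norm_inv, norm_norm, inv_mul_cancel₀ (hpos n).ne'])
  have hlim' : Tendsto (fun n => ‖(S⁻¹ ^ φ n).1‖⁻¹ • (S⁻¹ ^ φ n).1) atTop (𝓝 A) := hlim
  have happ : ∀ v, Tendsto (fun n => ‖(S⁻¹ ^ φ n).1‖⁻¹ • (S⁻¹ ^ φ n).1 v) atTop (𝓝 (A v)) :=
    fun v => tendsto_clm_apply hlim' tendsto_const_nhds
  have h0 : Tendsto (fun n => ‖(S⁻¹ ^ φ n).1‖⁻¹) atTop (𝓝 0) :=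
    tendsto_inv_atTop_zero.comp (hinf.comp hφ.tendsto_atTop)
  have hyn : ∀ n : ℕ, (S⁻¹ ^ n).1 y = y := by
    intro n
    induction n with
    | zero => rfl
    | succ n ih => rw [pow_succ, val_mul_apply, h.prox.inv_apply_self, ih]
  refine ⟨A, φ, hφ, hpos, hlim', fun v hv => ?_, ?_, fun v => ?_, ?_⟩
  · refine isClosed_closure.mem_of_tendsto (happ v) (Eventually.of_forall fun n => ?_)
    exact hG.sharp.smul_mem_closure (by positivity)
      (hG.map_mem_closure (G.pow_mem (G.inv_mem h.mem) _) hv)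
  · rintro rfl
    simp at hA
  · have h1 := (f.continuous.tendsto _).comp (happ v)
    have h2 : Tendsto (fun n => ‖(S⁻¹ ^ φ n).1‖⁻¹ * f v) atTop (𝓝 0) := by
      simpa using h0.mul_const (f v)
    refine tendsto_nhds_unique h1 (h2.congr fun n => ?_)
    simp only [Function.comp_apply, map_smul, smul_eq_mul, h.prox.form_inv_pow_apply]
  · refine tendsto_nhds_unique (happ y) ?_
    simp_rw [hyn]
    simpa using h0.smul_const y

variable {S₁ S₂ : GLin E} {y₁ y₂ : E} {f₁ f₂ : StrongDual ℝ E}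

/-- Let `w` be the sum of a finite part of the orbit of `y₁` spanning the same space. It dominates
every vector of this invariant space, so every element of `G` moves it a bounded amount. If `f₂ w >
0`, then `w ∈ C`, and a nonzero positive operator cannot kill all the summands. -/
theorem exists_apply_ne_zero_or (hd : 2 ≤ Module.finrank ℝ E) (h₁ : IsPosProx C G S₁ y₁ f₁)
    (h₂ : IsPosProx C G S₂ y₂ f₂) (hp : PosOn C (f₁ + f₂)) {A : E →L[ℝ] E}
    (hA : MapsTo A (closure C) (closure C)) (hA0 : A ≠ 0) :
    (∃ δ ∈ G, A (δ.1 y₁) ≠ 0) ∨ (f₂ y₁ = 0 ∧ ∀ g ∈ G, g.1 y₁ = f₁ (g.1 y₁) • y₁) := by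
  classical
  let O : Set E := {x | ∃ δ ∈ G, x = δ.1 y₁}
  have hO : ∀ x ∈ O, IsLimitVector C G x := by
    rintro x ⟨δ, hδ, rfl⟩
    exact hG.isLimitVector_map hδ (h₁.isLimitVector hG hd)
  have hOC : ∀ x ∈ O, x ∈ closure C := fun x hx => hG.mem_closure_of_isLimitVector (hO x hx)
  obtain ⟨s, hsO, hs⟩ := Submodule.fg_span_iff_fg_span_finset_subset O |>.1
    (IsNoetherian.noetherian (Submodule.span ℝ O))
  let w : E := ∑ x ∈ s, x
  have hw : w ∈ AddSubmonoid.closure {y | IsLimitVector C G y} :=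
    AddSubmonoid.sum_mem _ fun x hx => AddSubmonoid.subset_closure (hO x (hsO hx))
  have hwC := hG.mem_closure_of_mem hw
  have hbd : ∀ v ∈ Submodule.span ℝ O, ∃ k : ℝ, k • w - v ∈ closure C ∧ k • w + v ∈ closure C := by
    intro v hv
    rw [hs] at hv
    induction hv using Submodule.span_induction with
    | mem x hx =>
      refine ⟨1, ?_, ?_⟩
      · have : (1 : ℝ) • w - x = ∑ z ∈ s.erase x, z := by
          rw [one_smul, sub_eq_iff_eq_add', Finset.add_sum_erase s (fun z => z) hx]
        rw [this]
        refine hG.mem_closure_of_mem (AddSubmonoid.sum_mem _ fun z hz =>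
          AddSubmonoid.subset_closure (hO z (hsO (Finset.mem_of_mem_erase hz))))
      · rw [one_smul]
        exact hG.sharp.add_mem_closure hwC (hOC x (hsO hx))
    | zero => exact ⟨0, by simpa using hG.sharp.zero_mem_closure,
        by simpa using hG.sharp.zero_mem_closure⟩
    | add a b _ _ ha hb =>
      obtain ⟨k, h1, h2⟩ := ha
      obtain ⟨k', h1', h2'⟩ := hb
      refine ⟨k + k', ?_, ?_⟩
      · have := hG.sharp.add_mem_closure h1 h1'
        convert this using 1
        module
      · have := hG.sharp.add_mem_closure h2 h2'
        convert this using 1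
        module
    | smul r a _ ha =>
      obtain ⟨k, h1, h2⟩ := ha
      rcases le_total 0 r with hr | hr
      · refine ⟨r * k, ?_, ?_⟩
        · have := hG.sharp.smul_mem_closure hr h1
          rwa [smul_sub, smul_smul] at this
        · have := hG.sharp.smul_mem_closure hr h2
          rwa [smul_add, smul_smul] at this
      · refine ⟨-r * k, ?_, ?_⟩
        · have := hG.sharp.smul_mem_closure (neg_nonneg.2 hr) h2
          convert this using 1
          module
        · have := hG.sharp.smul_mem_closure (neg_nonneg.2 hr) h1
          convert this using 1
          module
  have hmono : ∀ {k k' : ℝ} {v : E}, k ≤ k' → k • w - v ∈ closure C → k' • w - v ∈ closure C := by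
    intro k k' v hkk h
    have e : k' • w - v = (k • w - v) + (k' - k) • w := by module
    rw [e]
    exact hG.sharp.add_mem_closure h (hG.sharp.smul_mem_closure (by linarith) hwC)
  have horb : ∀ g ∈ G, g.1 w ∈ Submodule.span ℝ O := by
    intro g hg
    rw [map_sum]
    refine Submodule.sum_mem _ fun x hx => Submodule.subset_span ?_
    obtain ⟨δ, hδ, rfl⟩ := hsO hx
    exact ⟨g * δ, G.mul_mem hg hδ, rfl⟩
  obtain ⟨k₁, hk₁, -⟩ := hbd _ (horb _ h₁.mem)
  obtain ⟨k₁', hk₁', -⟩ := hbd _ (horb _ (G.inv_mem h₁.mem))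
  obtain ⟨k₂, hk₂, -⟩ := hbd _ (horb _ h₂.mem)
  obtain ⟨k₂', hk₂', -⟩ := hbd _ (horb _ (G.inv_mem h₂.mem))
  have hy₁O : y₁ ∈ O := ⟨1, G.one_mem, rfl⟩
  have hw₁ : 0 < f₁ w := by
    obtain ⟨k, hk, -⟩ := hbd y₁ (Submodule.subset_span hy₁O)
    have h3 := h₁.nonneg _ hk
    rw [map_sub, map_smul, smul_eq_mul, h₁.prox.2] at h3
    rcases (h₁.nonneg w hwC).eq_or_lt with h4 | h4
    · rw [← h4] at h3
      linarith
    · exact h4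
  -- If `f₂ w = 0`, then `f₂` vanishes on the whole orbit, because `w` dominates it. An orbit vector
  -- off the line of `y₁` would be pushed by `S₁⁻ⁿ` to where `f₂ > 0`, so this line is fixed by `G`.
  rcases (h₂.nonneg w hwC).eq_or_lt with hw₂ | hw₂
  · right
    have hzero : ∀ δ ∈ G, f₂ (δ.1 y₁) = 0 := by
      intro δ hδ
      have hm : δ.1 y₁ ∈ O := ⟨δ, hδ, rfl⟩
      obtain ⟨k, hk, -⟩ := hbd _ (Submodule.subset_span hm)
      have h3 := h₂.nonneg _ hk
      rw [map_sub, map_smul, smul_eq_mul, ← hw₂] at h3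
      have h4 := h₂.nonneg _ (hOC _ hm)
      linarith
    refine ⟨hzero 1 G.one_mem, fun g hg => ?_⟩
    by_contra hne
    obtain ⟨n, hn⟩ := (h₁.eventually_le hG hp (hOC _ ⟨g, hg, rfl⟩) hne).exists
    have := hzero (S₁⁻¹ ^ n * g) (G.mul_mem (G.pow_mem (G.inv_mem h₁.mem) n) hg)
    rw [val_mul_apply] at this
    linarith
  · left
    have hwmem : w ∈ C := mem_of_bounded_of_posOn hG h₁ h₂ hp hw
      (k := max (max k₁ k₁') (max k₂ k₂'))
      (hmono ((le_max_left _ _).trans (le_max_left _ _)) hk₁)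
      (hmono ((le_max_right _ _).trans (le_max_left _ _)) hk₁')
      (hmono ((le_max_left _ _).trans (le_max_right _ _)) hk₂)
      (hmono ((le_max_right _ _).trans (le_max_right _ _)) hk₂') hw₁ hw₂
    have hAw := hG.sharp.apply_ne_zero hA hA0 hwmem
    rw [map_sum] at hAw
    obtain ⟨x, hx, hAx⟩ := Finset.exists_ne_zero_of_sum_ne_zero hAw
    obtain ⟨δ, hδ, rfl⟩ := hsO hx
    exact ⟨δ, hδ, hAx⟩

/-- A positive operator commuting with a proximal element whose image is killed by the other form
has rank one. -/
theorem apply_eq_of_commute {S : GLin E} {y : E} {f f' : StrongDual ℝ E}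
    (h : IsPosProx C G S y f) (hp : PosOn C (f + f')) {B : E →L[ℝ] E}
    (hB : MapsTo B (closure C) (closure C)) (hBS : B * S.1 = S.1 * B) (hf' : ∀ v, f' (B v) = 0)
    (v : E) : B v = f (B v) • y := by
  have hcomm : ∀ n : ℕ, ∀ x, (S⁻¹ ^ n).1 (B x) = B ((S⁻¹ ^ n).1 x) := by
    intro n x
    have h1 : Commute B S.1 := hBS
    have h2 : Commute B (S⁻¹ ^ n).1 := by
      rw [Units.val_pow_eq_pow_val]
      exact h1.units_inv_right.pow_right n
    exact (congrArg (fun T : E →L[ℝ] E => T x) h2.eq).symm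
  -- Otherwise `S⁻ⁿ (B x)` would eventually have positive `f'`, although it equals `B (S⁻ⁿ x)`, on
  -- which `f'` vanishes.
  have key : ∀ x ∈ C, B x = f (B x) • y := by
    intro x hx
    by_contra hne
    obtain ⟨n, hn⟩ := (h.eventually_le hG hp (hB (subset_closure hx)) hne).exists
    rw [hcomm, hf'] at hn
    exact lt_irrefl _ hn
  obtain ⟨c, hc⟩ := hG.sharp.nonempty
  obtain ⟨k, hk, hdom⟩ := hG.sharp.exists_dominate hc
  -- Every `v` is a combination of `c` and the vector `c + ((k * ‖v‖) • c - v)` of `C`, so linearity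
  -- extends the identity from `C` to the whole space.
  have h1 := key _ (hG.sharp.add_closure_mem hc (hdom v))
  have h2 := key c hc
  simp only [map_add, map_sub, map_smul, smul_eq_mul] at h1
  rw [add_smul, sub_smul, ← h2, mul_smul (k * ‖v‖) (f (B c)), ← h2] at h1
  have h3 := add_left_cancel h1
  exact sub_right_injective h3

/-- Directions of `S₂⁻ⁿ w` accumulate in the kernel of `f₂`, where `f₁ > 0` by positivity of the
sum. Hence `S₁ⁿ` sends them towards the line of `y₁`, which `L` does not kill. -/
theorem eventually_apply_ne_zero (h₁ : IsPosProx C G S₁ y₁ f₁)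
    (h₂ : IsPosProx C G S₂ y₂ f₂) (hp : PosOn C (f₁ + f₂)) {L : E →L[ℝ] E} (hL : L y₁ ≠ 0)
    {w : E} (hw : w ∈ closure C) (hwy : w ≠ f₂ w • y₂) :
    ∀ᶠ n : ℕ in atTop, L ((S₁ ^ n).1 ((S₂⁻¹ ^ n).1 w)) ≠ 0 := by
  have : ProperSpace E := FiniteDimensional.proper_real _
  by_contra hcon
  have hinf := h₂.prox.tendsto_norm_inv_pow hwy
  have hfr : ∃ᶠ n : ℕ in atTop, L ((S₁ ^ n).1 ((S₂⁻¹ ^ n).1 w)) = 0 := by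
    simpa using not_eventually.1 hcon
  obtain ⟨φ, hφ, hzero⟩ := extraction_of_frequently_atTop hfr
  have hw0 : w ≠ 0 := by
    rintro rfl
    simp at hwy
  have hpos : ∀ n : ℕ, 0 < ‖(S₂⁻¹ ^ n).1 w‖ := by
    intro n
    rw [norm_pos_iff]
    intro h0
    have := val_apply_inv_apply (S₂⁻¹ ^ n)⁻¹ w
    rw [inv_inv, h0, map_zero] at this
    exact hw0 this.symm
  obtain ⟨e, he, ψ, hψ, hlim⟩ := (isCompact_sphere (0 : E) 1).tendsto_subseq
    (x := fun n => ‖(S₂⁻¹ ^ φ n).1 w‖⁻¹ • (S₂⁻¹ ^ φ n).1 w) (fun n => by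
      rw [mem_sphere_zero_iff_norm, norm_smul, norm_inv, norm_norm,
        inv_mul_cancel₀ (hpos (φ n)).ne'])
  have hφψ : Tendsto (fun n => φ (ψ n)) atTop atTop := hφ.tendsto_atTop.comp hψ.tendsto_atTop
  have heC : e ∈ closure C := isClosed_closure.mem_of_tendsto hlim (Eventually.of_forall fun n =>
    hG.sharp.smul_mem_closure (by positivity)
      (hG.map_mem_closure (G.pow_mem (G.inv_mem h₂.mem) _) hw))
  have he0 : e ≠ 0 := by
    rintro rfl
    simp at he
  have hf₂e : f₂ e = 0 := by
    have h1 := (f₂.continuous.tendsto _).comp hlim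
    have h2 : Tendsto (fun n => ‖(S₂⁻¹ ^ φ (ψ n)).1 w‖⁻¹ * f₂ w) atTop (𝓝 0) := by
      simpa using (tendsto_inv_atTop_zero.comp (hinf.comp hφψ)).mul_const (f₂ w)
    refine tendsto_nhds_unique h1 (h2.congr fun n => ?_)
    simp only [Function.comp_apply, map_smul, smul_eq_mul, h₂.prox.form_inv_pow_apply]
  have hf₁e : 0 < f₁ e := by
    have := hp e heC he0
    rwa [add_apply, hf₂e, add_zero] at this
  have hS : Tendsto (fun n => S₁.1 ^ φ (ψ n)) atTop (𝓝 (f₁.smulRight y₁)) := h₁.prox.1.comp hφψ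
  have h3 := (L.continuous.tendsto _).comp (tendsto_clm_apply hS hlim)
  have h4 : L ((f₁.smulRight y₁) e) = 0 := by
    refine tendsto_nhds_unique h3 (tendsto_const_nhds.congr fun n => ?_)
    have := hzero (ψ n)
    rw [Units.val_pow_eq_pow_val] at this
    simp only [Function.comp_apply, map_smul, this, smul_zero]
  rw [ContinuousLinearMap.smulRight_apply, map_smul] at h4
  exact (smul_ne_zero hf₁e.ne' hL) h4

/-- The case of a common fixed point. -/
theorem exists_isBiprox_of_fixed (hd : 2 ≤ Module.finrank ℝ E) (h₁ : IsPosProx C G S₁ y₁ f₁)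
    (h₂ : IsPosProx C G S₂ y₂ f₂) (hp : PosOn C (f₁ + f₂)) (hf : f₂ y₁ = 0)
    (hfix : ∀ g ∈ G, g.1 y₁ = f₁ (g.1 y₁) • y₁) :
    ∃ S S' x x' f f', IsBiprox C G S S' x x' f f' ∧ PosOn C (f + f') := by
  have : ProperSpace (E →L[ℝ] E) := FiniteDimensional.proper_real _
  set K : ℝ := max (max (f₁ (S₁.1 y₁)) (f₁ (S₁⁻¹.1 y₁))) (max (f₁ (S₂.1 y₁)) (f₁ (S₂⁻¹.1 y₁)))
    with hK
  have hbd : ∀ g ∈ G, f₁ (g.1 y₁) ≤ K → K • y₁ - g.1 y₁ ∈ closure C := by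
    intro g hg hle
    rw [hfix g hg, ← sub_smul]
    exact hG.sharp.smul_mem_closure (by linarith) h₁.vec_mem
  -- The vector `y₁` itself is moved a bounded amount, being a common eigenvector. As `f₂ y₁ = 0`,
  -- the bound of `mem_of_bounded_of_posOn` is lost, and the unboundedness of the `z n` is what gets
  -- exploited.
  obtain ⟨c, hc, p, hpC, t, z, ht, ht0, hz, hlim, hcomm⟩ := hG.exists_centralizing
    (AddSubmonoid.subset_closure (h₁.isLimitVector hG hd)) h₁.mem h₂.mem
    (hbd _ h₁.mem ((le_max_left _ _).trans (le_max_left _ _)))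
    (hbd _ (G.inv_mem h₁.mem) ((le_max_right _ _).trans (le_max_left _ _)))
    (hbd _ h₂.mem ((le_max_left _ _).trans (le_max_right _ _)))
    (hbd _ (G.inv_mem h₂.mem) ((le_max_right _ _).trans (le_max_right _ _)))
  have hc₁ : ∀ n, (z n).1 * S₁.1 = S₁.1 * (z n).1 := fun n => by
    obtain ⟨κ, hκ⟩ := (hcomm n).1
    exact h₁.commute_of_smul hG (hz n) hκ
  have hc₂ : ∀ n, (z n).1 * S₂.1 = S₂.1 * (z n).1 := fun n => by
    obtain ⟨κ, hκ⟩ := (hcomm n).2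
    exact h₂.commute_of_smul hG (hz n) hκ
  let α : ℕ → ℝ := fun n => f₁ ((z n).1 y₁)
  let β : ℕ → ℝ := fun n => f₂ ((z n).1 y₂)
  have hα : ∀ n v, f₁ ((z n).1 v) = α n * f₁ v := fun n v => (h₁.prox.of_commute (hc₁ n) v).1
  have hβ : ∀ n v, f₂ ((z n).1 v) = β n * f₂ v := fun n v => (h₂.prox.of_commute (hc₂ n) v).1
  have hzy : ∀ n, (z n).1 y₁ = α n • y₁ := fun n => hfix _ (hz n)
  have hf₁p := h₁.pos hG hpC
  have hf₂p := h₂.pos hG hpC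
  have hf₂c := h₂.pos hG hc
  have tα : Tendsto α atTop (𝓝 (f₁ p)) := by
    have h3 : Tendsto (fun n => f₁ (y₁ + t n • c)) atTop (𝓝 1) := by
      have : Tendsto (fun n => f₁ y₁ + t n * f₁ c) atTop (𝓝 (f₁ y₁ + 0 * f₁ c)) :=
        tendsto_const_nhds.add (ht0.mul_const _)
      rw [h₁.prox.2, zero_mul, add_zero] at this
      exact this.congr fun n => by simp [h₁.prox.2]
    have h4 : Tendsto (fun n => f₁ ((z n).1 (y₁ + t n • c))) atTop (𝓝 (f₁ p)) :=
      (f₁.continuous.tendsto _).comp hlim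
    have h5 := h4.div h3 one_ne_zero
    rw [div_one] at h5
    refine h5.congr' ?_
    filter_upwards [h3.eventually_ne one_ne_zero] with n hn
    rw [Pi.div_apply, hα, mul_div_cancel_right₀ _ hn]
  -- The multiplier of `f₁` converges while that of `f₂` grows like `1 / t n`: `t n • z n` kills
  -- `f₁` in the limit, and the inverses of `z n` kill `f₂`.
  have tβ : Tendsto (fun n => t n * β n) atTop (𝓝 (f₂ p / f₂ c)) := by
    have h4 : Tendsto (fun n => f₂ ((z n).1 (y₁ + t n • c))) atTop (𝓝 (f₂ p)) :=
      (f₂.continuous.tendsto _).comp hlim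
    refine (h4.div_const (f₂ c)).congr fun n => ?_
    rw [hβ, map_add, hf, zero_add, map_smul, smul_eq_mul]
    field_simp
  have hzinv : ∀ n v, (z n).1 ((z n)⁻¹.1 v) = v := fun n v => val_apply_inv_apply _ _
  have hα' : ∀ n v, f₁ ((z n)⁻¹.1 v) = f₁ v / α n := fun n v => by
    have h3 := hα n ((z n)⁻¹.1 v)
    rw [hzinv] at h3
    have h4 : α n ≠ 0 := by
      intro h0
      have := hα n ((z n)⁻¹.1 c)
      rw [hzinv, h0, zero_mul] at this
      exact (h₁.pos hG hc).ne' this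
    rw [h3, mul_div_cancel_left₀ _ h4]
  have hβ0 : ∀ n, β n ≠ 0 := fun n h0 => by
    have := hβ n ((z n)⁻¹.1 c)
    rw [hzinv, h0, zero_mul] at this
    exact (h₂.pos hG hc).ne' this
  have hβ' : ∀ n v, f₂ ((z n)⁻¹.1 v) = t n / (t n * β n) * f₂ v := fun n v => by
    have h3 := hβ n ((z n)⁻¹.1 v)
    rw [hzinv] at h3
    have h4 := hβ0 n
    have h5 := (ht n).ne'
    rw [h3]
    field_simp
  have tα' : ∀ v, Tendsto (fun n => f₁ ((z n)⁻¹.1 v)) atTop (𝓝 (f₁ v / f₁ p)) := fun v =>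
    (tendsto_const_nhds.div tα hf₁p.ne').congr fun n => (hα' n v).symm
  have tβ' : ∀ v, Tendsto (fun n => f₂ ((z n)⁻¹.1 v)) atTop (𝓝 0) := fun v => by
    have h3 := ((ht0.div tβ (div_pos hf₂p hf₂c).ne').mul_const (f₂ v))
    rw [zero_div, zero_mul] at h3
    exact h3.congr fun n => (hβ' n v).symm
  obtain ⟨M, hM, hn⟩ := hG.sharp.exists_opNorm_le hc
  obtain ⟨ε, hε, hle⟩ := hG.sharp.exists_lower_bound hp
  have hcC := subset_closure hc
  have hpos_map : ∀ n, MapsTo (t n • (z n).1) (closure C) (closure C) := fun n v hv =>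
    hG.sharp.smul_mem_closure (ht n).le (hG.map_mem_closure (hz n) hv)
  have hb : ∃ R, ∀ n, ‖t n • (z n).1‖ ≤ R := by
    have h3 : Tendsto (fun n => (t n • (z n).1) c) atTop (𝓝 (p - f₁ p • y₁)) := by
      refine (hlim.sub (tα.smul_const y₁)).congr fun n => ?_
      rw [map_add, map_smul, hzy, add_sub_cancel_left, smul_apply]
    obtain ⟨R, hR⟩ := h3.norm.bddAbove_range
    exact ⟨M * R, fun n => (hn _ (hpos_map n)).trans
      (mul_le_mul_of_nonneg_left (hR ⟨n, rfl⟩) hM.le)⟩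
  have hb' : ∃ R, ∀ n, ‖(z n)⁻¹.1‖ ≤ R := by
    obtain ⟨R, hR⟩ := ((tα' c).add (tβ' c)).bddAbove_range
    refine ⟨M * (R / ε), fun n => (hn _ (hG.mapsTo (G.inv_mem (hz n)))).trans
      (mul_le_mul_of_nonneg_left ?_ hM.le)⟩
    rw [le_div_iff₀ hε, mul_comm]
    exact (hle _ (hG.map_mem_closure (G.inv_mem (hz n)) hcC)).trans (hR ⟨n, rfl⟩)
  obtain ⟨R, hR⟩ := hb
  obtain ⟨R', hR'⟩ := hb'
  obtain ⟨⟨B, B'⟩, -, φ, hφ, hlimB⟩ := ((isCompact_closedBall (0 : E →L[ℝ] E) R).prod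
    (isCompact_closedBall (0 : E →L[ℝ] E) R')).tendsto_subseq
    (x := fun n => (t n • (z n).1, (z n)⁻¹.1)) (fun n => ⟨by simpa using hR n, by simpa using hR' n⟩)
  have tB : Tendsto (fun n => t (φ n) • (z (φ n)).1) atTop (𝓝 B) :=
    continuous_fst.continuousAt.tendsto.comp hlimB
  have tB' : Tendsto (fun n => (z (φ n))⁻¹.1) atTop (𝓝 B') :=
    continuous_snd.continuousAt.tendsto.comp hlimB
  have tBv : ∀ v, Tendsto (fun n => t (φ n) • (z (φ n)).1 v) atTop (𝓝 (B v)) := fun v =>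
    tendsto_clm_apply tB tendsto_const_nhds
  have tBv' : ∀ v, Tendsto (fun n => (z (φ n))⁻¹.1 v) atTop (𝓝 (B' v)) := fun v =>
    tendsto_clm_apply tB' tendsto_const_nhds
  have mB : MapsTo B (closure C) (closure C) := fun v hv =>
    isClosed_closure.mem_of_tendsto (tBv v) (Eventually.of_forall fun n => hpos_map _ hv)
  have mB' : MapsTo B' (closure C) (closure C) := fun v hv =>
    isClosed_closure.mem_of_tendsto (tBv' v) (Eventually.of_forall fun n =>
      hG.map_mem_closure (G.inv_mem (hz _)) hv)
  have f₁B : ∀ v, f₁ (B v) = 0 := fun v => by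
    refine tendsto_nhds_unique ((f₁.continuous.tendsto _).comp (tBv v)) ?_
    have h3 := (((ht0.mul tα).mul_const (f₁ v)).comp hφ.tendsto_atTop)
    rw [zero_mul, zero_mul] at h3
    refine h3.congr fun n => ?_
    simp only [Function.comp_apply, map_smul, smul_eq_mul, hα]
    ring
  have f₂B : ∀ v, f₂ (B v) = f₂ p / f₂ c * f₂ v := fun v => by
    refine tendsto_nhds_unique ((f₂.continuous.tendsto _).comp (tBv v)) ?_
    refine ((tβ.mul_const (f₂ v)).comp hφ.tendsto_atTop).congr fun n => ?_
    simp only [Function.comp_apply, map_smul, smul_eq_mul, hβ]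
    ring
  have f₁B' : ∀ v, f₁ (B' v) = f₁ v / f₁ p := fun v =>
    tendsto_nhds_unique ((f₁.continuous.tendsto _).comp (tBv' v)) ((tα' v).comp hφ.tendsto_atTop)
  have f₂B' : ∀ v, f₂ (B' v) = 0 := fun v =>
    tendsto_nhds_unique ((f₂.continuous.tendsto _).comp (tBv' v)) ((tβ' v).comp hφ.tendsto_atTop)
  have cB : B * S₂.1 = S₂.1 * B := by
    refine tendsto_nhds_unique (tB.mul_const S₂.1) ((tB.const_mul S₂.1).congr fun n => ?_)
    rw [smul_mul_assoc, mul_smul_comm, hc₂]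
  have cB' : B' * S₁.1 = S₁.1 * B' := by
    refine tendsto_nhds_unique (tB'.mul_const S₁.1) ((tB'.const_mul S₁.1).congr fun n => ?_)
    have : Commute S₁.1 (z (φ n)).1 := (hc₁ _).symm
    exact this.units_inv_right.eq
  have hp' : PosOn C (f₂ + f₁) := by rwa [add_comm]
  -- Commutation with `S₂`, respectively `S₁`, forces rank one, so `z (φ n)` and its inverse tend
  -- projectively to rank-one operators of positive trace.
  have eB : B = f₂.smulRight ((f₂ p / f₂ c) • y₂) := by
    ext v
    rw [h₂.apply_eq_of_commute hG hp' mB cB f₁B v, f₂B, ContinuousLinearMap.smulRight_apply,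
      smul_smul, mul_comm]
  have eB' : B' = f₁.smulRight ((f₁ p)⁻¹ • y₁) := by
    ext v
    rw [h₁.apply_eq_of_commute hG hp mB' cB' f₂B' v, f₁B', ContinuousLinearMap.smulRight_apply,
      smul_smul, div_eq_mul_inv]
  rw [eB] at tB
  rw [eB'] at tB'
  refine exists_isBiprox_of_tendsto hG (fun n => hz (φ n)) (fun n => ht (φ n))
    (fun _ => one_pos) tB (by simpa using tB') ?_ ?_ h₂.nonneg h₁.nonneg hp'
  · rw [map_smul, h₂.prox.2, smul_eq_mul, mul_one]
    exact div_pos hf₂p hf₂c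
  · rw [map_smul, h₁.prox.2, smul_eq_mul, mul_one]
    exact inv_pos.2 hf₁p

/-- Two proximal elements whose attracting forms span a line that meets the dual cone give rise to
a biproximal element with the same property. -/
theorem exists_isBiprox (hd : 2 ≤ Module.finrank ℝ E) (h₁ : IsPosProx C G S₁ y₁ f₁)
    (h₂ : IsPosProx C G S₂ y₂ f₂) (hp : PosOn C (f₁ + f₂)) :
    ∃ S S' x x' f f', IsBiprox C G S S' x x' f f' ∧ PosOn C (f + f') := by
  have hp' : PosOn C (f₂ + f₁) := by rwa [add_comm]
  obtain ⟨A₁, φ₁, hφ₁, hA₁pos, hA₁, mA₁, hA₁0, fA₁, hA₁y⟩ := h₁.exists_limit_inv hG hd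
  obtain ⟨A₂, φ₂, hφ₂, hA₂pos, hA₂, mA₂, hA₂0, fA₂, hA₂y⟩ := h₂.exists_limit_inv hG hd
  rcases h₁.exists_apply_ne_zero_or hG hd h₂ hp mA₂ hA₂0 with ⟨δ₂, hδ₂, hne₂⟩ | ⟨hf, hfix⟩
  swap
  · exact h₁.exists_isBiprox_of_fixed hG hd h₂ hp hf hfix
  rcases h₂.exists_apply_ne_zero_or hG hd h₁ hp' mA₁ hA₁0 with ⟨δ₁, hδ₁, hne₁⟩ | ⟨hf, hfix⟩
  swap
  · exact h₂.exists_isBiprox_of_fixed hG hd h₁ hp' hf hfix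
  -- `A` kills `a` but not `δ b`, so the inverse image of `a` under `δ` is not on the line of `b`;
  -- this is the genericity needed for the escape argument.
  have aux : ∀ {δ : GLin E} {A : E →L[ℝ] E} {a b : E} {f : StrongDual ℝ E}, A a = 0 → a ≠ 0 →
      A (δ.1 b) ≠ 0 → δ⁻¹.1 a ≠ f (δ⁻¹.1 a) • b := by
    intro δ A a b f hAa ha hne e
    apply hne
    set κ := f (δ⁻¹.1 a)
    have h3 := congrArg δ.1 e
    rw [val_apply_inv_apply, map_smul] at h3
    have hκ : κ ≠ 0 := by
      intro h0
      rw [h0, zero_smul] at h3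
      exact ha h3
    have h4 : κ • A (δ.1 b) = 0 := by rw [← map_smul, ← h3, hAa]
    exact (smul_eq_zero.1 h4).resolve_left hκ
  have e₁ := h₁.eventually_apply_ne_zero hG h₂ hp (L := A₂ * δ₂.1) hne₂
    (hG.map_mem_closure (G.inv_mem hδ₁) h₁.vec_mem) (aux hA₁y h₁.prox.ne_zero hne₁)
  have e₂ := h₂.eventually_apply_ne_zero hG h₁ hp' (L := A₁ * δ₁.1) hne₁
    (hG.map_mem_closure (G.inv_mem hδ₂) h₂.vec_mem) (aux hA₂y h₂.prox.ne_zero hne₂)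
  obtain ⟨n, hn₁, hn₂⟩ := (e₁.and e₂).exists
  -- The middle factor makes one `δ` serve both directions: `A₂ (δ y₁) ≠ 0` and `A₁ (δ⁻¹ y₂) ≠ 0`.
  set δ : GLin E := δ₂ * S₁ ^ n * S₂⁻¹ ^ n * δ₁⁻¹ with hδdef
  have hδ : δ ∈ G := G.mul_mem (G.mul_mem (G.mul_mem hδ₂ (G.pow_mem h₁.mem n))
    (G.pow_mem (G.inv_mem h₂.mem) n)) (G.inv_mem hδ₁)
  have hδ' : δ⁻¹ = δ₁ * S₂ ^ n * S₁⁻¹ ^ n * δ₂⁻¹ := by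
    simp only [hδdef, mul_inv_rev, inv_inv, inv_pow, mul_assoc]
  have hx₁ : A₂ (δ.1 y₁) ≠ 0 := hn₁
  have hx₂ : A₁ (δ⁻¹.1 y₂) ≠ 0 := by rw [hδ']; exact hn₂
  let U : ℕ → GLin E := fun k => S₂⁻¹ ^ φ₂ k * δ * S₁ ^ φ₁ k
  have hUinv : ∀ k, (U k)⁻¹ = S₁⁻¹ ^ φ₁ k * δ⁻¹ * S₂ ^ φ₂ k := fun k => by
    simp only [U, mul_inv_rev, inv_inv, inv_pow, mul_assoc]
  refine exists_isBiprox_of_tendsto hG (U := U)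
    (fun k => G.mul_mem (G.mul_mem (G.pow_mem (G.inv_mem h₂.mem) _) hδ) (G.pow_mem h₁.mem _))
    (r := fun k => ‖(S₂⁻¹ ^ φ₂ k).1‖⁻¹) (s := fun k => ‖(S₁⁻¹ ^ φ₁ k).1‖⁻¹)
    (fun k => inv_pos.2 (hA₂pos _)) (fun k => inv_pos.2 (hA₁pos _))
    (a := A₂ (δ.1 y₁)) (b := A₁ (δ⁻¹.1 y₂)) (f₁ := f₁) (f₂ := f₂) ?_ ?_ ?_ ?_ h₁.nonneg h₂.nonneg hp
  · have h3 := (hA₂.mul_const δ.1).mul (h₁.prox.1.comp hφ₁.tendsto_atTop)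
    have h4 : A₂ * δ.1 * f₁.smulRight y₁ = f₁.smulRight (A₂ (δ.1 y₁)) := by
      ext v
      simp
    rw [h4] at h3
    refine h3.congr fun k => ?_
    simp only [Function.comp_apply, U, Units.val_mul, Units.val_pow_eq_pow_val, smul_mul_assoc]
  · have h3 := (hA₁.mul_const δ⁻¹.1).mul (h₂.prox.1.comp hφ₂.tendsto_atTop)
    have h4 : A₁ * δ⁻¹.1 * f₂.smulRight y₂ = f₂.smulRight (A₁ (δ⁻¹.1 y₂)) := by
      ext v
      simp
    rw [h4] at h3
    refine h3.congr fun k => ?_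
    simp only [Function.comp_apply, hUinv, Units.val_mul, Units.val_pow_eq_pow_val, smul_mul_assoc]
  -- The trace `f₁ (A₂ (δ y₁))` is positive because `f₂` vanishes on the image of `A₂`.
  · have := hp _ (mA₂ (hG.map_mem_closure hδ h₁.vec_mem)) hx₁
    rwa [add_apply, fA₂, add_zero] at this
  · have := hp _ (mA₁ (hG.map_mem_closure (G.inv_mem hδ) h₂.vec_mem)) hx₂
    rwa [add_apply, fA₁, zero_add] at this

end IsPosProx

end Existence

/-! ### Dominant eigenvalues and convergence of rescaled powers -/

section Dominant

open Filter Set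

/-- Gelfand's formula bounds the norms eventually by a geometric sequence of ratio less than 1. -/
theorem tendsto_norm_pow_of_spectralRadius_lt_one {A : Type*} [NormedRing A] [NormedAlgebra ℂ A]
    [CompleteSpace A] {a : A} (h : spectralRadius ℂ a < 1) :
    Tendsto (fun n : ℕ => ‖a ^ n‖) atTop (𝓝 0) := by
  obtain ⟨ρ, hρ, hρ1⟩ := ENNReal.lt_iff_exists_nnreal_btwn.1 h
  have hρ1' : ρ < 1 := by exact_mod_cast hρ1
  have h1 := (spectrum.pow_nnnorm_pow_one_div_tendsto_nhds_spectralRadius a).eventually_lt_const hρ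
  refine squeeze_zero' (Eventually.of_forall fun n => norm_nonneg _) ?_
    (tendsto_pow_atTop_nhds_zero_of_lt_one (r := (ρ : ℝ)) ρ.2 (by exact_mod_cast hρ1'))
  filter_upwards [h1, eventually_gt_atTop 0] with n hn hn0
  have hn0' : (0 : ℝ) < n := by exact_mod_cast hn0
  have h2 := ENNReal.rpow_le_rpow hn.le hn0'.le
  rw [← ENNReal.rpow_mul, one_div, inv_mul_cancel₀ hn0'.ne', ENNReal.rpow_one,
    ENNReal.rpow_natCast] at h2
  have h3 : ‖a ^ n‖₊ ≤ ρ ^ n := by exact_mod_cast h2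
  exact_mod_cast h3

attribute [local instance] Matrix.linftyOpNormedRing Matrix.linftyOpNormedAlgebra in
theorem Matrix.tendsto_pow_apply_of_forall_norm_lt_one {ι : Type*} [Fintype ι] [DecidableEq ι]
    [Nonempty ι] (M : Matrix ι ι ℂ) (h : ∀ (μ : ℂ) (v : ι → ℂ), v ≠ 0 → M.mulVec v = μ • v → ‖μ‖ < 1)
    (i j : ι) : Tendsto (fun n : ℕ => (M ^ n) i j) atTop (𝓝 0) := by
  have h1 : spectralRadius ℂ M < 1 := by
    refine spectrum.spectralRadius_lt_of_forall_lt M (r := 1) fun μ hμ => ?_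
    rw [Matrix.mem_spectrum_iff_isRoot_charpoly, Polynomial.IsRoot, Matrix.eval_charpoly] at hμ
    obtain ⟨v, hv, hv0⟩ := Matrix.exists_mulVec_eq_zero_iff.2 hμ
    rw [Matrix.sub_mulVec, sub_eq_zero, Matrix.scalar_apply, ← Matrix.smul_one_eq_diagonal,
      Matrix.smul_mulVec, Matrix.one_mulVec] at hv0
    exact_mod_cast h μ v hv hv0.symm
  have : CompleteSpace (Matrix ι ι ℂ) := FiniteDimensional.complete ℂ _
  refine squeeze_zero_norm (fun n => ?_) (tendsto_norm_pow_of_spectralRadius_lt_one h1)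
  have h2 : ‖(M ^ n) i j‖₊ ≤ ‖M ^ n‖₊ := by
    rw [Matrix.linfty_opNNNorm_def]
    exact (Finset.single_le_sum (f := fun j => ‖(M ^ n) i j‖₊) (fun _ _ => zero_le) (Finset.mem_univ j)).trans
      (Finset.le_sup (f := fun i => ∑ j, ‖(M ^ n) i j‖₊) (Finset.mem_univ i))
  exact_mod_cast h2

variable {V : Type*} [NormedAddCommGroup V] [NormedSpace ℝ V] [FiniteDimensional ℝ V]

open Polynomial in
/-- The spectral projection onto a simple real eigenvalue. -/
theorem exists_form_of_isDominantEigenvalue {T : V →L[ℝ] V} {r : ℝ}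
    (h : IsDominantEigenvalue T (r : ℂ)) {x : V} (hx : x ≠ 0) (hTx : T x = r • x) :
    ∃ f : StrongDual ℝ V, f x = 1 ∧ (∀ v, f (T v) = r * f v) ∧ ∀ v, T v = r • v → v = f v • x := by
  set A : Module.End ℝ V := (T : V →ₗ[ℝ] V) with hA
  have hAx : A x = r • x := hTx
  have hmult : A.charpoly.rootMultiplicity r = 1 := by
    have h1 := h.1
    rw [Polynomial.aroots_def, Polynomial.count_roots] at h1
    rw [Polynomial.eq_rootMultiplicity_map (f := algebraMap ℝ ℂ) (algebraMap ℝ ℂ).injective]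
    exact h1
  have hp0 : A.charpoly ≠ 0 := A.charpoly_monic.ne_zero
  obtain ⟨q, hq, hqd⟩ := Polynomial.exists_eq_pow_rootMultiplicity_mul_and_not_dvd A.charpoly hp0 r
  rw [hmult, pow_one] at hq
  have hqr : q.eval r ≠ 0 := fun h0 => hqd (Polynomial.dvd_iff_isRoot.2 h0)
  have hker : ∀ v, A v = r • v → ∃ c : ℝ, c • x = v := by
    have h1 := A.finrank_eigenspace_le r
    rw [hmult] at h1
    intro v hv
    have hx' : x ∈ A.eigenspace r := Module.End.mem_eigenspace_iff.2 hAx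
    have hv' : v ∈ A.eigenspace r := Module.End.mem_eigenspace_iff.2 hv
    obtain ⟨w, hw⟩ := finrank_le_one_iff.1 h1
    obtain ⟨a, ha⟩ := hw ⟨x, hx'⟩
    obtain ⟨b, hb⟩ := hw ⟨v, hv'⟩
    have ha' : a • (w : V) = x := congrArg Subtype.val ha
    have hb' : b • (w : V) = v := congrArg Subtype.val hb
    have ha0 : a ≠ 0 := by
      rintro rfl
      exact hx (by rw [← ha', zero_smul])
    exact ⟨b / a, by rw [← ha', smul_smul, div_mul_cancel₀ _ ha0, hb']⟩
  -- The characteristic polynomial is `(X - r) q` with `q r ≠ 0`. By Cayley–Hamilton `q(A)` maps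
  -- into the eigenline, and dividing by `q r` makes it the identity there.
  set R : Module.End ℝ V := (q.eval r)⁻¹ • aeval A q with hR
  have hRA : ∀ v, R (A v) = A (R v) := by
    intro v
    have h1 : aeval A q * A = A * aeval A q := by
      have := congrArg (aeval A) (mul_comm q X)
      simpa only [map_mul, aeval_X] using this
    have := congrArg (fun B : Module.End ℝ V => B v) h1
    simp only [Module.End.mul_apply] at this
    simp only [hR, LinearMap.smul_apply, map_smul, this]
  have hAR : ∀ v, A (R v) = r • R v := by
    intro v
    have h1 := congrArg (fun B : Module.End ℝ V => B v) A.aeval_self_charpoly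
    rw [hq] at h1
    simp only [map_mul, map_sub, aeval_X, aeval_C, Module.End.mul_apply, LinearMap.sub_apply,
      Module.algebraMap_end_apply, LinearMap.zero_apply, sub_eq_zero] at h1
    simp only [hR, LinearMap.smul_apply, map_smul, h1]
    rw [smul_comm]
  have hReig : ∀ v, A v = r • v → R v = v := by
    intro v hv
    have : aeval A q v = q.eval r • v := by
      rcases eq_or_ne v 0 with rfl | hv0
      · simp
      · exact Module.End.aeval_apply_of_hasEigenvector (Module.End.hasEigenvector_iff.2
          ⟨Module.End.mem_eigenspace_iff.2 hv, hv0⟩)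
    simp only [hR, LinearMap.smul_apply, this, smul_smul, inv_mul_cancel₀ hqr, one_smul]
  have hex : ∀ v, ∃ c : ℝ, c • x = R v := fun v => hker _ (hAR v)
  choose g hg using hex
  have hinj : ∀ {a b : ℝ}, a • x = b • x → a = b := fun e => smul_left_injective ℝ hx e
  let gl : V →ₗ[ℝ] ℝ :=
    { toFun := g
      map_add' := fun u v => hinj (by rw [add_smul, hg, hg, hg, map_add])
      map_smul' := fun c v => hinj (by
        rw [hg, map_smul, RingHom.id_apply, smul_eq_mul, mul_smul, hg]) }
  refine ⟨LinearMap.toContinuousLinearMap gl, hinj ?_, fun v => hinj ?_, fun v hv => ?_⟩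
  · change g x • x = (1 : ℝ) • x
    rw [hg, hReig x hAx, one_smul]
  · change g (A v) • x = (r * g v) • x
    rw [hg, mul_smul, hg, hRA, hAR]
  · change v = g v • x
    rw [hg, hReig v hv]

/-- Powers of an operator with a real dominant eigenvalue converge, after rescaling, to the
spectral projection. -/
theorem exists_isProx_of_isDominantEigenvalue {T : V →L[ℝ] V} {r : ℝ} (hr : r ≠ 0)
    (h : IsDominantEigenvalue T (r : ℂ)) {x : V} (hx : x ≠ 0) (hTx : T x = r • x) :
    ∃ f : StrongDual ℝ V, IsProx (r⁻¹ • T) x f := by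
  classical
  obtain ⟨f, hfx, hfT, hker⟩ := exists_form_of_isDominantEigenvalue h hx hTx
  refine ⟨f, isProx_of_tendsto_sub_pow hfx ?_ ?_ ?_⟩
  · rw [smul_apply, hTx, smul_smul, inv_mul_cancel₀ hr, one_smul]
  · intro v
    rw [smul_apply, map_smul, hfT, smul_eq_mul, inv_mul_cancel_left₀ hr]
  set N : V →L[ℝ] V := r⁻¹ • T - f.smulRight x with hN
  let b := Module.finBasis ℝ V
  have : Nontrivial V := ⟨x, 0, hx⟩
  have : Nonempty (Fin (Module.finrank ℝ V)) := ⟨⟨0, Module.finrank_pos⟩⟩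
  let tm := LinearMap.toMatrixAlgEquiv b
  have hentry : ∀ i j, Tendsto (fun k : ℕ => (tm (N : V →ₗ[ℝ] V) ^ k) i j) atTop (𝓝 0) := by
    intro i j
    -- Eigenvalues of the remainder must be examined over the complex numbers; an eigenvector is
    -- encoded by its real and imaginary parts `X` and `Y`.
    let M : Matrix _ _ ℂ := (tm (N : V →ₗ[ℝ] V)).map (algebraMap ℝ ℂ)
    have hM : ∀ (μ : ℂ) (v : Fin (Module.finrank ℝ V) → ℂ), v ≠ 0 → M.mulVec v = μ • v →
        ‖μ‖ < 1 := by
      intro μ v hv hMv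
      let X : V := ∑ j, (v j).re • b j
      let Y : V := ∑ j, (v j).im • b j
      have hreprX : ∀ i, b.repr X i = (v i).re := fun i => by
        have := b.equivFun_symm_apply (fun j => (v j).re)
        rw [show X = b.equivFun.symm (fun j => (v j).re) from this.symm, ← b.equivFun_apply,
          LinearEquiv.apply_symm_apply]
      have hreprY : ∀ i, b.repr Y i = (v i).im := fun i => by
        have := b.equivFun_symm_apply (fun j => (v j).im)
        rw [show Y = b.equivFun.symm (fun j => (v j).im) from this.symm, ← b.equivFun_apply,
          LinearEquiv.apply_symm_apply]
      have key : ∀ (L : V →ₗ[ℝ] V) i, ((tm L).map (algebraMap ℝ ℂ)).mulVec v i =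
          (b.repr (L X) i : ℂ) + (b.repr (L Y) i : ℂ) * Complex.I := by
        intro L i
        have hX : b.repr (L X) i = ∑ j, (v j).re * tm L i j := by
          simp [X, tm, LinearMap.toMatrixAlgEquiv_apply, Finsupp.finsetSum_apply]
        have hY : b.repr (L Y) i = ∑ j, (v j).im * tm L i j := by
          simp [Y, tm, LinearMap.toMatrixAlgEquiv_apply, Finsupp.finsetSum_apply]
        rw [hX, hY, Matrix.mulVec, dotProduct]
        apply Complex.ext
        · simp [mul_comm]
        · simp [mul_comm]
      have hN1 : N X = μ.re • X - μ.im • Y ∧ N Y = μ.im • X + μ.re • Y := by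
        have e : ∀ i, (b.repr (N X) i : ℂ) + (b.repr (N Y) i : ℂ) * Complex.I = μ * v i := fun i => by
          have h3 := congrFun hMv i
          rw [Pi.smul_apply, smul_eq_mul] at h3
          exact (key (N : V →ₗ[ℝ] V) i).symm.trans h3
        constructor
        · apply b.repr.injective
          ext i
          have := congrArg Complex.re (e i)
          simp at this
          simp [hreprX, hreprY, this]
        · apply b.repr.injective
          ext i
          have := congrArg Complex.im (e i)
          simp at this
          simp [hreprX, hreprY, this]
          ring
      -- For `μ ≠ 0` this puts `X` and `Y` in the kernel of `f`, where `N` is `r⁻¹ • T`; so `r * μ`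
      -- is an eigenvalue of `T`, different from `r` by simplicity, hence of smaller modulus.
      have hfN : ∀ u, f (N u) = 0 := by
        intro u
        simp only [hN, sub_apply, smul_apply, map_sub, map_smul, hfT,
          ContinuousLinearMap.smulRight_apply, hfx, smul_eq_mul, mul_one]
        rw [inv_mul_cancel_left₀ hr, sub_self]
      by_cases hμ0 : μ = 0
      · simp [hμ0]
      have h1 := hfN X
      have h2 := hfN Y
      rw [hN1.1, map_sub, map_smul, map_smul, smul_eq_mul, smul_eq_mul] at h1
      rw [hN1.2, map_add, map_smul, map_smul, smul_eq_mul, smul_eq_mul] at h2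
      have hns : μ.re * μ.re + μ.im * μ.im ≠ 0 := by
        rw [← Complex.normSq_apply]
        exact fun h0 => hμ0 (Complex.normSq_eq_zero.1 h0)
      have hfX : f X = 0 := by
        have : (μ.re * μ.re + μ.im * μ.im) * f X = 0 := by linear_combination μ.re * h1 + μ.im * h2
        exact (mul_eq_zero.1 this).resolve_left hns
      have hfY : f Y = 0 := by
        have : (μ.re * μ.re + μ.im * μ.im) * f Y = 0 := by linear_combination μ.re * h2 - μ.im * h1
        exact (mul_eq_zero.1 this).resolve_left hns
      have hTN : ∀ u, f u = 0 → T u = r • N u := fun u hu => by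
        rw [hN, sub_apply, ContinuousLinearMap.smulRight_apply, hu, zero_smul, sub_zero, smul_apply,
          smul_smul, mul_inv_cancel₀ hr, one_smul]
      have hTX := hTN X hfX
      have hTY := hTN Y hfY
      have hμ1 : μ ≠ 1 := by
        rintro rfl
        have hX0 : X = 0 := by
          rw [hker X (by rw [hTX, hN1.1]; simp), hfX, zero_smul]
        have hY0 : Y = 0 := by
          rw [hker Y (by rw [hTY, hN1.2]; simp), hfY, zero_smul]
        apply hv
        ext i
        apply Complex.ext
        · rw [← hreprX, hX0]; simp
        · rw [← hreprY, hY0]; simp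
      have hTv : ((tm (T : V →ₗ[ℝ] V)).map (algebraMap ℝ ℂ)).mulVec v = ((r : ℂ) * μ) • v := by
        ext i
        rw [key]
        simp only [ContinuousLinearMap.coe_coe, hTX, hTY, hN1.1, hN1.2]
        apply Complex.ext
        · simp [hreprX, hreprY]
          ring
        · simp [hreprX, hreprY]
          ring
      have hroot : (r : ℂ) * μ ∈ (T : V →ₗ[ℝ] V).charpoly.aroots ℂ := by
        rw [Polynomial.mem_aroots]
        refine ⟨(LinearMap.charpoly_monic _).ne_zero, ?_⟩
        rw [← LinearMap.charpoly_toMatrix (T : V →ₗ[ℝ] V) b, Polynomial.aeval_def,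
          ← Polynomial.eval_map, ← Matrix.charpoly_map, Matrix.eval_charpoly]
        refine Matrix.exists_mulVec_eq_zero_iff.1 ⟨v, hv, ?_⟩
        rw [Matrix.sub_mulVec, sub_eq_zero, Matrix.scalar_apply, ← Matrix.smul_one_eq_diagonal,
          Matrix.smul_mulVec, Matrix.one_mulVec]
        exact hTv.symm
      have hlt := h.2 _ hroot (fun e => hμ1 (by
        have : (r : ℂ) * (μ - 1) = 0 := by linear_combination e
        rcases mul_eq_zero.1 this with h3 | h3
        · exact absurd (by exact_mod_cast h3) hr
        · exact sub_eq_zero.1 h3))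
      rw [norm_mul] at hlt
      have hrpos : 0 < ‖(r : ℂ)‖ := by simpa using hr
      exact lt_of_mul_lt_mul_left (by simpa using hlt) hrpos.le
    have h1 := Matrix.tendsto_pow_apply_of_forall_norm_lt_one M hM i j
    have h2 := (Complex.continuous_re.tendsto _).comp h1
    refine h2.congr fun k => ?_
    have : M ^ k = (tm (N : V →ₗ[ℝ] V) ^ k).map (algebraMap ℝ ℂ) :=
      (map_pow (algebraMap ℝ ℂ).mapMatrix _ k).symm
    rw [Function.comp_apply, this]
    simp
  let Φ : Matrix (Fin (Module.finrank ℝ V)) (Fin (Module.finrank ℝ V)) ℝ →ₗ[ℝ] (V →L[ℝ] V) :=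
    LinearMap.toContinuousLinearMap.toLinearMap ∘ₗ tm.symm.toLinearMap
  have hΦ : ∀ k : ℕ, Φ (tm (N : V →ₗ[ℝ] V) ^ k) = N ^ k := by
    intro k
    ext v
    simp only [Φ, LinearMap.comp_apply, AlgEquiv.toLinearMap_apply, LinearEquiv.coe_coe, ← map_pow,
      AlgEquiv.symm_apply_apply, LinearMap.coe_toContinuousLinearMap']
    induction k generalizing v with
    | zero => rfl
    | succ k ih => rw [pow_succ, pow_succ, Module.End.mul_apply, ih]; rfl
  have hc := Φ.continuous_of_finiteDimensional
  have h1 : Tendsto (fun k : ℕ => tm (N : V →ₗ[ℝ] V) ^ k) atTop (𝓝 0) :=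
    tendsto_pi_nhds.2 fun i => tendsto_pi_nhds.2 fun j => hentry i j
  have h2 := (hc.tendsto _).comp h1
  rw [map_zero] at h2
  exact h2.congr hΦ

end Dominant

/-! ### Topology of the projective space through its cone -/

section Topology

open Filter Set

variable {V : Type*} [NormedAddCommGroup V] [NormedSpace ℝ V]

/-- The projection `V \ {0} → P(V)`. -/
noncomputable def toProj (v : {v : V // v ≠ 0}) : ℙ ℝ V := Projectivization.mk ℝ v.1 v.2

theorem continuous_toProj : Continuous (toProj (V := V)) := continuous_quotient_mk'

theorem isQuotientMap_toProj : Topology.IsQuotientMap (toProj (V := V)) := isQuotientMap_quotient_mk'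

theorem isOpenMap_toProj : IsOpenMap (toProj (V := V)) := by
  intro U hU
  rw [← isQuotientMap_toProj.isOpen_preimage]
  have : toProj ⁻¹' (toProj '' U) =
      ⋃ a : ℝˣ, (fun v : {v : V // v ≠ 0} => (⟨(a : ℝ) • v.1, smul_ne_zero a.ne_zero v.2⟩ :
        {v : V // v ≠ 0})) ⁻¹' U := by
    ext v
    simp only [mem_preimage, mem_image, mem_iUnion]
    constructor
    · rintro ⟨w, hw, e⟩
      obtain ⟨a, ha⟩ := (Projectivization.mk_eq_mk_iff ℝ _ _ w.2 v.2).1 e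
      exact ⟨a, by convert hw using 1; exact Subtype.ext ha⟩
    · rintro ⟨a, ha⟩
      exact ⟨_, ha, (Projectivization.mk_eq_mk_iff ℝ _ _ _ v.2).2 ⟨a, rfl⟩⟩
  rw [this]
  refine isOpen_iUnion fun a => hU.preimage ?_
  exact Continuous.subtype_mk (by fun_prop) _

theorem tendsto_mk {α : Type*} {l : Filter α} {v : α → V} {v₀ : V} (h : Tendsto v l (𝓝 v₀))
    (hv : ∀ a, v a ≠ 0) (hv₀ : v₀ ≠ 0) :
    Tendsto (fun a => Projectivization.mk ℝ (v a) (hv a)) l (𝓝 (Projectivization.mk ℝ v₀ hv₀)) :=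
  (continuous_toProj.tendsto ⟨v₀, hv₀⟩).comp
    ((tendsto_subtype_rng (f := fun a => (⟨v a, hv a⟩ : {v : V // v ≠ 0}))).2 h)

theorem GLin.apply_ne_zero (u : GLin V) {v : V} (hv : v ≠ 0) : u.1 v ≠ 0 := fun h => hv (by
  rw [← inv_apply_val_apply u v, h, map_zero])

theorem continuous_pgl_smul (g : PGL V) : Continuous fun x : ℙ ℝ V => g • x := by
  induction g using QuotientGroup.induction_on with
  | H u =>
    rw [isQuotientMap_toProj.continuous_iff]
    have : (fun x : ℙ ℝ V => (u : PGL V) • x) ∘ toProj =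
        toProj ∘ fun v : {v : V // v ≠ 0} => (⟨u.1 v.1, GLin.apply_ne_zero u v.2⟩ :
          {v : V // v ≠ 0}) := by
      ext v
      rfl
    rw [this]
    exact continuous_toProj.comp (Continuous.subtype_mk (by fun_prop) _)

theorem isOpen_image_mk {U : Set V} (hU : IsOpen U) :
    IsOpen {x : ℙ ℝ V | ∃ w ∈ U, ∃ hw : w ≠ 0, x = Projectivization.mk ℝ w hw} := by
  have : {x : ℙ ℝ V | ∃ w ∈ U, ∃ hw : w ≠ 0, x = Projectivization.mk ℝ w hw} =
      toProj '' (Subtype.val ⁻¹' U) := by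
    ext x
    constructor
    · rintro ⟨w, hw, hw0, rfl⟩
      exact ⟨⟨w, hw0⟩, hw, rfl⟩
    · rintro ⟨w, hw, rfl⟩
      exact ⟨w.1, hw, w.2, rfl⟩
  rw [this]
  exact isOpenMap_toProj _ (hU.preimage continuous_subtype_val)

theorem isOpen_cone {Ω : Set (ℙ ℝ V)} (hΩ : IsOpen Ω) : IsOpen (cone Ω) := by
  have : cone Ω = Subtype.val '' (toProj ⁻¹' Ω) := by
    ext v
    constructor
    · rintro ⟨hv, h⟩
      exact ⟨⟨v, hv⟩, h, rfl⟩
    · rintro ⟨w, hw, rfl⟩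
      exact ⟨w.2, hw⟩
  rw [this]
  exact (isClosed_singleton (x := (0 : V))).isOpen_compl.isOpenMap_subtype_val _
    (hΩ.preimage continuous_toProj)

theorem isOpen_of_isOpen_cone {Ω : Set (ℙ ℝ V)} (h : IsOpen (cone Ω)) : IsOpen Ω := by
  rw [← isQuotientMap_toProj.isOpen_preimage]
  have : toProj ⁻¹' Ω = Subtype.val ⁻¹' (cone Ω) := by
    ext v
    exact ⟨fun hv => ⟨v.2, hv⟩, fun ⟨_, hv⟩ => hv⟩
  rw [this]
  exact h.preimage continuous_subtype_val

/-- Open continuous maps commute with taking closures of preimages; this is used for the projection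
and for the inclusion of the nonzero vectors. -/
theorem mem_cone_closure_iff {Ω : Set (ℙ ℝ V)} {v : V} (hv : v ≠ 0) :
    Projectivization.mk ℝ v hv ∈ closure Ω ↔ v ∈ closure (cone Ω) := by
  have h1 : Projectivization.mk ℝ v hv ∈ closure Ω ↔
      (⟨v, hv⟩ : {v : V // v ≠ 0}) ∈ closure (toProj ⁻¹' Ω) := by
    rw [← isOpenMap_toProj.preimage_closure_eq_closure_preimage continuous_toProj]
    rfl
  have h2 : toProj ⁻¹' Ω = (Subtype.val : {v : V // v ≠ 0} → V) ⁻¹' (cone Ω) := by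
    ext w
    exact ⟨fun hw => ⟨w.2, hw⟩, fun ⟨_, hw⟩ => hw⟩
  have h3 : IsOpenMap (Subtype.val : {v : V // v ≠ 0} → V) :=
    (isClosed_singleton (x := (0 : V))).isOpen_compl.isOpenMap_subtype_val
  rw [h1, h2, ← h3.preimage_closure_eq_closure_preimage continuous_subtype_val]
  rfl

end Topology

/-! ### The cone over a properly convex set -/

section ConeOver

open Filter Set

variable {V : Type*} [NormedAddCommGroup V] [NormedSpace ℝ V]

/-- `C` is one of the two halves of the cone over `Ω`. -/
structure IsConeOver (C : Set V) (Ω : Set (ℙ ℝ V)) : Prop where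
  sharp : IsSharpCone C
  mem_cone : ∀ v, v ∈ cone Ω ↔ v ∈ C ∨ -v ∈ C

/-- If `φ` took both signs at `u` and `v`, a positive combination of them would be a zero of `φ` in
`C`. -/
theorem IsSharpCone.sign_of_ne_zero {C : Set V} (hC : IsSharpCone C) {φ : StrongDual ℝ V}
    (h : ∀ v ∈ C, φ v ≠ 0) : (∀ v ∈ C, 0 < φ v) ∨ ∀ v ∈ C, φ v < 0 := by
  by_contra! hcon
  obtain ⟨⟨u, hu, hu'⟩, v, hv, hv'⟩ := hcon
  have h1 := lt_of_le_of_ne hu' (h u hu)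
  have h2 := lt_of_le_of_ne hv' (h v hv).symm
  refine h _ (hC.add_mem _ (hC.smul_mem (φ v) h2 u hu) _ (hC.smul_mem (-φ u) (by linarith) v hv)) ?_
  simp
  ring

theorem IsSharpCone.sign_of_ne_zero_closure {C : Set V} (hC : IsSharpCone C) {φ : StrongDual ℝ V}
    (h : ∀ v ∈ closure C, v ≠ 0 → φ v ≠ 0) : PosOn C φ ∨ PosOn C (-φ) := by
  by_contra! hcon
  simp only [PosOn] at hcon
  push Not at hcon
  obtain ⟨⟨u, hu, hu0, hu'⟩, v, hv, hv0, hv'⟩ := hcon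
  have h1 := lt_of_le_of_ne hu' (h u hu hu0)
  rw [neg_apply, neg_nonpos] at hv'
  have h2 := lt_of_le_of_ne hv' (h v hv hv0).symm
  have hmem := hC.add_mem_closure (hC.smul_mem_closure h2.le hu)
    (hC.smul_mem_closure (t := -φ u) (by linarith) hv)
  by_cases h0 : φ v • u + -φ u • v = 0
  · have h3 : -u ∈ closure C := by
      have h4 : -u = ((φ v)⁻¹ * -φ u) • v := by
        rw [mul_smul, ← neg_eq_of_add_eq_zero_right h0, smul_neg, smul_smul,
          inv_mul_cancel₀ h2.ne', one_smul]
      rw [h4]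
      exact hC.smul_mem_closure (mul_nonneg (inv_nonneg.2 h2.le) (by linarith)) hv
    exact hu0 (hC.eq_zero_of_neg_mem hu h3)
  · refine h _ hmem h0 ?_
    simp
    ring

theorem smul_mem_cone {Ω : Set (ℙ ℝ V)} {v : V} (hv : v ∈ cone Ω) {t : ℝ} (ht : t ≠ 0) :
    t • v ∈ cone Ω := by
  obtain ⟨h0, h⟩ := hv
  refine ⟨smul_ne_zero ht h0, ?_⟩
  convert h using 1
  exact (Projectivization.mk_eq_mk_iff' ℝ _ _ _ _).2 ⟨t, rfl⟩

theorem IsProperlyConvex.exists_isConeOver {Ω : Set (ℙ ℝ V)} (h : IsProperlyConvex Ω)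
    (hΩ : IsOpen Ω) (hne : Ω.Nonempty) : ∃ C : Set V, IsConeOver C Ω := by
  obtain ⟨φ, hav, hconv, hbdd⟩ := h
  have hnorm : ∀ v ∈ cone Ω, 0 < φ v → (φ v)⁻¹ • v ∈ chart φ Ω := fun v hv hpos =>
    ⟨by rw [map_smul, smul_eq_mul, inv_mul_cancel₀ hpos.ne'],
      smul_mem_cone hv (inv_ne_zero hpos.ne')⟩
  have hmem : ∀ v, v ∈ cone Ω ↔ v ∈ {v | 0 < φ v ∧ v ∈ cone Ω} ∨ -v ∈ {v | 0 < φ v ∧ v ∈ cone Ω} := by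
    intro v
    have hneg : ∀ w, w ∈ cone Ω → -w ∈ cone Ω := fun w hw => by
      simpa using smul_mem_cone hw (t := -1) (by norm_num)
    constructor
    · intro hv
      rcases (hav v hv).lt_or_gt with h1 | h1
      · exact Or.inr ⟨by simpa using h1, hneg v hv⟩
      · exact Or.inl ⟨h1, hv⟩
    · rintro (hv | hv)
      · exact hv.2
      · simpa using hneg _ hv.2
  refine ⟨{v | 0 < φ v ∧ v ∈ cone Ω}, ⟨?_, ?_, ?_, ?_, ?_, ?_⟩, hmem⟩
  · exact (isOpen_lt continuous_const φ.continuous).inter (isOpen_cone hΩ)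
  · rintro u ⟨hu, huc⟩ v ⟨hv, hvc⟩
    have huv : 0 < φ u + φ v := by linarith
    refine ⟨by rw [map_add]; exact huv, ?_⟩
    have h1 := hconv (hnorm u huc hu) (hnorm v hvc hv) (a := φ u / (φ u + φ v))
      (b := φ v / (φ u + φ v)) (by positivity) (by positivity) (by field_simp)
    have h2 := smul_mem_cone h1.2 huv.ne'
    convert h2 using 1
    rw [smul_smul, smul_smul, smul_add, smul_smul, smul_smul]
    congr 1
    · rw [show (φ u + φ v) * (φ u / (φ u + φ v) * (φ u)⁻¹) = 1 by field_simp, one_smul]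
    · rw [show (φ u + φ v) * (φ v / (φ u + φ v) * (φ v)⁻¹) = 1 by field_simp, one_smul]
  · rintro t ht v ⟨hv, hvc⟩
    exact ⟨by rw [map_smul, smul_eq_mul]; exact mul_pos ht hv, smul_mem_cone hvc ht.ne'⟩
  · obtain ⟨x, hx⟩ := hne
    have hxc : x.rep ∈ cone Ω := ⟨x.rep_nonzero, by rwa [x.mk_rep]⟩
    rcases (hmem _).1 hxc with h1 | h1
    · exact ⟨_, h1⟩
    · exact ⟨_, h1⟩
  · obtain ⟨R, hR⟩ := hbdd.exists_norm_le
    refine ⟨φ, (|R| + 1)⁻¹, by positivity, ?_⟩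
    rintro v ⟨hv, hvc⟩
    have h1 := hR _ (hnorm v hvc hv)
    rw [norm_smul, norm_inv, Real.norm_of_nonneg hv.le, inv_mul_le_iff₀ hv] at h1
    rw [inv_mul_le_iff₀ (by positivity)]
    nlinarith [le_abs_self R]
  · rintro ⟨h0, -⟩
    simp at h0

namespace IsConeOver

variable {C : Set V} {Ω : Set (ℙ ℝ V)} (h : IsConeOver C Ω)
include h

theorem mk_mem_iff {v : V} (hv : v ≠ 0) : Projectivization.mk ℝ v hv ∈ Ω ↔ v ∈ C ∨ -v ∈ C := by
  rw [← h.mem_cone]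
  exact ⟨fun hx => ⟨hv, hx⟩, fun ⟨_, hx⟩ => hx⟩

theorem ne_zero {v : V} (hv : v ∈ C) : v ≠ 0 := fun h0 => h.sharp.zero_notMem (h0 ▸ hv)

theorem mk_mem {v : V} (hv : v ∈ C) : Projectivization.mk ℝ v (h.ne_zero hv) ∈ Ω :=
  (h.mk_mem_iff _).2 (Or.inl hv)

theorem exists_mk_eq {x : ℙ ℝ V} (hx : x ∈ Ω) :
    ∃ v, ∃ hv : v ∈ C, x = Projectivization.mk ℝ v (h.ne_zero hv) := by
  have h1 := (h.mk_mem_iff x.rep_nonzero).1 (by rwa [x.mk_rep])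
  rcases h1 with h1 | h1
  · exact ⟨_, h1, x.mk_rep.symm⟩
  · refine ⟨_, h1, ?_⟩
    conv_lhs => rw [← x.mk_rep]
    exact (Projectivization.mk_eq_mk_iff' ℝ _ _ _ _).2 ⟨-1, by simp⟩

theorem isOpen : IsOpen Ω := by
  apply isOpen_of_isOpen_cone
  have : cone Ω = C ∪ -C := by
    ext v
    rw [h.mem_cone]
    simp
  rw [this]
  exact h.sharp.isOpen.union h.sharp.isOpen.neg

theorem mk_mem_closure_iff {v : V} (hv : v ≠ 0) :
    Projectivization.mk ℝ v hv ∈ closure Ω ↔ v ∈ closure C ∨ -v ∈ closure C := by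
  have : cone Ω = C ∪ -C := by
    ext v
    rw [h.mem_cone]
    simp
  have hneg : closure (-C) = -closure C := ((Homeomorph.neg V).preimage_closure C).symm
  rw [mem_cone_closure_iff, this, closure_union, hneg]
  rfl

theorem exists_mk_eq_closure {x : ℙ ℝ V} (hx : x ∈ closure Ω) :
    ∃ v, ∃ hv : v ≠ 0, v ∈ closure C ∧ x = Projectivization.mk ℝ v hv := by
  have h1 := (h.mk_mem_closure_iff x.rep_nonzero).1 (by rwa [x.mk_rep])
  rcases h1 with h1 | h1
  · exact ⟨_, _, h1, x.mk_rep.symm⟩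
  · refine ⟨_, neg_ne_zero.2 x.rep_nonzero, h1, ?_⟩
    conv_lhs => rw [← x.mk_rep]
    exact (Projectivization.mk_eq_mk_iff' ℝ _ _ _ _).2 ⟨-1, by simp⟩

theorem notMem_of_neg_mem {v : V} (hv : v ∈ closure C) (hv' : -v ∈ C) : False :=
  h.sharp.zero_notMem (by simpa using h.sharp.add_closure_mem hv' hv)

theorem mk_mem_frontier_iff {v : V} (hv : v ≠ 0) (hvC : v ∈ closure C) :
    Projectivization.mk ℝ v hv ∈ frontier Ω ↔ v ∉ C := by
  rw [h.isOpen.frontier_eq, Set.mem_sdiff, h.mk_mem_closure_iff, h.mk_mem_iff]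
  constructor
  · rintro ⟨-, h1⟩ h2
    exact h1 (Or.inl h2)
  · refine fun h1 => ⟨Or.inl hvC, ?_⟩
    rintro (h2 | h2)
    · exact h1 h2
    · exact h.notMem_of_neg_mem hvC h2

theorem posOn_of_avoids {φ : StrongDual ℝ V} (hφ : Avoids φ (closure Ω)) :
    PosOn C φ ∨ PosOn C (-φ) :=
  h.sharp.sign_of_ne_zero_closure fun v hv hv0 =>
    hφ v ⟨hv0, (h.mk_mem_closure_iff hv0).2 (Or.inl hv)⟩

end IsConeOver

/-- The group of linear lifts of elements of `Γ` that preserve the cone `C`. -/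
def liftGroup (C : Set V) (Γ : Subgroup (PGL V)) : Subgroup (GLin V) where
  carrier := {u | (u : PGL V) ∈ Γ ∧ ∀ v, u.1 v ∈ C ↔ v ∈ C}
  one_mem' := ⟨Γ.one_mem, fun v => Iff.rfl⟩
  mul_mem' := by
    rintro a b ⟨ha, ha'⟩ ⟨hb, hb'⟩
    exact ⟨Γ.mul_mem ha hb, fun v => by rw [val_mul_apply, ha', hb']⟩
  inv_mem' := by
    rintro a ⟨ha, ha'⟩
    exact ⟨Γ.inv_mem ha, fun v => by rw [← ha', val_apply_inv_apply]⟩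

/-- Sequential form of discreteness for a subgroup of `PGL(V)`. -/
def SeqDiscrete (Γ : Subgroup (PGL V)) : Prop :=
  ∀ u : ℕ → GLin V, (∀ n, (u n : PGL V) ∈ Γ) → ∀ T T' : V →L[ℝ] V,
    Tendsto (fun n => (u n).1) atTop (𝓝 T) → Tendsto (fun n => (u n)⁻¹.1) atTop (𝓝 T') →
    ∀ᶠ n in atTop, ∃ κ : ℝ, (u (n + 1)).1 = κ • (u n).1

theorem mk_eq_mk_of_smul {u w : GLin V} {κ : ℝ} (hκ : κ ≠ 0) (h : w.1 = κ • u.1) :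
    (w : PGL V) = (u : PGL V) := by
  symm
  rw [QuotientGroup.eq]
  refine mem_scalars.2 ⟨Units.mk0 κ hκ, fun v => ?_⟩
  rw [val_mul_apply, h, smul_apply, map_smul, inv_apply_val_apply]
  rfl

theorem exists_smul_of_mk_eq_mk {u w : GLin V} (h : (w : PGL V) = (u : PGL V)) :
    ∃ κ : ℝ, κ ≠ 0 ∧ w.1 = κ • u.1 := by
  obtain ⟨c, hc⟩ := mem_scalars.1 (QuotientGroup.eq.1 h.symm)
  refine ⟨c, c.ne_zero, ?_⟩
  ext v
  have := congrArg u.1 (hc v)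
  rwa [val_mul_apply, val_apply_inv_apply, map_smul] at this

/-- Convergence of the inverses makes the limit invertible, so quotients of consecutive terms tend
to 1 in `PGL V` and are eventually trivial. -/
theorem seqDiscrete_of_discreteTopology (Γ : Subgroup (PGL V)) (hΓ : DiscreteTopology Γ) :
    SeqDiscrete Γ := by
  intro u hu T T' hT hT'
  have h1 : T * T' = 1 := by
    refine tendsto_nhds_unique (hT.mul hT') ?_
    simp
  have h2 : T' * T = 1 := by
    refine tendsto_nhds_unique (hT'.mul hT) ?_
    simp
  let U : GLin V := ⟨T, T', h1, h2⟩
  have hU : Tendsto u atTop (𝓝 U) := by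
    rw [Units.isInducing_embedProduct.tendsto_nhds_iff]
    exact hT.prodMk_nhds ((MulOpposite.continuous_op.tendsto _).comp hT')
  have hw : Tendsto (fun n => (((u n)⁻¹ * u (n + 1) : GLin V) : PGL V)) atTop (𝓝 1) := by
    have h3 := hU.inv.mul (hU.comp (tendsto_add_atTop_nat 1))
    rw [inv_mul_cancel] at h3
    exact (QuotientGroup.continuous_mk.tendsto 1).comp h3
  obtain ⟨O, hO, hO'⟩ := isOpen_induced_iff.1 (isOpen_discrete ({1} : Set Γ))
  have h1O : (1 : PGL V) ∈ O := by
    have : (1 : Γ) ∈ Subtype.val ⁻¹' O := by rw [hO']; rfl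
    exact this
  filter_upwards [hw (hO.mem_nhds h1O)] with n hn
  have hmem : (((u n)⁻¹ * u (n + 1) : GLin V) : PGL V) ∈ Γ :=
    Γ.mul_mem (Γ.inv_mem (hu n)) (hu (n + 1))
  have h3 : (⟨_, hmem⟩ : Γ) ∈ Subtype.val ⁻¹' O := hn
  rw [hO'] at h3
  have h4 : (((u n)⁻¹ * u (n + 1) : GLin V) : PGL V) = 1 := congrArg Subtype.val h3
  have h5 : (u (n + 1) : PGL V) = u n := (inv_mul_eq_one.1 h4).symm
  obtain ⟨κ, -, hκ⟩ := exists_smul_of_mk_eq_mk h5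
  exact ⟨κ, hκ⟩

end ConeOver

/-! ### Lifting a convex cocompact action to the cone -/

section Lifts

open Filter Set

variable {V : Type*} [NormedAddCommGroup V] [NormedSpace ℝ V]

theorem smul_mem_iff_of_mem_aut {Ω : Set (ℙ ℝ V)} {g : PGL V} (hg : g ∈ Aut Ω) (x : ℙ ℝ V) :
    g • x ∈ Ω ↔ x ∈ Ω := by
  have h : g • Ω = Ω := hg
  conv_lhs => rw [← h]
  exact Set.smul_mem_smul_set_iff

theorem apply_mem_cone_iff {Ω : Set (ℙ ℝ V)} {u : GLin V} (hu : (u : PGL V) ∈ Aut Ω) (v : V) :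
    u.1 v ∈ cone Ω ↔ v ∈ cone Ω := by
  constructor
  · rintro ⟨h0, h⟩
    have hv : v ≠ 0 := fun h1 => h0 (by rw [h1, map_zero])
    exact ⟨hv, (smul_mem_iff_of_mem_aut hu _).1 h⟩
  · rintro ⟨h0, h⟩
    exact ⟨GLin.apply_ne_zero u h0, (smul_mem_iff_of_mem_aut hu _).2 h⟩

theorem mk_neg (u : GLin V) : ((-u : GLin V) : PGL V) = u :=
  mk_eq_mk_of_smul (κ := -1) (by norm_num) (by simp)

/-- The homothety of ratio `t`. -/
noncomputable def homothety (t : ℝ) (ht : t ≠ 0) : GLin V :=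
  Units.map (algebraMap ℝ (V →L[ℝ] V)).toMonoidHom (Units.mk0 t ht)

theorem homothety_apply (t : ℝ) (ht : t ≠ 0) (v : V) : (homothety t ht).1 v = t • v := by
  simp [homothety, Algebra.algebraMap_eq_smul_one]

namespace IsConeOver

variable {C : Set V} {Ω : Set (ℙ ℝ V)} (h : IsConeOver C Ω)
include h

theorem smul_mem_iff {t : ℝ} (ht : 0 < t) (v : V) : t • v ∈ C ↔ v ∈ C := by
  refine ⟨fun hv => ?_, h.sharp.smul_mem t ht v⟩
  have := h.sharp.smul_mem t⁻¹ (inv_pos.2 ht) _ hv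
  rwa [smul_smul, inv_mul_cancel₀ ht.ne', one_smul] at this

theorem mem_liftGroup_of_forall {Γ : Subgroup (PGL V)} (hΓ : Γ ≤ Aut Ω) {u : GLin V}
    (hu : (u : PGL V) ∈ Γ) (hC : ∀ v ∈ C, u.1 v ∈ C) : u ∈ liftGroup C Γ := by
  refine ⟨hu, fun v => ⟨fun hv => ?_, hC v⟩⟩
  rcases (h.mem_cone v).1 ((apply_mem_cone_iff (hΓ hu) v).1 ((h.mem_cone _).2 (Or.inl hv)))
    with h1 | h1
  · exact h1
  · have h2 := hC _ h1
    rw [map_neg] at h2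
    exact (h.notMem_of_neg_mem (subset_closure hv) h2).elim

/-- A lift sends each vector of `C` to `C` or `-C`. The choice is uniform, since a positive form
composed with `u` does not vanish on `C` and thus has constant sign. -/
theorem mem_liftGroup_or_neg_mem {Γ : Subgroup (PGL V)} (hΓ : Γ ≤ Aut Ω) {u : GLin V}
    (hu : (u : PGL V) ∈ Γ) : u ∈ liftGroup C Γ ∨ -u ∈ liftGroup C Γ := by
  obtain ⟨φ, ε, hε, hφ⟩ := h.sharp.exists_coercive
  have hpos : ∀ v ∈ C, 0 < φ v := fun v hv =>
    (mul_pos hε (norm_pos_iff.2 (h.ne_zero hv))).trans_le (hφ v hv)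
  have hpm : ∀ v ∈ C, u.1 v ∈ C ∨ -u.1 v ∈ C := fun v hv =>
    (h.mem_cone _).1 ((apply_mem_cone_iff (hΓ hu) v).2 ((h.mem_cone v).2 (Or.inl hv)))
  have hne : ∀ v ∈ C, (φ.comp u.1) v ≠ 0 := by
    intro v hv
    rcases hpm v hv with h1 | h1
    · exact (hpos _ h1).ne'
    · have := hpos _ h1
      rw [map_neg] at this
      exact (neg_pos.1 this).ne
  rcases h.sharp.sign_of_ne_zero hne with h1 | h1
  · refine Or.inl (h.mem_liftGroup_of_forall hΓ hu fun v hv => (hpm v hv).resolve_right fun h2 => ?_)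
    have h3 := hpos _ h2
    have h4 : 0 < φ (u.1 v) := h1 v hv
    rw [map_neg] at h3
    linarith
  · refine Or.inr (h.mem_liftGroup_of_forall hΓ (by rwa [mk_neg]) fun v hv => ?_)
    refine (hpm v hv).resolve_left fun h2 => ?_
    have h3 := hpos _ h2
    have h4 : φ (u.1 v) < 0 := h1 v hv
    linarith

theorem exists_mem_liftGroup {Γ : Subgroup (PGL V)} (hΓ : Γ ≤ Aut Ω) {γ : PGL V} (hγ : γ ∈ Γ) :
    ∃ u ∈ liftGroup C Γ, (u : PGL V) = γ := by
  induction γ using QuotientGroup.induction_on with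
  | H u =>
    rcases h.mem_liftGroup_or_neg_mem hΓ hγ with h1 | h1
    · exact ⟨u, h1, rfl⟩
    · exact ⟨-u, h1, mk_neg u⟩

theorem homothety_mem_liftGroup (Γ : Subgroup (PGL V)) {t : ℝ} (ht : 0 < t) :
    homothety t ht.ne' ∈ liftGroup C Γ := by
  refine ⟨?_, fun v => by rw [homothety_apply, h.smul_mem_iff ht]⟩
  have : ((homothety t ht.ne' : GLin V) : PGL V) = ((1 : GLin V) : PGL V) := by
    refine mk_eq_mk_of_smul ht.ne' ?_
    ext v
    rw [homothety_apply]
    rfl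
  rw [this]
  exact Γ.one_mem

theorem mk_mem_orbLimitSet {Γ : Subgroup (PGL V)} {y : V}
    (hy : IsLimitVector C (liftGroup C Γ) y) :
    Projectivization.mk ℝ y hy.1 ∈ orbLimitSet Γ Ω := by
  obtain ⟨hy0, hyC, x, hx, u, hu, hlim⟩ := hy
  have hycl : y ∈ closure C :=
    mem_closure_of_tendsto hlim (Eventually.of_forall fun n => ((hu n).2 x).2 hx)
  refine ⟨_, h.mk_mem hx, ?_⟩
  rw [accPt_iff_frequently]
  refine (tendsto_mk hlim (fun n => h.ne_zero (((hu n).2 x).2 hx)) hy0).frequently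
    (Eventually.frequently (Eventually.of_forall fun n => ⟨fun e => ?_, _, (hu n).1, rfl⟩))
  have h1 := ((h.mk_mem_frontier_iff hy0 hycl).2 hyC).2
  rw [h.isOpen.interior_eq, ← e] at h1
  exact h1 (h.mk_mem (((hu n).2 x).2 hx))

/-- In the affine chart, the class of `y + v` lies on the segment from a limit point to a point of
the hull. -/
theorem add_mem_cone_core {Γ : Subgroup (PGL V)} {y v : V}
    (hy : IsLimitVector C (liftGroup C Γ) y) (hyC : y ∈ closure C) (hv : v ∈ C)
    (hvc : v ∈ cone (core Γ Ω)) : y + v ∈ cone (core Γ Ω) := by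
  have hyv : y + v ∈ C := by
    rw [add_comm]
    exact h.sharp.add_closure_mem hv hyC
  obtain ⟨hv0, -, φ, hφ, w, hw, hw0, e⟩ := hvc
  refine ⟨h.ne_zero hyv, h.mk_mem hyv, φ, hφ, ?_⟩
  have hφw : φ w = 1 := by
    have h1 : Convex ℝ {v : V | φ v = 1} := convex_hyperplane φ.isLinear 1
    exact convexHull_min (fun v hv => hv.1) h1 hw
  obtain ⟨a, ha⟩ := (Projectivization.mk_eq_mk_iff' ℝ _ _ hv0 hw0).1 e
  have hφv : φ v = a := by rw [← ha, map_smul, hφw, smul_eq_mul, mul_one]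
  have hφy : φ y ≠ 0 := hφ y ⟨hy.1, (h.mk_mem_closure_iff hy.1).2 (Or.inl hyC)⟩
  have hyL : (φ y)⁻¹ • y ∈ chart φ (orbLimitSet Γ Ω) :=
    ⟨by rw [map_smul, smul_eq_mul, inv_mul_cancel₀ hφy],
      smul_mem_cone ⟨hy.1, h.mk_mem_orbLimitSet hy⟩ (inv_ne_zero hφy)⟩
  -- The chart form may be negative on `C`, but `φ y` and `a = φ v` always have the same sign, so
  -- the weights are nonnegative.
  have hsum : φ y + a ≠ 0 ∧ 0 ≤ φ y / (φ y + a) ∧ 0 ≤ a / (φ y + a) := by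
    rcases h.posOn_of_avoids hφ with h1 | h1
    · have h2 := h1 y hyC hy.1
      have h3 := h1 v (subset_closure hv) hv0
      rw [hφv] at h3
      exact ⟨by positivity, by positivity, by positivity⟩
    · have h2 := h1 y hyC hy.1
      have h3 := h1 v (subset_closure hv) hv0
      rw [neg_apply, neg_pos] at h2 h3
      rw [hφv] at h3
      exact ⟨by linarith, div_nonneg_of_nonpos h2.le (by linarith),
        div_nonneg_of_nonpos h3.le (by linarith)⟩
  obtain ⟨hs0, hs1, hs2⟩ := hsum
  have hmem := convex_convexHull ℝ (chart φ (orbLimitSet Γ Ω)) (subset_convexHull ℝ _ hyL) hw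
    hs1 hs2 (by field_simp)
  have e2 : (φ y / (φ y + a)) • (φ y)⁻¹ • y + (a / (φ y + a)) • w = (φ y + a)⁻¹ • (y + v) := by
    rw [← ha, smul_add, smul_smul, smul_smul]
    congr 2
    · field_simp
    · field_simp
  rw [e2] at hmem
  exact ⟨_, hmem, smul_ne_zero (inv_ne_zero hs0) (h.ne_zero hyv),
    ((Projectivization.mk_eq_mk_iff' ℝ _ _ _ _).2 ⟨_, rfl⟩).symm⟩

/-- The saturations of the images of small balls in `C` cover the compact quotient. The closed balls
of a finite subcover form `K`, and positive homotheties adjust the lifts. -/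
theorem exists_isCompact_of_compactSpace [FiniteDimensional ℝ V] {Γ : Subgroup (PGL V)}
    (hΓ : Γ ≤ Aut Ω) {S : Set (ℙ ℝ V)} (hS : S ⊆ Ω) (hc : CompactSpace (QuotientBy Γ S)) :
    ∃ K ⊆ C, IsCompact K ∧ ∀ v ∈ C, v ∈ cone S → ∃ g ∈ liftGroup C Γ, g.1 v ∈ K := by
  choose! p hpC hp using fun y (hy : y ∈ S) => h.exists_mk_eq (hS hy)
  have hball : ∀ y ∈ S, ∃ r > 0, Metric.closedBall (p y) r ⊆ C := fun y hy =>
    Metric.nhds_basis_closedBall.mem_iff.1 (h.sharp.isOpen.mem_nhds (hpC y hy))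
  choose! r hr hrC using hball
  let O : ℙ ℝ V → Set (ℙ ℝ V) := fun y =>
    {x | ∃ w ∈ Metric.ball (p y) (r y), ∃ hw : w ≠ 0, x = Projectivization.mk ℝ w hw}
  have hO : ∀ y, IsOpen (O y) := fun y => isOpen_image_mk Metric.isOpen_ball
  let P : ℙ ℝ V → S → Prop := fun y z => ∃ γ ∈ Γ, γ • (z : ℙ ℝ V) ∈ O y
  have hP : ∀ y, ∀ a b : S, (∃ γ ∈ Γ, γ • (a : ℙ ℝ V) = b) → P y a = P y b := by
    rintro y a b ⟨γ, hγ, e⟩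
    refine propext ⟨?_, ?_⟩
    · rintro ⟨δ, hδ, hm⟩
      refine ⟨δ * γ⁻¹, Γ.mul_mem hδ (Γ.inv_mem hγ), ?_⟩
      rwa [← e, smul_smul, inv_mul_cancel_right]
    · rintro ⟨δ, hδ, hm⟩
      refine ⟨δ * γ, Γ.mul_mem hδ hγ, ?_⟩
      rwa [mul_smul, e]
  let W : S → Set (QuotientBy Γ S) := fun y => {q | Quot.lift (P y) (hP y) q}
  have hW : ∀ y, IsOpen (W y) := by
    intro y
    rw [← isQuotientMap_quot_mk.isOpen_preimage]
    have : Quot.mk _ ⁻¹' W y = ⋃ γ ∈ Γ, {z : S | γ • (z : ℙ ℝ V) ∈ O y} := by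
      ext z
      simp only [mem_iUnion, exists_prop]
      rfl
    rw [this]
    exact isOpen_biUnion fun γ _ =>
      (hO y).preimage ((continuous_pgl_smul γ).comp continuous_subtype_val)
  obtain ⟨t, ht⟩ := isCompact_univ.elim_finite_subcover W hW (by
    intro q _
    induction q using Quot.ind with
    | mk z =>
      refine mem_iUnion.2 ⟨z, 1, Γ.one_mem, p z, Metric.mem_ball_self (hr z z.2),
        h.ne_zero (hpC z z.2), ?_⟩
      rw [one_smul]
      exact hp z z.2)
  refine ⟨⋃ y ∈ t, Metric.closedBall (p y) (r y), ?_, ?_, ?_⟩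
  · exact iUnion₂_subset fun y _ => hrC y y.2
  · have := FiniteDimensional.proper_real V
    exact t.isCompact_biUnion fun y _ => isCompact_closedBall _ _
  · rintro v hv ⟨hv0, hvS⟩
    have h1 := ht (mem_univ (Quot.mk _ ⟨_, hvS⟩))
    simp only [mem_iUnion, exists_prop] at h1
    obtain ⟨y, hy, γ, hγ, w, hw, hw0, e⟩ := h1
    obtain ⟨u, hu, rfl⟩ := h.exists_mem_liftGroup hΓ hγ
    obtain ⟨a, ha⟩ := (Projectivization.mk_eq_mk_iff' ℝ _ _ hw0 (GLin.apply_ne_zero u hv0)).1 e.symm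
    have hwC : w ∈ C := hrC y y.2 (Metric.ball_subset_closedBall hw)
    have huv : u.1 v ∈ C := (hu.2 v).2 hv
    have ha0 : 0 < a := by
      by_contra! hneg
      rcases hneg.eq_or_lt with h0 | h0
      · exact hw0 (by rw [← ha, h0, zero_smul])
      · refine h.notMem_of_neg_mem (subset_closure hwC) ?_
        rw [← ha, ← neg_smul]
        exact h.sharp.smul_mem _ (by linarith) _ huv
    refine ⟨homothety a ha0.ne' * u, (liftGroup C Γ).mul_mem (h.homothety_mem_liftGroup Γ ha0) hu, ?_⟩
    rw [val_mul_apply, homothety_apply, ha]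
    exact mem_iUnion₂.2 ⟨y, hy, Metric.ball_subset_closedBall hw⟩

/-- A convex cocompact group of automorphisms lifts to a cocompact action on the cone. -/
theorem isCocompactAction [FiniteDimensional ℝ V] {Γ : Subgroup (PGL V)} (hΓ : Γ ≤ Aut Ω)
    (hd : SeqDiscrete Γ) (hcc : ActsConvexCocompactly Γ Ω) :
    IsCocompactAction C (liftGroup C Γ) where
  sharp := h.sharp
  map_mem g hg v hv := (hg.2 v).2 hv
  scalar_mem g t ht hgt := by
    have : g = homothety t ht.ne' := by
      ext v
      rw [hgt, homothety_apply]
    rw [this]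
    exact h.homothety_mem_liftGroup Γ ht
  discrete u hu := hd u fun n => (hu n).1
  cocompact := by
    obtain ⟨hne, hc⟩ := hcc
    obtain ⟨K, hKC, hK, hDK⟩ := h.exists_isCompact_of_compactSpace hΓ (fun _ hx => hx.1) hc
    refine ⟨C ∩ cone (core Γ Ω), K, inter_subset_left, ?_, hK, hKC, fun v hv => hDK v hv.1 hv.2,
      fun v hv s hs => ⟨h.sharp.smul_mem s hs v hv.1, smul_mem_cone hv.2 hs.ne'⟩, ?_⟩
    · obtain ⟨x, hx⟩ := hne
      obtain ⟨v, hv, rfl⟩ := h.exists_mk_eq hx.1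
      exact ⟨v, hv, _, hx⟩
    · rintro v ⟨hv, hvc⟩ y hy
      have hyC : y ∈ closure C := by
        obtain ⟨-, -, x, hx, u, hu, hlim⟩ := hy
        exact mem_closure_of_tendsto hlim (Eventually.of_forall fun n => ((hu n).2 x).2 hx)
      refine ⟨?_, h.add_mem_cone_core hy hyC hv hvc⟩
      rw [add_comm]
      exact h.sharp.add_closure_mem hv hyC

end IsConeOver

end Lifts

/-! ### The dual cone and biduality -/

section DualCone

open Filter Set

variable {V : Type*} [NormedAddCommGroup V] [NormedSpace ℝ V]

/-- A common zero of `f` and `f'` would be a zero of every combination. This frees the axis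
hypotheses from the unknown coefficients of the point of intersection. -/
theorem posOn_add_of_posOn_combination {C : Set V} {f f' : StrongDual ℝ V}
    (hf : ∀ v ∈ closure C, 0 ≤ f v) (hf' : ∀ v ∈ closure C, 0 ≤ f' v) {a b : ℝ}
    (h : PosOn C (a • f + b • f')) : PosOn C (f + f') := by
  intro v hv hv0
  by_contra! hneg
  rw [add_apply] at hneg
  have h1 := h v hv hv0
  have h2 : f v = 0 := by linarith [hf v hv, hf' v hv]
  have h3 : f' v = 0 := by linarith [hf v hv, hf' v hv]
  simp [h2, h3] at h1

/-- The open dual cone. -/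
def dualCone (C : Set V) : Set (StrongDual ℝ V) := {f | PosOn C f}

/-- Evaluation at a vector. -/
noncomputable abbrev evalAt (v : V) : StrongDual ℝ (StrongDual ℝ V) :=
  NormedSpace.inclusionInDoubleDual ℝ V v

theorem nonneg_of_mem_closure_dualCone {C : Set V} {f : StrongDual ℝ V}
    (hf : f ∈ closure (dualCone C)) {v : V} (hv : v ∈ closure C) : 0 ≤ f v := by
  have hcl : IsClosed {f : StrongDual ℝ V | 0 ≤ f v} :=
    isClosed_le continuous_const (evalAt v).continuous
  refine closure_minimal (fun f hf => ?_) hcl hf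
  by_cases hv0 : v = 0
  · simp [hv0]
  · exact (hf v hv hv0).le

namespace IsSharpCone

variable {C : Set V} (hC : IsSharpCone C)
include hC

theorem exists_posOn : ∃ f, PosOn C f := by
  obtain ⟨φ, ε, hε, hφ⟩ := hC.exists_coercive_closure
  exact ⟨φ, fun v hv hv0 => (mul_pos hε (norm_pos_iff.2 hv0)).trans_le (hφ v hv)⟩

theorem mem_closure_dualCone {f : StrongDual ℝ V} (hf : ∀ v ∈ closure C, 0 ≤ f v) :
    f ∈ closure (dualCone C) := by
  obtain ⟨φ, hφ⟩ := hC.exists_posOn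
  have h : Tendsto (fun n : ℕ => f + (1 / ((n : ℝ) + 1)) • φ) atTop (𝓝 (f + (0 : ℝ) • φ)) :=
    (tendsto_one_div_add_atTop_nhds_zero_nat.smul_const φ).const_add f
  rw [zero_smul, add_zero] at h
  refine mem_closure_of_tendsto h (Eventually.of_forall fun n v hv hv0 => ?_)
  have h1 := hφ v hv hv0
  have h2 := hf v hv
  simp only [add_apply, smul_apply, smul_eq_mul]
  positivity

theorem posOn_evalAt {w : V} (hw : w ∈ C) : PosOn (dualCone C) (evalAt w) := fun _ hf hf0 =>
  hC.pos_of_nonneg (fun _ hv => nonneg_of_mem_closure_dualCone hf hv) hf0 hw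

/-- Bipolar theorem: if `w ∉ C`, Hahn–Banach gives a form nonpositive on `C` and nonnegative at `w`;
its negative lies in the closed dual cone and contradicts positivity. -/
theorem mem_of_posOn_evalAt {w : V} (hw : PosOn (dualCone C) (evalAt w)) : w ∈ C := by
  by_contra hwC
  have hconv : Convex ℝ C := by
    intro u hu v hv a b ha hb hab
    rcases ha.eq_or_lt with rfl | ha
    · have : b = 1 := by linarith
      simpa [this] using hv
    rcases hb.eq_or_lt with rfl | hb
    · have : a = 1 := by linarith
      simpa [this] using hu
    exact hC.add_mem _ (hC.smul_mem a ha u hu) _ (hC.smul_mem b hb v hv)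
  obtain ⟨f, hf⟩ := geometric_hahn_banach_open_point hconv hC.isOpen hwC
  have h1 : ∀ a ∈ C, f a ≤ 0 := by
    intro a ha
    by_contra! hpos
    have h2 := hf _ (hC.smul_mem ((|f w| + 1) / f a) (by positivity) a ha)
    rw [map_smul, smul_eq_mul, div_mul_cancel₀ _ hpos.ne'] at h2
    linarith [le_abs_self (f w)]
  have h2 : 0 ≤ f w := by
    have hcl : IsClosed {v : V | f v ≤ f w} := isClosed_le f.continuous continuous_const
    have : f 0 ≤ f w := closure_minimal (fun v hv => (hf v hv).le) hcl hC.zero_mem_closure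
    rwa [map_zero] at this
  obtain ⟨c, hc⟩ := hC.nonempty
  have hf0 : -f ≠ 0 := by
    intro h0
    have h3 := hf c hc
    rw [neg_eq_zero.1 h0] at h3
    simp at h3
  have hcl : IsClosed {v : V | f v ≤ 0} := isClosed_le f.continuous continuous_const
  have h3 := hw (-f) (hC.mem_closure_dualCone fun v hv => by
    have : f v ≤ 0 := closure_minimal h1 hcl hv
    simpa using this) hf0
  rw [NormedSpace.dual_def, neg_apply] at h3
  linarith

theorem dualCone [FiniteDimensional ℝ V] : IsSharpCone (dualCone C) := by
  refine ⟨?_, ?_, ?_, hC.exists_posOn, ?_, ?_⟩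
  · rw [Metric.isOpen_iff]
    intro f hf
    obtain ⟨ε, hε, h⟩ := hC.exists_lower_bound hf
    refine ⟨ε, hε, fun g hg v hv hv0 => ?_⟩
    have h1 := h v hv
    have h2 := (g - f).le_opNorm v
    rw [Metric.mem_ball, dist_eq_norm] at hg
    have h3 : ‖g - f‖ * ‖v‖ < ε * ‖v‖ := mul_lt_mul_of_pos_right hg (norm_pos_iff.2 hv0)
    have h4 := neg_abs_le ((g - f) v)
    rw [Real.norm_eq_abs] at h2
    have h5 : (g - f) v = g v - f v := rfl
    linarith
  · intro f hf g hg v hv hv0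
    exact add_pos (hf v hv hv0) (hg v hv hv0)
  · intro t ht f hf v hv hv0
    exact mul_pos ht (hf v hv hv0)
  · obtain ⟨c, hc⟩ := hC.nonempty
    obtain ⟨k, hk, h⟩ := hC.exists_dominate hc
    -- An order unit `c` bounds the norm of any positive form by its value at `c`, so evaluation at
    -- `c` is coercive.
    refine ⟨evalAt c, k⁻¹, by positivity, fun f hf => ?_⟩
    rw [NormedSpace.dual_def, inv_mul_le_iff₀ hk]
    have hnn : ∀ v ∈ closure C, 0 ≤ f v :=
      fun v hv => nonneg_of_mem_closure_dualCone (subset_closure hf) hv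
    refine f.opNorm_le_bound (mul_nonneg hk.le (hnn c (subset_closure hc))) fun v => ?_
    have h1 := hnn _ (h v)
    have h2 := hnn _ (h (-v))
    rw [map_sub, map_smul, smul_eq_mul] at h1 h2
    rw [norm_neg, map_neg] at h2
    rw [Real.norm_eq_abs, abs_le]
    constructor <;> linarith
  · intro h0
    obtain ⟨c, hc⟩ := hC.nonempty
    exact lt_irrefl _ (h0 c (subset_closure hc) fun h => hC.zero_notMem (h ▸ hc))

end IsSharpCone

theorem exists_evalAt_eq [FiniteDimensional ℝ V] (ξ : StrongDual ℝ (StrongDual ℝ V)) :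
    ∃ v : V, evalAt v = ξ := by
  have hinj : Function.Injective (NormedSpace.inclusionInDoubleDual ℝ V).toLinearMap :=
    (NormedSpace.inclusionInDoubleDualLi ℝ (E := V)).injective
  have hdim : ∀ (W : Type _) [NormedAddCommGroup W] [NormedSpace ℝ W] [FiniteDimensional ℝ W],
      Module.finrank ℝ (StrongDual ℝ W) = Module.finrank ℝ W := by
    intro W _ _ _
    rw [← (LinearMap.toContinuousLinearMap (𝕜 := ℝ) (E := W) (F' := ℝ)).finrank_eq]
    exact Subspace.dual_finrank_eq
  have := (LinearMap.injective_iff_surjective_of_finrank_eq_finrank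
    (by rw [hdim, hdim])).1 hinj
  exact this ξ

theorem finrank_strongDual [FiniteDimensional ℝ V] :
    Module.finrank ℝ (StrongDual ℝ V) = Module.finrank ℝ V := by
  rw [← (LinearMap.toContinuousLinearMap (𝕜 := ℝ) (E := V) (F' := ℝ)).finrank_eq]
  exact Subspace.dual_finrank_eq

theorem IsConeOver.dual [FiniteDimensional ℝ V] {C : Set V} {Ω : Set (ℙ ℝ V)}
    (h : IsConeOver C Ω) : IsConeOver (dualCone C) (dual Ω) := by
  refine ⟨h.sharp.dualCone, fun f => ?_⟩
  have key : ∀ hf : f ≠ 0, (∀ v ∈ closure C, v ≠ 0 → f v ≠ 0) ↔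
      Projectivization.mk ℝ f hf ∈ ConvProj.dual Ω := by
    intro hf
    obtain ⟨a, ha⟩ := Projectivization.exists_smul_eq_mk_rep ℝ f hf
    constructor
    · rintro h1 x hx h2
      obtain ⟨v, hv0, hv, rfl⟩ := h.exists_mk_eq_closure hx
      obtain ⟨b, hb⟩ := Projectivization.exists_smul_eq_mk_rep ℝ v hv0
      rw [OnHyperplane, ← ha, ← hb] at h2
      have h3 : (a : ℝ) * ((b : ℝ) * f v) = 0 := by simpa [Units.smul_def] using h2
      exact h1 v hv hv0 (by simpa using h3)
    · intro h1 v hv hv0 h2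
      refine h1 (Projectivization.mk ℝ v hv0) ((h.mk_mem_closure_iff hv0).2 (Or.inl hv)) ?_
      obtain ⟨b, hb⟩ := Projectivization.exists_smul_eq_mk_rep ℝ v hv0
      rw [OnHyperplane, ← ha, ← hb]
      simp [Units.smul_def, h2]
  constructor
  · rintro ⟨hf, h1⟩
    exact h.sharp.sign_of_ne_zero_closure ((key hf).2 h1)
  · intro h1
    obtain ⟨c, hc⟩ := h.sharp.nonempty
    have hne : ∀ v ∈ closure C, v ≠ 0 → f v ≠ 0 := by
      rintro v hv hv0
      rcases h1 with h1 | h1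
      · exact (h1 v hv hv0).ne'
      · have := h1 v hv hv0
        rw [neg_apply, neg_pos] at this
        exact this.ne
    have hf : f ≠ 0 := fun h0 => hne c (subset_closure hc) (h.ne_zero hc) (by simp [h0])
    exact ⟨hf, (key hf).1 hne⟩

end DualCone

/-! ### Transposition and the contragredient action -/

section Transpose

open Filter Set

variable {V : Type*} [NormedAddCommGroup V] [NormedSpace ℝ V]

/-- Transposition of endomorphisms. -/
noncomputable def transpose : (V →L[ℝ] V) →L[ℝ] (StrongDual ℝ V →L[ℝ] StrongDual ℝ V) :=
  (ContinuousLinearMap.compL ℝ V V ℝ).flip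

theorem transpose_apply (T : V →L[ℝ] V) (f : StrongDual ℝ V) (v : V) :
    transpose T f v = f (T v) := rfl

theorem contragredientGL_val (u : GLin V) : (contragredientGL V u).1 = transpose u⁻¹.1 := rfl

theorem contragredientGL_inv_val (u : GLin V) : (contragredientGL V u)⁻¹.1 = transpose u.1 := rfl

theorem transpose_injective : Function.Injective (transpose (V := V)) := by
  intro S T h
  ext v
  refine (SeparatingDual.eq_iff_forall_dual_eq (R := ℝ)).2 fun f => ?_
  rw [← transpose_apply, h, transpose_apply]

theorem isClosedEmbedding_of_injective {E F : Type*} [NormedAddCommGroup E] [NormedSpace ℝ E]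
    [NormedAddCommGroup F] [NormedSpace ℝ F] [FiniteDimensional ℝ E] {f : E →L[ℝ] F}
    (hf : Function.Injective f) : Topology.IsClosedEmbedding f :=
  LinearMap.isClosedEmbedding_of_injective (f := f.toLinearMap) (LinearMap.ker_eq_bot.2 hf)

theorem isClosedEmbedding_transpose [FiniteDimensional ℝ V] :
    Topology.IsClosedEmbedding (transpose (V := V)) := by
  have : FiniteDimensional ℝ (V →L[ℝ] V) := inferInstance
  exact isClosedEmbedding_of_injective (E := V →L[ℝ] V)
    (F := StrongDual ℝ V →L[ℝ] StrongDual ℝ V) (f := transpose) transpose_injective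

/-- Transposition exchanges attracting vector and attracting form, and being an embedding it both
preserves and reflects convergence. The inverse is there because the contragredient of `N⁻¹` is the
transpose of `N`. -/
theorem isProx_contragredientGL_iff [FiniteDimensional ℝ V] {N : GLin V} {y : V}
    {f : StrongDual ℝ V} :
    IsProx (contragredientGL V N⁻¹).1 f (evalAt y) ↔ IsProx N.1 y f := by
  have hcl := isClosedEmbedding_transpose (V := V)
  have h1 : ∀ n : ℕ, (contragredientGL V N⁻¹).1 ^ n = transpose (N.1 ^ n) := by
    intro n
    rw [← Units.val_pow_eq_pow_val, ← map_pow, contragredientGL_val, inv_pow, inv_inv,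
      Units.val_pow_eq_pow_val]
  have h2 : (evalAt y).smulRight f = transpose (f.smulRight y) := by
    ext g v
    rw [transpose_apply]
    simp [mul_comm]
  rw [IsProx, IsProx, hcl.isEmbedding.tendsto_nhds_iff, ← h2]
  simp only [h1]
  rfl

theorem contragredient_mk (u : GLin V) :
    contragredient V (u : PGL V) = (contragredientGL V u : PGL (StrongDual ℝ V)) := rfl

theorem contragredient_injective : Function.Injective (contragredient V) := by
  intro a b hab
  induction a using QuotientGroup.induction_on with
  | H u =>
    induction b using QuotientGroup.induction_on with
    | H w =>
      obtain ⟨κ, hκ, e⟩ := exists_smul_of_mk_eq_mk hab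
      rw [contragredientGL_val, contragredientGL_val, ← map_smul] at e
      have h1 := mk_eq_mk_of_smul hκ (transpose_injective e)
      rw [QuotientGroup.mk_inv, QuotientGroup.mk_inv, inv_inj] at h1
      exact h1

theorem homothety_inv (t : ℝ) (ht : t ≠ 0) :
    (homothety (V := V) t ht)⁻¹ = homothety t⁻¹ (inv_ne_zero ht) := by
  rw [homothety, ← map_inv, homothety]
  congr 1
  ext
  simp

theorem mk_homothety_mul (t : ℝ) (ht : t ≠ 0) (u : GLin V) :
    ((homothety t ht * u : GLin V) : PGL V) = u := by
  refine mk_eq_mk_of_smul ht ?_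
  ext v
  rw [val_mul_apply, homothety_apply]
  rfl

theorem exists_contragredientGL_eq {γ : PGL V} {M : GLin (StrongDual ℝ V)}
    (hM : (M : PGL (StrongDual ℝ V)) = contragredient V γ) :
    ∃ N : GLin V, (N : PGL V) = γ ∧ contragredientGL V N = M := by
  induction γ using QuotientGroup.induction_on with
  | H u =>
    obtain ⟨κ, hκ, e⟩ := exists_smul_of_mk_eq_mk hM
    refine ⟨homothety κ⁻¹ (inv_ne_zero hκ) * u, mk_homothety_mul _ _ _, ?_⟩
    ext f v
    rw [e, contragredientGL_apply, mul_inv_rev, val_mul_apply, homothety_inv, homothety_apply,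
      smul_apply, contragredientGL_val, smul_apply, transpose_apply]
    simp

theorem SeqDiscrete.map_contragredient [FiniteDimensional ℝ V] {Γ : Subgroup (PGL V)}
    (h : SeqDiscrete Γ) : SeqDiscrete (Γ.map (contragredient V)) := by
  intro M hM T T' hT hT'
  have h1 : ∀ n, ∃ N : GLin V, (N : PGL V) ∈ Γ ∧ contragredientGL V N = M n := by
    intro n
    obtain ⟨γ, hγ, e⟩ := hM n
    obtain ⟨N, hN, e2⟩ := exists_contragredientGL_eq e.symm
    exact ⟨N, hN ▸ hγ, e2⟩
  choose N hN hNM using h1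
  have hcl := isClosedEmbedding_transpose (V := V)
  simp only [← hNM, contragredientGL_val, contragredientGL_inv_val] at hT hT'
  obtain ⟨S, rfl⟩ := hcl.isClosed_range.mem_of_tendsto hT (Eventually.of_forall fun n => ⟨_, rfl⟩)
  obtain ⟨S', rfl⟩ := hcl.isClosed_range.mem_of_tendsto hT' (Eventually.of_forall fun n => ⟨_, rfl⟩)
  have h2 := h (fun n => (N n)⁻¹) (fun n => Γ.inv_mem (hN n)) S S'
    (hcl.isEmbedding.tendsto_nhds_iff.2 hT)
    (by simpa only [inv_inv] using hcl.isEmbedding.tendsto_nhds_iff.2 hT')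
  filter_upwards [h2] with n ⟨κ, hκ⟩
  refine ⟨κ, ?_⟩
  rw [← hNM, ← hNM, contragredientGL_val, contragredientGL_val, hκ, map_smul]

end Transpose

/-! ### Attracting points as positive proximal data, in both actions -/

section DualAction

open Filter Set

variable {V : Type*} [NormedAddCommGroup V] [NormedSpace ℝ V]

theorem map_contragredient_le_aut [FiniteDimensional ℝ V] {C : Set V} {Ω : Set (ℙ ℝ V)}
    (h : IsConeOver C Ω) {Γ : Subgroup (PGL V)} (hΓ : Γ ≤ Aut Ω) :
    Γ.map (contragredient V) ≤ Aut (dual Ω) := by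
  have key : ∀ γ ∈ Γ, ∀ F ∈ dual Ω, contragredient V γ • F ∈ dual Ω := by
    intro γ hγ F hF
    obtain ⟨u, hu, rfl⟩ := h.exists_mem_liftGroup hΓ hγ
    obtain ⟨f, hf, rfl⟩ := h.dual.exists_mk_eq hF
    have hcl : MapsTo u⁻¹.1 (closure C) (closure C) :=
      MapsTo.closure (fun v hv => (((liftGroup C Γ).inv_mem hu).2 v).2 hv) u⁻¹.1.continuous
    have : (contragredientGL V u).1 f ∈ dualCone C := fun v hv hv0 =>
      hf _ (hcl hv) (GLin.apply_ne_zero u⁻¹ hv0)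
    exact h.dual.mk_mem this
  rintro _ ⟨γ, hγ, rfl⟩
  refine Set.Subset.antisymm ?_ ?_
  · rintro _ ⟨F, hF, rfl⟩
    exact key γ hγ F hF
  · intro F hF
    refine ⟨contragredient V γ⁻¹ • F, key _ (Γ.inv_mem hγ) F hF, ?_⟩
    change contragredient V γ • contragredient V γ⁻¹ • F = F
    rw [smul_smul, ← map_mul, mul_inv_cancel, map_one, one_smul]

variable [FiniteDimensional ℝ V]

theorem IsAttractingPoint.exists_isProx {γ : PGL V} {x : ℙ ℝ V} (h : IsAttractingPoint γ x) :
    ∃ N : GLin V, (N : PGL V) = γ ∧ ∃ f, IsProx N.1 x.rep f := by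
  obtain ⟨u, rfl, r, hr, hux⟩ := h
  have hr0 : r ≠ 0 := by
    rintro rfl
    rw [zero_smul] at hux
    exact GLin.apply_ne_zero u x.rep_nonzero hux
  obtain ⟨f, hf⟩ := exists_isProx_of_isDominantEigenvalue hr0 hr x.rep_nonzero hux
  refine ⟨homothety r⁻¹ (inv_ne_zero hr0) * u, mk_homothety_mul _ _ _, f, ?_⟩
  convert hf using 1
  ext v
  rw [val_mul_apply, homothety_apply]
  rfl

namespace IsConeOver

variable {C : Set V} {Ω : Set (ℙ ℝ V)} (h : IsConeOver C Ω) {Γ : Subgroup (PGL V)} (hΓ : Γ ≤ Aut Ω)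
  (hG : IsCocompactAction C (liftGroup C Γ))
include h hΓ hG

omit [FiniteDimensional ℝ V] in
-- If `-N` were the lift preserving `C`, the even and odd powers of `-N` at a point `c` of `C` would
-- put both `f c • y` and its negative in the closure.
theorem exists_isPosProx {N : GLin V} (hN : (N : PGL V) ∈ Γ) {y : V} {f : StrongDual ℝ V}
    (hp : IsProx N.1 y f) :
    ∃ σ : ℝ, (σ = 1 ∨ σ = -1) ∧ IsPosProx C (liftGroup C Γ) N (σ • y) (σ • f) := by
  rcases h.mem_liftGroup_or_neg_mem hΓ hN with h1 | h1
  · obtain ⟨σ, hσ, h2, h3, h4⟩ := hG.exists_sign h1 hp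
    exact ⟨σ, hσ, h1, h2, h3, h4⟩
  · exfalso
    obtain ⟨c, hc, hfc⟩ := hG.sharp.exists_apply_ne_zero hp.form_ne_zero
    have hmem : ∀ n : ℕ, ((-N.1) ^ n) c ∈ C := fun n => hG.pow_apply_mem h1 n hc
    have hlim := hp.tendsto_apply c
    have h2 : f c • y ∈ closure C := by
      refine mem_closure_of_tendsto (hlim.comp (tendsto_id.const_mul_atTop' (r := 2) (by norm_num)))
        (Eventually.of_forall fun n => ?_)
      have := hmem (2 * n)
      rwa [Even.neg_pow ⟨n, by ring⟩] at this
    have h3 : -(f c • y) ∈ closure C := by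
      refine mem_closure_of_tendsto (hlim.comp ((tendsto_add_atTop_nat 1).comp
        (tendsto_id.const_mul_atTop' (r := 2) (by norm_num)))).neg
        (Eventually.of_forall fun n => ?_)
      have := hmem (2 * n + 1)
      rw [Odd.neg_pow ⟨n, rfl⟩] at this
      exact this
    exact smul_ne_zero hfc hp.ne_zero (hG.sharp.eq_zero_of_neg_mem h2 h3)

theorem exists_isPosProx_of_isAttractingPoint {γ : PGL V} (hγ : γ ∈ Γ) {x : ℙ ℝ V}
    (hx : IsAttractingPoint γ x) : ∃ (N : GLin V) (y : V) (f : StrongDual ℝ V), (N : PGL V) = γ ∧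
      IsPosProx C (liftGroup C Γ) N y f ∧ ∃ hy, x = Projectivization.mk ℝ y hy := by
  obtain ⟨N, rfl, f, hf⟩ := hx.exists_isProx
  obtain ⟨σ, hσ, h1⟩ := h.exists_isPosProx hΓ hG hγ hf
  refine ⟨N, _, _, rfl, h1, h1.prox.ne_zero, ?_⟩
  conv_lhs => rw [← x.mk_rep]
  refine (Projectivization.mk_eq_mk_iff' ℝ _ _ _ _).2 ⟨σ, ?_⟩
  rcases hσ with rfl | rfl <;> simp

theorem exists_isPosProx_of_isProx_contragredient {γ : PGL V} (hγ : γ ∈ Γ)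
    {M : GLin (StrongDual ℝ V)} (hM : (M : PGL (StrongDual ℝ V)) = contragredient V γ)
    {f : StrongDual ℝ V} {ξ : StrongDual ℝ (StrongDual ℝ V)} (hp : IsProx M.1 f ξ) :
    ∃ (N : GLin V) (y : V), ∃ σ : ℝ, (σ = 1 ∨ σ = -1) ∧ (N : PGL V) = γ⁻¹ ∧
      IsPosProx C (liftGroup C Γ) N y (σ • f) ∧ ξ = σ • evalAt y := by
  obtain ⟨N, rfl, rfl⟩ := exists_contragredientGL_eq hM
  obtain ⟨y, rfl⟩ := exists_evalAt_eq ξ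
  rw [← inv_inv N, isProx_contragredientGL_iff] at hp
  obtain ⟨σ, hσ, h1⟩ := h.exists_isPosProx hΓ hG (Γ.inv_mem hγ) hp
  refine ⟨N⁻¹, _, σ, hσ, rfl, h1, ?_⟩
  rw [evalAt, evalAt, map_smul, smul_smul]
  rcases hσ with rfl | rfl <;> simp

theorem exists_isPosProx_of_isAttractingPoint_contragredient {γ : PGL V} (hγ : γ ∈ Γ)
    {F : ℙ ℝ (StrongDual ℝ V)} (hF : IsAttractingPoint (contragredient V γ) F) :
    ∃ (N : GLin V) (y : V) (f : StrongDual ℝ V), (N : PGL V) = γ⁻¹ ∧ IsPosProx C (liftGroup C Γ) N y f ∧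
      ∃ hf, F = Projectivization.mk ℝ f hf := by
  obtain ⟨M, hM, ξ, hξ⟩ := hF.exists_isProx
  obtain ⟨N, y, σ, hσ, hN, h1, -⟩ := h.exists_isPosProx_of_isProx_contragredient hΓ hG hγ hM hξ
  refine ⟨N, y, _, hN, h1, h1.prox.form_ne_zero, ?_⟩
  conv_lhs => rw [← F.mk_rep]
  refine (Projectivization.mk_eq_mk_iff' ℝ _ _ _ _).2 ⟨σ, ?_⟩
  rw [smul_smul]
  rcases hσ with rfl | rfl <;> norm_num

omit hΓ hG [FiniteDimensional ℝ V] in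
theorem isBiprox {N N' : GLin V} {x x' : V} {f f' : StrongDual ℝ V}
    (h₁ : IsPosProx C (liftGroup C Γ) N x f) (h₂ : IsPosProx C (liftGroup C Γ) N' x' f')
    (hN : (N' : PGL V) = (N : PGL V)⁻¹) : IsBiprox C (liftGroup C Γ) N N' x x' f f' := by
  refine ⟨h₁, h₂, ?_⟩
  obtain ⟨κ, hκ, e⟩ := exists_smul_of_mk_eq_mk (u := N⁻¹) hN
  refine ⟨κ, ?_, e⟩
  by_contra! hneg
  obtain ⟨c, hc⟩ := h.sharp.nonempty
  have h3 := (h₂.mem.2 c).2 hc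
  have h4 := (((liftGroup C Γ).inv_mem h₁.mem).2 c).2 hc
  refine h.notMem_of_neg_mem (subset_closure h3) ?_
  rw [e, smul_apply, ← neg_smul]
  exact h.sharp.smul_mem _ (by linarith [lt_of_le_of_ne hneg hκ]) _ h4

omit hG in
theorem isPosProx_contragredientGL {N : GLin V} {y : V} {f : StrongDual ℝ V}
    (hp : IsPosProx C (liftGroup C Γ) N y f) :
    IsPosProx (dualCone C) (liftGroup (dualCone C) (Γ.map (contragredient V)))
      (contragredientGL V N⁻¹) f (evalAt y) := by
  refine ⟨?_, isProx_contragredientGL_iff.2 hp.prox, h.sharp.mem_closure_dualCone hp.nonneg,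
    fun g hg => nonneg_of_mem_closure_dualCone hg hp.vec_mem⟩
  have hcl : MapsTo N.1 (closure C) (closure C) :=
    MapsTo.closure (fun v hv => (hp.mem.2 v).2 hv) N.1.continuous
  refine h.dual.mem_liftGroup_of_forall (map_contragredient_le_aut h hΓ)
    ⟨_, Γ.inv_mem hp.mem.1, rfl⟩ fun g hg v hv hv0 => ?_
  rw [contragredientGL_apply, inv_inv]
  exact hg _ (hcl hv) (GLin.apply_ne_zero N hv0)

end IsConeOver

end DualAction

/-! ### North-south dynamics along the axis -/

section AxisDynamics

open Filter Set

variable {E : Type*} [NormedAddCommGroup E] [NormedSpace ℝ E] {C : Set E}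

theorem IsSharpCone.combination_mem (hC : IsSharpCone C) {u v : E} (hu : u ∈ closure C)
    (hv : v ∈ closure C) (huv : u + v ∈ C) {a b : ℝ} (ha : 0 < a) (hb : 0 < b) :
    a • u + b • v ∈ C := by
  have hm : 0 < min a b := lt_min ha hb
  have e : a • u + b • v = min a b • (u + v) + ((a - min a b) • u + (b - min a b) • v) := by
    module
  rw [e]
  exact hC.add_closure_mem (hC.smul_mem _ hm _ huv) (hC.add_mem_closure
    (hC.smul_mem_closure (sub_nonneg.2 (min_le_left a b)) hu)
    (hC.smul_mem_closure (sub_nonneg.2 (min_le_right a b)) hv))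

namespace IsBiprox

variable {G : Subgroup (GLin E)} {S S' : GLin E} {x x' : E} {f f' : StrongDual ℝ E}
  (h : IsBiprox C G S S' x x' f f') (hC : IsSharpCone C) (hmap : ∀ g ∈ G, ∀ v ∈ C, g.1 v ∈ C)
include h hC hmap

/-- Under `S⁻ⁿ` the value of `f` is constant and `f'` stays zero, so coercivity bounds the orbit of
`z`; vectors off the line of `x` escape. Only invariance of the cone is assumed, so the lemma also
applies to a dual action that need not be cocompact. -/
theorem eq_smul_of_form_eq_zero [FiniteDimensional ℝ E] (hp : PosOn C (f + f')) {z : E}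
    (hz : z ∈ closure C) (hz0 : f' z = 0) : z = f z • x := by
  by_contra hne
  obtain ⟨ε, hε, hle⟩ := hC.exists_lower_bound hp
  obtain ⟨n, hn⟩ := ((h.fst.prox.tendsto_norm_inv_pow hne).eventually_gt_atTop (f z / ε)).exists
  have hcl : MapsTo (S⁻¹ ^ n).1 (closure C) (closure C) :=
    MapsTo.closure (hmap _ (G.pow_mem (G.inv_mem h.fst.mem) n)) (S⁻¹ ^ n).1.continuous
  have h1 := hle _ (hcl hz)
  obtain ⟨μ, hμ, e⟩ := h.exists_smul
  have h2 : ∀ w, f' w = 0 → f' (S⁻¹.1 w) = 0 := by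
    intro w hw
    have := h.snd.prox.form_apply w
    rw [e, smul_apply, map_smul, hw, smul_eq_mul] at this
    exact (mul_eq_zero.1 this).resolve_left hμ.ne'
  have h3 : ∀ n : ℕ, f' ((S⁻¹ ^ n).1 z) = 0 := by
    intro n
    induction n with
    | zero => simpa using hz0
    | succ n ih =>
      rw [pow_succ', val_mul_apply]
      exact h2 _ ih
  rw [add_apply, h.fst.prox.form_inv_pow_apply, h3, add_zero] at h1
  rw [div_lt_iff₀ hε] at hn
  linarith

/-- As `S'ⁿ w` tends to `f' w • x'`, the vector `x + S'ⁿ w` enters the open cone; pulling it back by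
`S'ⁿ` only rescales `x`. -/
theorem add_mem_of_form_pos (hxx : x + x' ∈ C) {w : E} (hw : w ∈ closure C) (hw0 : 0 < f' w) :
    x + w ∈ C := by
  obtain ⟨ν, hν, e⟩ := h.symm.exists_smul
  have hx : ∀ n : ℕ, (S' ^ n).1 x = ν ^ n • x := by
    intro n
    induction n with
    | zero => simp
    | succ n ih =>
      rw [pow_succ', val_mul_apply, ih, map_smul, h.symm.apply_snd_vec e, smul_smul, pow_succ]
  have h1 : x + f' w • x' ∈ C := by
    simpa using hC.combination_mem h.fst.vec_mem h.snd.vec_mem hxx one_pos hw0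
  have h2 : Tendsto (fun n : ℕ => x + (S'.1 ^ n) w) atTop (𝓝 (x + f' w • x')) :=
    (h.snd.prox.tendsto_apply w).const_add x
  obtain ⟨n, hn⟩ := (h2.eventually (hC.isOpen.mem_nhds h1)).exists
  have h3 := hmap _ (G.inv_mem (G.pow_mem h.snd.mem n)) _ hn
  have h4 : ((S' ^ n)⁻¹).1 x = (ν ^ n)⁻¹ • x := by
    have := inv_apply_val_apply (S' ^ n) x
    rw [hx, map_smul] at this
    rw [← this, smul_smul, inv_mul_cancel₀ (pow_pos hν n).ne', one_smul, this]
  rw [map_add, ← Units.val_pow_eq_pow_val, inv_apply_val_apply, h4] at h3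
  have h5 := hC.combination_mem (hC.smul_mem_closure (by positivity) h.fst.vec_mem) hw h3
    (pow_pos hν n) one_pos
  rwa [smul_smul, mul_inv_cancel₀ (pow_pos hν n).ne', one_smul, one_smul] at h5

end IsBiprox

end AxisDynamics

/-! ### From the two axes to rank one -/

section RankOne

open Filter Set

variable {V : Type*} [NormedAddCommGroup V] [NormedSpace ℝ V]

theorem onHyperplane_mk_iff {v : V} (hv : v ≠ 0) {f : StrongDual ℝ V} (hf : f ≠ 0) :
    OnHyperplane (Projectivization.mk ℝ v hv) (Projectivization.mk ℝ f hf) ↔ f v = 0 := by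
  obtain ⟨a, ha⟩ := Projectivization.exists_smul_eq_mk_rep ℝ f hf
  obtain ⟨b, hb⟩ := Projectivization.exists_smul_eq_mk_rep ℝ v hv
  rw [OnHyperplane, ← ha, ← hb]
  simp [Units.smul_def]

theorem mk_mem_projLine_iff {v a b : V} (hv : v ≠ 0) (ha : a ≠ 0) (hb : b ≠ 0) :
    Projectivization.mk ℝ v hv ∈
      projLine (Projectivization.mk ℝ a ha) (Projectivization.mk ℝ b hb) ↔
    ∃ s t : ℝ, s • a + t • b = v := by
  rw [projLine, mem_ofPred_eq, Projectivization.submodule_mk, Projectivization.submodule_mk,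
    Projectivization.submodule_mk, Submodule.span_singleton_le_iff_mem, ← Submodule.span_insert,
    Submodule.mem_span_pair]

namespace IsConeOver

variable {C : Set V} {Ω : Set (ℙ ℝ V)} (h : IsConeOver C Ω)

include h in
theorem exists_sign_of_segmentOf_subset {u w : V} (hli : LinearIndependent ℝ ![u, w])
    (hsub : segmentOf u w ⊆ closure Ω) :
    ∃ ε : ℝ, (ε = 1 ∨ ε = -1) ∧ ε • u ∈ closure C ∧ ε • w ∈ closure C := by
  have hpm : ∀ s t : ℝ, 0 ≤ s → 0 ≤ t → (s ≠ 0 ∨ t ≠ 0) → s • u + t • w ≠ 0 ∧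
      (s • u + t • w ∈ closure C ∨ -(s • u + t • w) ∈ closure C) := by
    intro s t hs ht hst
    have h0 : s • u + t • w ≠ 0 := by
      intro h0
      have := LinearIndependent.pair_iff.1 hli s t h0
      rcases hst with h1 | h1
      · exact h1 this.1
      · exact h1 this.2
    exact ⟨h0, (h.mk_mem_closure_iff h0).1 (hsub ⟨s, t, hs, ht, h0, rfl⟩)⟩
  obtain ⟨φ, hφ⟩ := h.sharp.exists_posOn
  have hnz : ∀ s t : ℝ, 0 ≤ s → 0 ≤ t → (s ≠ 0 ∨ t ≠ 0) → φ (s • u + t • w) ≠ 0 := by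
    intro s t hs ht hst
    obtain ⟨h0, h1 | h1⟩ := hpm s t hs ht hst
    · exact (hφ _ h1 h0).ne'
    · have := hφ _ h1 (neg_ne_zero.2 h0)
      rw [map_neg, neg_pos] at this
      exact this.ne
  obtain ⟨hu0, hu⟩ := hpm 1 0 (by norm_num) le_rfl (by norm_num)
  obtain ⟨hw0, hw⟩ := hpm 0 1 le_rfl (by norm_num) (by norm_num)
  simp only [one_smul, zero_smul, add_zero, zero_add] at hu hw hu0 hw0
  have hzero : ∀ s t : ℝ, 0 < s → 0 < t → s * φ u + t * φ w ≠ 0 := fun s t hs ht => by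
    simpa using hnz s t hs.le ht.le (Or.inl hs.ne')
  rcases hu with hu | hu <;> rcases hw with hw | hw
  · exact ⟨1, Or.inl rfl, by simpa using hu, by simpa using hw⟩
  · have h1 := hφ _ hu hu0
    have h2 := hφ _ hw (neg_ne_zero.2 hw0)
    rw [map_neg] at h2
    exact (hzero _ _ h2 h1 (by ring)).elim
  · have h1 := hφ _ hu (neg_ne_zero.2 hu0)
    have h2 := hφ _ hw hw0
    rw [map_neg] at h1
    exact (hzero _ _ h2 h1 (by ring)).elim
  · exact ⟨-1, Or.inr rfl, by simpa using hu, by simpa using hw⟩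

variable [FiniteDimensional ℝ V] {Γ : Subgroup (PGL V)} (hΓ : Γ ≤ Aut Ω)
  (hG : IsCocompactAction C (liftGroup C Γ)) (hd : 2 ≤ Module.finrank ℝ V)
  {S S' : GLin V} {x x' : V} {f f' : StrongDual ℝ V}
  (hb : IsBiprox C (liftGroup C Γ) S S' x x' f f') (hxx : x + x' ∈ C) (hp : PosOn C (f + f'))

include h hG hd hb hxx hp

/-- Consider a boundary segment through `x`, lifted to the closed cone. An endpoint with `f' > 0`
must have weight zero in `x` because `f' x = 0`, so `x` is the other endpoint and their sum is in
`C`. If `f'` vanishes at both endpoints, both lie on the line of `x`. -/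
theorem isStronglyExtremal_attracting :
    IsStronglyExtremal Ω (Projectivization.mk ℝ x hb.fst.prox.ne_zero) := by
  rintro ⟨u, w, hli, ⟨s, t, hs, ht, h0, e⟩, hsub⟩
  obtain ⟨ε, hε, hu, hw⟩ := h.exists_sign_of_segmentOf_subset hli (hsub.trans frontier_subset_closure)
  have hε2 : ε * ε = 1 := by rcases hε with rfl | rfl <;> norm_num
  have hε0 : ε ≠ 0 := by rcases hε with rfl | rfl <;> norm_num
  obtain ⟨a, ha⟩ := (Projectivization.mk_eq_mk_iff' ℝ _ _ hb.fst.prox.ne_zero h0).1 e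
  obtain ⟨φ, hφ⟩ := h.sharp.exists_posOn
  have hx : x = (a * ε * s) • ε • u + (a * ε * t) • ε • w := by
    rw [← ha, smul_add, smul_smul, smul_smul, smul_smul, smul_smul]
    congr 2
    · linear_combination (-a * s) * hε2
    · linear_combination (-a * t) * hε2
  have hu0 : ε • u ≠ 0 := smul_ne_zero hε0 (hli.ne_zero 0)
  have hw0 : ε • w ≠ 0 := smul_ne_zero hε0 (hli.ne_zero 1)
  have haε : 0 < a * ε := by
    have h1 := hφ _ hb.fst.vec_mem hb.fst.prox.ne_zero
    have h2 := hφ _ hu hu0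
    have h3 := hφ _ hw hw0
    rw [hx, map_add, map_smul (_ : StrongDual ℝ V), map_smul (_ : StrongDual ℝ V) (a * ε * t)] at h1
    simp only [smul_eq_mul] at h1
    by_contra! hneg
    have h4 : a * ε * s ≤ 0 := mul_nonpos_of_nonpos_of_nonneg hneg hs
    have h5 : a * ε * t ≤ 0 := mul_nonpos_of_nonpos_of_nonneg hneg ht
    nlinarith
  have hfx : f' x = 0 := hb.symm.form_vec hd
  have hmem : ∀ s t : ℝ, 0 ≤ s → 0 ≤ t → s • ε • u + t • ε • w ∉ C := by
    intro s t hs ht hC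
    have e2 : s • ε • u + t • ε • w = ε • (s • u + t • w) := by module
    have h1 : s • u + t • w ≠ 0 := by
      intro h1
      rw [e2, h1, smul_zero] at hC
      exact h.sharp.zero_notMem hC
    have h2 := hsub ⟨s, t, hs, ht, h1, rfl⟩
    rw [h.isOpen.frontier_eq] at h2
    refine h2.2 ((h.mk_mem_iff h1).2 ?_)
    rw [e2] at hC
    rcases hε with rfl | rfl
    · exact Or.inl (by simpa using hC)
    · exact Or.inr (by rwa [neg_smul, one_smul] at hC)
  have hs' : 0 ≤ a * ε * s := mul_nonneg haε.le hs
  have ht' : 0 ≤ a * ε * t := mul_nonneg haε.le ht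
  have hsum : a * ε * s * f' (ε • u) + a * ε * t * f' (ε • w) = 0 := by
    rw [hx, map_add, map_smul (_ : StrongDual ℝ V), map_smul (_ : StrongDual ℝ V) (a * ε * t)] at hfx
    exact hfx
  have hmap : ∀ g ∈ liftGroup C Γ, ∀ v ∈ C, g.1 v ∈ C := hG.map_mem
  rcases (hb.snd.nonneg _ hu).eq_or_lt with h1 | h1
  · rcases (hb.snd.nonneg _ hw).eq_or_lt with h2 | h2
    · have h3 := hb.eq_smul_of_form_eq_zero h.sharp hmap hp hu h1.symm
      have h4 := hb.eq_smul_of_form_eq_zero h.sharp hmap hp hw h2.symm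
      have h5 : f (ε • u) ≠ 0 := fun h5 => hu0 (by rw [h3, h5, zero_smul])
      generalize f (ε • u) = p at h3 h5
      generalize f (ε • w) = q at h4
      have h6 : (q * ε) • u + (-p * ε) • w = 0 := by
        have : q • (ε • u) - p • (ε • w) = 0 := by
          rw [h3, h4]
          module
        rw [← this]
        module
      have h7 := (LinearIndependent.pair_iff.1 hli _ _ h6).2
      exact mul_ne_zero (neg_ne_zero.2 h5) hε0 h7
    · have h3 : a * ε * t = 0 := by
        rw [← h1, mul_zero, zero_add] at hsum
        exact (mul_eq_zero.1 hsum).resolve_right h2.ne'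
      have h4 := hb.add_mem_of_form_pos h.sharp hmap hxx hw h2
      rw [h3, zero_smul, add_zero] at hx
      refine hmem (a * ε * s) 1 hs' zero_le_one ?_
      rwa [← hx, one_smul]
  · have h2 : 0 ≤ a * ε * t * f' (ε • w) := mul_nonneg ht' (hb.snd.nonneg _ hw)
    have h3 : a * ε * s = 0 := by
      have h4 : 0 ≤ a * ε * s * f' (ε • u) := mul_nonneg hs' h1.le
      have h5 : a * ε * s * f' (ε • u) = 0 := by linarith
      exact (mul_eq_zero.1 h5).resolve_right h1.ne'
    have h4 := hb.add_mem_of_form_pos h.sharp hmap hxx hu h1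
    rw [h3, zero_smul, zero_add] at hx
    refine hmem 1 (a * ε * t) zero_le_one ht' ?_
    rwa [← hx, one_smul, add_comm]

include hΓ

omit hp in
-- A supporting form at `x` belongs, up to sign, to the closed dual cone and is killed by evaluation
-- at `x`. The dynamics on the dual cone, where `x + x' ∈ C` is the positivity needed, makes it a
-- multiple of `f'`.
theorem isSmoothPoint_attracting :
    IsSmoothPoint Ω (Projectivization.mk ℝ x hb.fst.prox.ne_zero) := by
  refine ⟨Projectivization.mk ℝ f' hb.snd.prox.form_ne_zero, ⟨?_, ?_⟩, ?_⟩
  · exact (onHyperplane_mk_iff _ _).2 (hb.symm.form_vec hd)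
  · intro p hpΩ
    obtain ⟨v, hv, rfl⟩ := h.exists_mk_eq hpΩ
    rw [onHyperplane_mk_iff]
    exact (hb.snd.pos hG hv).ne'
  · rintro F ⟨hF, hF'⟩
    induction F using Projectivization.ind with
    | h φ hφ0 =>
      rw [onHyperplane_mk_iff] at hF
      have hne : ∀ v ∈ C, φ v ≠ 0 := fun v hv hv0 =>
        hF' _ (h.mk_mem hv) ((onHyperplane_mk_iff _ _).2 hv0)
      have hd1 := h.isPosProx_contragredientGL hΓ hb.fst
      have hd2 := h.isPosProx_contragredientGL hΓ hb.snd
      obtain ⟨μ, hμ, e⟩ := hb.exists_smul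
      -- The order is swapped so that the second form of the dual pair is evaluation at `x`.
      have hd3 := h.dual.isBiprox hd2 hd1 (by
        rw [← QuotientGroup.mk_inv, ← map_inv, inv_inv]
        have h1 : (S' : PGL V) = ((S⁻¹ : GLin V) : PGL V) := mk_eq_mk_of_smul hμ.ne' e
        change contragredient V ((S⁻¹ : GLin V) : PGL V) = contragredient V (S' : PGL V)
        rw [h1])
      have hpd : PosOn (dualCone C) (evalAt x' + evalAt x) := by
        rw [evalAt, evalAt, ← map_add, add_comm]
        exact h.sharp.posOn_evalAt hxx
      have key : ∀ g : StrongDual ℝ V, (∀ v ∈ C, 0 < g v) → g x = 0 → g = g x' • f' := by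
        intro g hg hgx
        have hcl : IsClosed {v : V | 0 ≤ g v} := isClosed_le continuous_const g.continuous
        have hgm := h.sharp.mem_closure_dualCone (f := g) fun v hv =>
          closure_minimal (fun v hv => (hg v hv).le) hcl hv
        exact hd3.eq_smul_of_form_eq_zero h.sharp.dualCone (fun g hg v hv => (hg.2 v).2 hv) hpd
          hgm hgx
      refine (Projectivization.mk_eq_mk_iff' ℝ _ _ _ _).2 ⟨φ x', ?_⟩
      rcases h.sharp.sign_of_ne_zero hne with h1 | h1
      · exact (key φ h1 hF).symm
      · have h2 := key (-φ) (fun v hv => by simpa using h1 v hv) (by simpa using hF)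
        ext v
        have h3 : -φ v = -φ x' * f' v := by simpa using DFunLike.congr_fun h2 v
        change φ x' * f' v = φ v
        linarith

theorem attracting_mem_sseBoundary :
    Projectivization.mk ℝ x hb.fst.prox.ne_zero ∈ sseBoundary Ω :=
  ⟨(h.mk_mem_frontier_iff _ hb.fst.vec_mem).2 (hb.fst.vec_notMem hG hd),
    h.isSmoothPoint_attracting hΓ hG hd hb hxx, h.isStronglyExtremal_attracting hG hd hb hxx hp⟩

/-- A biproximal element whose axis meets the cone and whose dual axis meets the dual cone is
rank-one. -/
theorem isRankOne : IsRankOne Ω (S : PGL V) := by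
  obtain ⟨μ, hμ, e⟩ := hb.exists_smul
  have hSx' := hb.apply_snd_vec e
  refine ⟨hΓ hb.fst.mem.1, ?_, ?_⟩
  · rw [isOfFinOrder_iff_pow_eq_one]
    rintro ⟨n, hn, hn1⟩
    have h1 : ((S ^ n : GLin V) : PGL V) = ((1 : GLin V) : PGL V) := hn1
    obtain ⟨κ, hκ, e1⟩ := exists_smul_of_mk_eq_mk h1
    have h2 : ∀ m : ℕ, (S ^ m).1 x = x ∧ (S ^ m).1 x' = μ ^ m • x' := by
      intro m
      induction m with
      | zero => simp
      | succ m ih =>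
        rw [pow_succ', val_mul_apply, val_mul_apply, ih.1, ih.2, hb.fst.prox.apply_self, map_smul,
          hSx', smul_smul, pow_succ]
        exact ⟨rfl, rfl⟩
    obtain ⟨h3, h4⟩ := h2 n
    rw [e1] at h3 h4
    have h5 : κ = 1 := by
      have := congrArg f h3
      simpa [hb.fst.prox.2] using this
    have h6 : μ ^ n = 1 := by
      have := congrArg f' h4
      simpa [hb.snd.prox.2, h5] using this.symm
    -- Finite order would force the ratio `μ` of the eigenvalues at `x'` and `x`, a positive number
    -- different from 1, to be a root of unity.
    exact hb.scalar_ne_one hd e ((pow_eq_one_iff_of_nonneg hμ.le hn.ne').1 h6)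
  · have hxx0 := h.ne_zero hxx
    refine ⟨⟨Projectivization.mk ℝ (x + x') hxx0, Projectivization.mk ℝ x hb.fst.prox.ne_zero,
      h.mk_mem hxx, (h.attracting_mem_sseBoundary hΓ hG hd hb hxx hp).1⟩, ?_, ?_⟩
    · rintro p ⟨hp1, hp2⟩
      obtain ⟨v, hv0, hv, rfl⟩ := h.exists_mk_eq_closure (frontier_subset_closure hp2)
      rw [h.mk_mem_frontier_iff hv0 hv] at hp2
      obtain ⟨s, t, rfl⟩ := (mk_mem_projLine_iff _ _ _).1 hp1
      have e2 : s • (x + x') + t • x = (s + t) • x + s • x' := by module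
      -- The forms `f` and `f'` read off the coordinates along `x` and `x'`; a point of the closed
      -- cone has both nonnegative, and it is on the boundary only if one vanishes.
      have h1 : f (s • (x + x') + t • x) = s + t := by
        rw [e2, map_add, map_smul, map_smul, hb.fst.prox.2, hb.form_vec hd]
        simp
      have h2 : f' (s • (x + x') + t • x) = s := by
        rw [e2, map_add, map_smul, map_smul, hb.snd.prox.2, hb.symm.form_vec hd]
        simp
      have h3 := hb.fst.nonneg _ hv
      have h4 := hb.snd.nonneg _ hv
      rw [h1] at h3
      rw [h2] at h4
      rcases h3.eq_or_lt with h3 | h3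
      · have hsse := h.attracting_mem_sseBoundary hΓ hG hd hb.symm (by rwa [add_comm])
          (by rwa [add_comm])
        convert hsse using 1
        refine (Projectivization.mk_eq_mk_iff' ℝ _ _ _ _).2 ⟨s, ?_⟩
        rw [e2, ← h3, zero_smul, zero_add]
      rcases h4.eq_or_lt with h4 | h4
      · convert h.attracting_mem_sseBoundary hΓ hG hd hb hxx hp using 1
        refine (Projectivization.mk_eq_mk_iff' ℝ _ _ _ _).2 ⟨s + t, ?_⟩
        rw [e2, ← h4, zero_smul, add_zero]
      · refine (hp2 ?_).elim
        rw [e2]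
        exact h.sharp.combination_mem hb.fst.vec_mem hb.snd.vec_mem hxx h3 h4
    · have key : ∀ (u : GLin V) (a b : ℝ), (u : PGL V) ∈ Aut Ω → u.1 x = a • x → u.1 x' = b • x' →
          ∀ p ∈ projLine (Projectivization.mk ℝ (x + x') hxx0)
            (Projectivization.mk ℝ x hb.fst.prox.ne_zero) ∩ Ω, (u : PGL V) • p ∈
            projLine (Projectivization.mk ℝ (x + x') hxx0)
            (Projectivization.mk ℝ x hb.fst.prox.ne_zero) ∩ Ω := by
        rintro u a b hu hua hub p ⟨hp1, hp2⟩
        refine ⟨?_, (smul_mem_iff_of_mem_aut hu p).2 hp2⟩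
        induction p using Projectivization.ind with
        | h v hv =>
          obtain ⟨s, t, rfl⟩ := (mk_mem_projLine_iff _ _ _).1 hp1
          rw [mk_smul_mk u _ hv (GLin.apply_ne_zero u hv), mk_mem_projLine_iff]
          refine ⟨s * b, s * a + t * a - s * b, ?_⟩
          rw [map_add, map_smul, map_smul, map_add, hua, hub]
          module
      refine Set.Subset.antisymm ?_ ?_
      · rintro _ ⟨p, hp1, rfl⟩
        exact key S 1 μ (hΓ hb.fst.mem.1) (by rw [hb.fst.prox.apply_self, one_smul]) hSx' p hp1
      · intro p hp1
        refine ⟨(S : PGL V)⁻¹ • p, key S⁻¹ 1 μ⁻¹ ((Aut Ω).inv_mem (hΓ hb.fst.mem.1))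
          (by rw [hb.fst.prox.inv_apply_self, one_smul]) ?_ p hp1, smul_inv_smul _ _⟩
        have := inv_apply_val_apply S x'
        rw [hSx', map_smul] at this
        rw [← this, smul_smul, inv_mul_cancel₀ hμ.ne', one_smul, this]

end IsConeOver

end RankOne

/-! ### Reduction of the four statements to pairs of proximal elements -/

section Biproximal

open Filter Set

variable {V : Type*} [NormedAddCommGroup V] [NormedSpace ℝ V]

/-- This is the exit point of a line through `u`, the supremum of the admissible `s`; it produces
the second endpoint of a straight geodesic. -/
theorem IsSharpCone.exists_sub_smul_mem {C : Set V} (hC : IsSharpCone C) {u k : V} (hu : u ∈ C)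
    (hk : k ∈ closure C) (hk0 : k ≠ 0) :
    ∃ s : ℝ, 0 < s ∧ u - s • k ∈ closure C ∧ u - s • k ∉ C := by
  obtain ⟨φ, hφ⟩ := hC.exists_posOn
  have hφk := hφ k hk hk0
  set A : Set ℝ := {s | u - s • k ∈ closure C} with hA
  have hAcl : IsClosed A := isClosed_closure.preimage (by fun_prop)
  have hA0 : (0 : ℝ) ∈ A := by
    rw [hA]
    change u - (0 : ℝ) • k ∈ closure C
    rw [zero_smul, sub_zero]
    exact subset_closure hu
  have hAb : BddAbove A := by
    refine ⟨φ u / φ k, fun s hs => ?_⟩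
    have h1 : 0 ≤ φ (u - s • k) := by
      by_cases h0 : u - s • k = 0
      · rw [h0, map_zero]
      · exact (hφ _ hs h0).le
    rw [map_sub, map_smul, smul_eq_mul] at h1
    rw [le_div_iff₀ hφk]
    linarith
  have hs := hAcl.csSup_mem ⟨0, hA0⟩ hAb
  have hnot : u - sSup A • k ∉ C := by
    intro hmem
    have hcont : Tendsto (fun t : ℝ => u - t • k) (𝓝[>] (sSup A)) (𝓝 (u - sSup A • k)) :=
      (Continuous.tendsto (by fun_prop) _).mono_left nhdsWithin_le_nhds
    obtain ⟨t, ht, ht'⟩ := ((hcont.eventually (hC.isOpen.mem_nhds hmem)).and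
      self_mem_nhdsWithin).exists
    exact absurd (le_csSup hAb (show t ∈ A from subset_closure ht)) (not_le.2 ht')
  refine ⟨sSup A, lt_of_le_of_ne (le_csSup hAb hA0) fun h0 => hnot ?_, hs, hnot⟩
  rw [← h0, zero_smul, sub_zero]
  exact hu

variable [FiniteDimensional ℝ V]

theorem IsConeOver.exists_isAttractingPoint_of_bipUnitTangent {C : Set V} {Ω : Set (ℙ ℝ V)}
    (h : IsConeOver C Ω) {Γ : Subgroup (PGL V)}
    (hne : (bipUnitTangent Γ Ω).Nonempty) :
    ∃ γ₁ ∈ Γ, ∃ γ₂ ∈ Γ, ∃ v₁ v₂ : V, ∃ (h₁ : v₁ ≠ 0) (h₂ : v₂ ≠ 0),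
      IsAttractingPoint γ₁ (Projectivization.mk ℝ v₁ h₁) ∧
      IsAttractingPoint γ₂ (Projectivization.mk ℝ v₂ h₂) ∧ v₁ + v₂ ∈ C := by
  obtain ⟨q, hq⟩ := hne
  obtain ⟨t, rfl⟩ := Quot.exists_rep q
  have hends := hq t rfl
  obtain ⟨u, hu, hut⟩ := h.exists_mk_eq t.foot_mem
  obtain ⟨k, hk0, hk, hkt⟩ := h.exists_mk_eq_closure (frontier_subset_closure t.fwd_mem)
  have hkC : k ∉ C := by
    rw [← h.mk_mem_frontier_iff hk0 hk, ← hkt]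
    exact t.fwd_mem
  obtain ⟨s, hs, hp, hpC⟩ := h.sharp.exists_sub_smul_mem hu hk hk0
  have hp0 : u - s • k ≠ 0 := by
    intro h0
    rw [sub_eq_zero.1 h0, h.smul_mem_iff hs] at hu
    exact hkC hu
  have hkp : k + (u - s • k) ∈ C := by
    have h1 := h.sharp.combination_mem (h.sharp.smul_mem_closure hs.le hk) hp
      (by rwa [add_sub_cancel]) (inv_pos.2 hs) one_pos
    rwa [smul_smul, inv_mul_cancel₀ hs.ne', one_smul, one_smul] at h1
  have hk_end : Projectivization.mk ℝ k hk0 ∈ proxLimitSet Γ := by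
    refine hends ⟨?_, by rw [← hkt]; exact t.fwd_mem⟩
    rw [hut, hkt, mk_mem_projLine_iff]
    exact ⟨0, 1, by simp⟩
  have hp_end : Projectivization.mk ℝ _ hp0 ∈ proxLimitSet Γ := by
    refine hends ⟨?_, (h.mk_mem_frontier_iff hp0 hp).2 hpC⟩
    rw [hut, hkt, mk_mem_projLine_iff]
    exact ⟨1, -s, by module⟩
  -- Having a sum in `C` is an open condition on pairs of lifts, so the endpoints can be replaced by
  -- nearby attracting points.
  have hopen : IsOpen {z : V × V | z.1 + z.2 ∈ C} := h.sharp.isOpen.preimage (by fun_prop)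
  obtain ⟨U, W, hU, hW, hkU, hpW, hUW⟩ := isOpen_prod_iff.1 hopen _ _ hkp
  obtain ⟨_, ⟨w₁, hw₁, hw₁0, rfl⟩, γ₁, hγ₁, ha₁⟩ :=
    mem_closure_iff.1 hk_end _ (isOpen_image_mk hU) ⟨k, hkU, hk0, rfl⟩
  obtain ⟨_, ⟨w₂, hw₂, hw₂0, rfl⟩, γ₂, hγ₂, ha₂⟩ :=
    mem_closure_iff.1 hp_end _ (isOpen_image_mk hW) ⟨_, hpW, hp0, rfl⟩
  have hw : (w₁, w₂) ∈ {z : V × V | z.1 + z.2 ∈ C} := hUW ⟨hw₁, hw₂⟩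
  exact ⟨γ₁, hγ₁, γ₂, hγ₂, w₁, w₂, hw₁0, hw₂0, ha₁, ha₂, hw⟩

namespace IsConeOver

variable {C : Set V} {Ω : Set (ℙ ℝ V)} (h : IsConeOver C Ω) {Γ : Subgroup (PGL V)}
  (hΓ : Γ ≤ Aut Ω) (hG : IsCocompactAction C (liftGroup C Γ)) (hd : 2 ≤ Module.finrank ℝ V)
include h hΓ hG hd

theorem isRankOne_of_dual_axis {γ : PGL V} (hγ : γ ∈ Γ)
    (hax : (axis (contragredient V γ) ∩ ConvProj.dual Ω).Nonempty) : IsRankOne Ω γ := by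
  obtain ⟨z, ⟨F₁, F₂, hF₁, hF₂, hz⟩, hzd⟩ := hax
  rw [← map_inv] at hF₂
  obtain ⟨N₁, y₁, f₁, hN₁, hp₁, hf₁, rfl⟩ :=
    h.exists_isPosProx_of_isAttractingPoint_contragredient hΓ hG hγ hF₁
  obtain ⟨N₂, y₂, f₂, hN₂, hp₂, hf₂, rfl⟩ :=
    h.exists_isPosProx_of_isAttractingPoint_contragredient hΓ hG (Γ.inv_mem hγ) hF₂
  obtain ⟨g, hg, rfl⟩ := h.dual.exists_mk_eq hzd
  obtain ⟨s, t, rfl⟩ := (mk_mem_projLine_iff _ _ _).1 hz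
  have hpos : PosOn C (f₂ + f₁) := by
    rw [add_comm]
    exact posOn_add_of_posOn_combination hp₁.nonneg hp₂.nonneg hg
  rw [inv_inv] at hN₂
  have hb := h.isBiprox hp₂ hp₁ (by rw [hN₁, hN₂])
  rw [← hN₂]
  exact h.isRankOne hΓ hG hd hb (hb.add_mem hG hd hpos) hpos

theorem quotientIsRankOne_of_dual_bipUnitTangent
    (hne : (bipUnitTangent (Γ.map (contragredient V)) (ConvProj.dual Ω)).Nonempty) :
    QuotientIsRankOne Γ Ω := by
  obtain ⟨_, ⟨γ₁, hγ₁, rfl⟩, _, ⟨γ₂, hγ₂, rfl⟩, g₁, g₂, hg₁, hg₂, ha₁, ha₂, hg⟩ :=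
    h.dual.exists_isAttractingPoint_of_bipUnitTangent hne
  obtain ⟨N₁, y₁, f₁, hN₁, hp₁, hf₁, e₁⟩ :=
    h.exists_isPosProx_of_isAttractingPoint_contragredient hΓ hG hγ₁ ha₁
  obtain ⟨N₂, y₂, f₂, hN₂, hp₂, hf₂, e₂⟩ :=
    h.exists_isPosProx_of_isAttractingPoint_contragredient hΓ hG hγ₂ ha₂
  obtain ⟨a, rfl⟩ := (Projectivization.mk_eq_mk_iff' ℝ _ _ hg₁ hf₁).1 e₁
  obtain ⟨b, rfl⟩ := (Projectivization.mk_eq_mk_iff' ℝ _ _ hg₂ hf₂).1 e₂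
  obtain ⟨S, S', x, x', f, f', hb, hp⟩ := hp₁.exists_isBiprox hG hd hp₂
    (posOn_add_of_posOn_combination hp₁.nonneg hp₂.nonneg hg)
  exact ⟨_, hb.fst.mem.1, h.isRankOne hΓ hG hd hb (hb.add_mem hG hd hp) hp⟩

variable (hGd : IsCocompactAction (dualCone C)
  (liftGroup (dualCone C) (Γ.map (contragredient V))))
include hGd

/-- By biduality the axis plays the role of a dual axis for the action on the dual cone.
Cocompactness there gives that the dual axis meets the dual cone, the other half of the rank-one
criterion. -/
theorem isRankOne_of_axis {γ : PGL V} (hγ : γ ∈ Γ) (hax : (axis γ ∩ Ω).Nonempty) :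
    IsRankOne Ω γ := by
  obtain ⟨z, ⟨x₁, x₂, hx₁, hx₂, hz⟩, hzΩ⟩ := hax
  obtain ⟨N₁, y₁, f₁, rfl, hp₁, hy₁, rfl⟩ := h.exists_isPosProx_of_isAttractingPoint hΓ hG hγ hx₁
  obtain ⟨N₂, y₂, f₂, hN₂, hp₂, hy₂, rfl⟩ :=
    h.exists_isPosProx_of_isAttractingPoint hΓ hG (Γ.inv_mem hγ) hx₂
  obtain ⟨g, hg, rfl⟩ := h.exists_mk_eq hzΩ
  obtain ⟨s, t, rfl⟩ := (mk_mem_projLine_iff _ _ _).1 hz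
  have hb := h.isBiprox hp₁ hp₂ hN₂
  have hd₁ := h.isPosProx_contragredientGL hΓ hp₁
  have hd₂ := h.isPosProx_contragredientGL hΓ hp₂
  have hpos : PosOn (dualCone C) (evalAt y₁ + evalAt y₂) := by
    refine posOn_add_of_posOn_combination hd₁.nonneg hd₂.nonneg (a := s) (b := t) ?_
    have := h.sharp.posOn_evalAt hg
    rwa [evalAt, map_add, map_smul, map_smul] at this
  have hbd := h.dual.isBiprox hd₁ hd₂ (by
    rw [← contragredient_mk, ← contragredient_mk, ← map_inv, QuotientGroup.mk_inv,
      QuotientGroup.mk_inv, hN₂])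
  refine h.isRankOne hΓ hG hd hb (h.sharp.mem_of_posOn_evalAt ?_)
    (hbd.add_mem hGd (by rwa [finrank_strongDual]) hpos)
  rwa [evalAt, map_add]

theorem quotientIsRankOne_of_bipUnitTangent (hne : (bipUnitTangent Γ Ω).Nonempty) :
    QuotientIsRankOne Γ Ω := by
  have hdd : 2 ≤ Module.finrank ℝ (StrongDual ℝ V) := by rwa [finrank_strongDual]
  obtain ⟨γ₁, hγ₁, γ₂, hγ₂, g₁, g₂, hg₁, hg₂, ha₁, ha₂, hg⟩ :=
    h.exists_isAttractingPoint_of_bipUnitTangent hne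
  obtain ⟨N₁, y₁, f₁, hN₁, hp₁, hy₁, e₁⟩ := h.exists_isPosProx_of_isAttractingPoint hΓ hG hγ₁ ha₁
  obtain ⟨N₂, y₂, f₂, hN₂, hp₂, hy₂, e₂⟩ := h.exists_isPosProx_of_isAttractingPoint hΓ hG hγ₂ ha₂
  obtain ⟨a, rfl⟩ := (Projectivization.mk_eq_mk_iff' ℝ _ _ hg₁ hy₁).1 e₁
  obtain ⟨b, rfl⟩ := (Projectivization.mk_eq_mk_iff' ℝ _ _ hg₂ hy₂).1 e₂
  have hd₁ := h.isPosProx_contragredientGL hΓ hp₁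
  have hd₂ := h.isPosProx_contragredientGL hΓ hp₂
  -- The biproximal pair is built in the dual group and then carried back to `Γ`: its vectors become
  -- forms on `V`, and its forms become vectors by reflexivity.
  obtain ⟨M, M', F, F', ξ, ξ', hb, hp⟩ := hd₁.exists_isBiprox hGd hdd hd₂ (by
    refine posOn_add_of_posOn_combination hd₁.nonneg hd₂.nonneg (a := a) (b := b) ?_
    have := h.sharp.posOn_evalAt hg
    rwa [evalAt, map_add, map_smul, map_smul] at this)
  have hF := hb.add_mem hGd hdd hp
  obtain ⟨γ, hγ, e⟩ := hb.fst.mem.1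
  obtain ⟨γ', hγ', e'⟩ := hb.snd.mem.1
  obtain ⟨N, y, σ, hσ, hN, hpN, rfl⟩ :=
    h.exists_isPosProx_of_isProx_contragredient hΓ hG hγ e.symm hb.fst.prox
  obtain ⟨N', y', σ', hσ', hN', hpN', rfl⟩ :=
    h.exists_isPosProx_of_isProx_contragredient hΓ hG hγ' e'.symm hb.snd.prox
  have hinv : γ' = γ⁻¹ := by
    obtain ⟨μ, hμ, eμ⟩ := hb.exists_smul
    refine contragredient_injective ?_
    rw [e', map_inv, e]
    exact mk_eq_mk_of_smul (u := M⁻¹) hμ.ne' eμ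
  have hbN := h.isBiprox hpN hpN' (by rw [hN', hN, hinv])
  refine ⟨_, hpN.mem.1, h.isRankOne hΓ hG hd hbN (h.sharp.mem_of_posOn_evalAt ?_) ?_⟩
  · rw [evalAt, map_add]
    exact posOn_add_of_posOn_combination
      (fun g hg => nonneg_of_mem_closure_dualCone hg hpN.vec_mem)
      (fun g hg => nonneg_of_mem_closure_dualCone hg hpN'.vec_mem) hp
  -- The forms come back only up to the signs `σ` and `σ'`; taking these signs again as coefficients
  -- recovers `F + F'`.
  · refine posOn_add_of_posOn_combination hpN.nonneg hpN'.nonneg (a := σ) (b := σ') ?_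
    have h1 : σ * σ = 1 := by rcases hσ with rfl | rfl <;> norm_num
    have h2 : σ' * σ' = 1 := by rcases hσ' with rfl | rfl <;> norm_num
    rw [smul_smul, smul_smul, h1, h2, one_smul, one_smul]
    exact hF

end IsConeOver

end Biproximal

end ConvProj

theorem corollary7p9 {V : Type*} [NormedAddCommGroup V] [NormedSpace ℝ V] [FiniteDimensional ℝ V]
    (hd : 2 ≤ Module.finrank ℝ V)
    (Ω : Set (ℙ ℝ V)) (hopen : IsOpen Ω) (hconv : ConvProj.IsProperlyConvex Ω)
    (Γ : Subgroup (ConvProj.PGL V)) (hdisc : DiscreteTopology Γ) (hΓ : Γ ≤ ConvProj.Aut Ω)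
    (hcc : ConvProj.ActsConvexCocompactly Γ Ω) :
    ((∀ γ ∈ Γ, ConvProj.IsBiproximal γ →
        (ConvProj.axis (ConvProj.contragredient V γ) ∩ ConvProj.dual Ω).Nonempty →
        ConvProj.IsRankOne Ω γ) ∧
      ((ConvProj.bipUnitTangent (Γ.map (ConvProj.contragredient V)) (ConvProj.dual Ω)).Nonempty →
        ConvProj.QuotientIsRankOne Γ Ω)) ∧
    (ConvProj.ActsConvexCocompactly (Γ.map (ConvProj.contragredient V)) (ConvProj.dual Ω) →
      (∀ γ ∈ Γ, ConvProj.IsBiproximal γ → (ConvProj.axis γ ∩ Ω).Nonempty →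
        ConvProj.IsRankOne Ω γ) ∧
      ((ConvProj.bipUnitTangent Γ Ω).Nonempty → ConvProj.QuotientIsRankOne Γ Ω)) := by
  obtain ⟨x, hx⟩ := hcc.1
  obtain ⟨C, hC⟩ := hconv.exists_isConeOver hopen ⟨x, hx.1⟩
  have hseq := ConvProj.seqDiscrete_of_discreteTopology Γ hdisc
  have hG := hC.isCocompactAction hΓ hseq hcc
  refine ⟨⟨fun γ hγ _ hax => hC.isRankOne_of_dual_axis hΓ hG hd hγ hax,
    hC.quotientIsRankOne_of_dual_bipUnitTangent hΓ hG hd⟩, fun hccd => ?_⟩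
  have hGd := hC.dual.isCocompactAction (ConvProj.map_contragredient_le_aut hC hΓ)
    hseq.map_contragredient hccd
  exact ⟨fun γ hγ _ hax => hC.isRankOne_of_axis hΓ hG hd hGd hγ hax,
    hC.quotientIsRankOne_of_bipUnitTangent hΓ hG hd hGd⟩
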